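/- Let $\mu$ be the Haar probability measure on $SO(3)$, let $\lambda$ be the uniform probability measure on the unit sphere $\mathbb S^2\subset\mathbb R^3$, and let $e_z=(0,0,1)$. For $\beta>0$ let $\rho_{\beta,z}$ be the probability measure on $SO(3)$ given by $$\rho_{\beta,z}(d\Omega)=\frac{e^{\beta\langle e_z,\Omega e_z\rangle}}{Z_\beta}\,\mu(d\Omega),\qquad Z_\beta=\int e^{\beta\langle e_z,\Omega e_z\rangle}\,d\mu(\Omega).$$ For a finite set $\Lambda\subset\mathbb Z^3$ let $\vec E(\Lambda)$ be the set of oriented nearest-neighbour edges $(i,j)$ with $i,j\in\Lambda$ (each edge in both orientations). The disorder $\omega=(\Omega_{i,j})_{(i,j)\in\vec E(\Lambda)}$ consists of random rotations of law $\rho_{\beta,z}$ such that $\Omega_{j,i}=\Omega_{i,j}^{-1}$ and such that the rotations on distinct unoriented edges are independent; $\mathbb E_\beta^{\mathrm{Heis}}$ is the expectation with respect to $\omega$. Given $\omega$, let $\langle\cdot\rangle_{\omega,\beta,\Lambda}$ be the expectation with respect to the quenched Gibbs measure (with free boundary conditions) on spin configurations $S\in(\mathbb S^2)^\Lambda$,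 $$dP_\omega(S)\propto\prod_{(i,j)\in\vec E(\Lambda)}\exp\Big(\tfrac\beta2\langle S(i),\Omega_{i,j}S(j)\rangle\Big)\,\lambda^{\otimes\Lambda}(dS).$$ **Theorem.** (1) There exist constants $\beta^*,a>0$ such that for all $\beta\ge\beta^*$, all finite $\Lambda\subset\mathbb Z^3$ and all $x,y\in\Lambda$ such that $\Lambda$ contains every lattice point of the open Euclidean ball $B\big(\tfrac{x+y}2,2\|x-y\|_2\big)$, $$\mathbb E_\beta^{\mathrm{Heis}}\big[\langle S(x)\cdot S(y)\rangle_{\omega,\beta,\Lambda}\big]\ \ge\ 1-\sqrt{\frac{a\log\beta}{\beta}}.$$ (2) There exists $\beta_0>0$ such that for every $0<\beta\le\beta_0$ there is a constant $c(\beta)>0$ such that for all finite $\Lambda\subset\mathbb Z^3$ and all $x,y\in\Lambda$, $$\mathbb E_\beta^{\mathrm{Heis}}\big[\langle S(x)\cdot S(y)\rangle_{\omega,\beta,\Lambda}\big]\ \le\ e^{-c(\beta)\|x-y\|_2}.$$ -/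

import Mathlib

open MeasureTheory

noncomputable section

namespace NishimoriHeisenberg

/-! ### Spins, rotations and their invariant measures -/

/-- Three-dimensional Euclidean space. -/
abbrev R3 : Type := EuclideanSpace ℝ (Fin 3)

/-- The unit sphere `𝕊²`, in which the spins take their values. -/
abbrev S2 : Type := Metric.sphere (0 : R3) 1

/-- The unit vector pointing in the `z` direction. -/
def ez : R3 := EuclideanSpace.single 2 1

/-- The rotation group `SO(3)`, with the topology inherited from the `3 × 3` real matrices. -/
abbrev SO3 : Type := ↥(Matrix.specialOrthogonalGroup (Fin 3) ℝ)

instance : MeasurableSpace SO3 := borel SO3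

instance : BorelSpace SO3 := ⟨rfl⟩

instance : IsTopologicalGroup SO3 where
  continuous_inv := by
    have h : (fun A : SO3 => (A⁻¹ : SO3)) = fun A : SO3 => (star A : SO3) := rfl
    rw [h]
    exact Continuous.subtype_mk (continuous_star.comp continuous_subtype_val) _

instance : CompactSpace SO3 := by
  have hK : IsCompact (Set.univ.pi fun _ : Fin 3 =>
      Set.univ.pi fun _ : Fin 3 => Set.Icc (-1 : ℝ) 1) :=
    isCompact_univ_pi fun _ => isCompact_univ_pi fun _ => isCompact_Icc
  refine isCompact_iff_compactSpace.1 (IsCompact.of_isClosed_subset hK ?_ ?_ :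
    IsCompact (Matrix.specialOrthogonalGroup (Fin 3) ℝ : Set (Matrix (Fin 3) (Fin 3) ℝ)))
  · have h : (Matrix.specialOrthogonalGroup (Fin 3) ℝ : Set (Matrix (Fin 3) (Fin 3) ℝ))
        = {A | A * A.transpose = 1} ∩ {A | A.det = 1} := by
      ext A
      exact Matrix.mem_specialOrthogonalGroup_iff.trans
        (and_congr_left' (Matrix.mem_orthogonalGroup_iff (Fin 3) ℝ))
    rw [h]
    exact (isClosed_eq (by fun_prop) continuous_const).inter
      (isClosed_eq (by fun_prop) continuous_const)
  · intro A hA i _ j _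
    have := entry_norm_bound_of_unitary (Matrix.mem_specialOrthogonalGroup_iff.1 hA).1 i j
    exact abs_le.1 this

/-- The action of a rotation on a vector of `ℝ³`. -/
def rot (A : SO3) (v : R3) : R3 := Matrix.toEuclideanLin (A : Matrix (Fin 3) (Fin 3) ℝ) v

/-- The Haar probability measure on `SO(3)`. -/
def haarSO3 : Measure SO3 := Measure.haarMeasure ⊤

/-- The uniform probability measure on `𝕊²`: the surface measure, divided by its total mass. -/
def unifS2 : Measure S2 :=
  ((volume : Measure R3).toSphere Set.univ)⁻¹ • (volume : Measure R3).toSphere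

/-- The Nishimori law `ρ_{β,z}(dΩ) = Z_β⁻¹ exp (β ⟨e_z, Ω e_z⟩) dμ(Ω)` on `SO(3)`,
where `μ` is the Haar probability measure. -/
def nishimoriLaw (β : ℝ) : Measure SO3 :=
  haarSO3.tilted fun Ω => β * inner ℝ ez (rot Ω ez)

/-! ### Finite domains of `ℤ³` and their edges -/

/-- The sites of the lattice `ℤ³`. -/
abbrev Site : Type := Fin 3 → ℤ

/-- A site of `ℤ³`, as a point of Euclidean space. -/
def toR3 (x : Site) : R3 := WithLp.toLp 2 fun k => (x k : ℝ)

/-- The pair `(i, j)` is an edge of `Λ` oriented in a positive coordinate direction. -/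
def IsPosEdge {Λ : Finset Site} (i j : Λ) : Prop :=
  ∃ k : Fin 3, (j : Site) = (i : Site) + Pi.single k 1

instance {Λ : Finset Site} (i j : Λ) : Decidable (IsPosEdge i j) := by
  unfold IsPosEdge; infer_instance

/-- The positively oriented edges of `Λ`: one orientation of each nearest-neighbour edge
with both endpoints in `Λ`. -/
abbrev PosEdge (Λ : Finset Site) : Type := {e : Λ × Λ // IsPosEdge e.1 e.2}

/-- The set of all oriented nearest-neighbour edges of `Λ`, in both orientations. -/
def orientedEdges (Λ : Finset Site) : Finset (Λ × Λ) :=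
  Finset.univ.filter fun e => IsPosEdge e.1 e.2 ∨ IsPosEdge e.2 e.1

/-! ### The quenched disorder -/

/-- A disorder on `Λ`, given by its values on the positively oriented edges. -/
abbrev Disorder (Λ : Finset Site) : Type := PosEdge Λ → SO3

/-- The rotation `Ω_{i,j}` carried by an oriented edge `(i, j)`; it satisfies
`Ω_{j,i} = Ω_{i,j}⁻¹`. (The value `1` for pairs that are not edges is never used.) -/
def Disorder.rotation {Λ : Finset Site} (ω : Disorder Λ) (i j : Λ) : SO3 :=
  if h : IsPosEdge i j then ω ⟨(i, j), h⟩
  else if h : IsPosEdge j i then (ω ⟨(j, i), h⟩)⁻¹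
  else 1

/-- The law of the disorder: independent rotations of law `ρ_{β,z}` on the edges. This law does
not depend on the orientation chosen, `ρ_{β,z}` being invariant under `Ω ↦ Ω⁻¹`. -/
def disorderLaw (β : ℝ) (Λ : Finset Site) : Measure (Disorder Λ) :=
  Measure.pi fun _ => nishimoriLaw β

/-! ### The quenched Gibbs measure -/

/-- The logarithm of the Gibbs weight of a spin configuration:
`∑ (β/2) ⟨S(i), Ω_{i,j} S(j)⟩`, over all oriented edges `(i, j)` of `Λ`. -/
def logWeight {Λ : Finset Site} (β : ℝ) (ω : Disorder Λ) (S : Λ → S2) : ℝ :=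
  ∑ e ∈ orientedEdges Λ,
    β / 2 * inner ℝ (S e.1 : R3) (rot (ω.rotation e.1 e.2) (S e.2 : R3))

/-- The quenched Gibbs measure `P_ω` on `(𝕊²)^Λ` with free boundary conditions: the probability
measure proportional to `exp (logWeight β ω S) λ^{⊗Λ}(dS)`, with `λ` uniform on `𝕊²`. -/
def gibbs {Λ : Finset Site} (β : ℝ) (ω : Disorder Λ) : Measure (Λ → S2) :=
  (Measure.pi fun _ => unifS2).tilted (logWeight β ω)

/-- The averaged quenched correlation `𝔼_β [⟨S(x) · S(y)⟩_{ω,β,Λ}]`. -/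
def correlation (β : ℝ) (Λ : Finset Site) (x y : Λ) : ℝ :=
  ∫ ω, (∫ S, inner ℝ (S x : R3) (S y : R3) ∂(gibbs β ω)) ∂(disorderLaw β Λ)

/-- The points `x`, `y` are far from the boundary of `Λ`, on the scale of their distance: all
lattice points of the Euclidean ball `B((x + y)/2, 2 ‖x - y‖₂)` belong to `Λ`. -/
def FarFromBoundary (Λ : Finset Site) (x y : Site) : Prop :=
  ∀ z : Site, toR3 z ∈ Metric.ball (midpoint ℝ (toR3 x) (toR3 y)) (2 * ‖toR3 x - toR3 y‖) → z ∈ Λ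

end NishimoriHeisenberg

end

/-! The same `β` governs the disorder and the spins. Hence the law of the disorder is the Haar
measure on edges tilted by the Gibbs weight of the configuration `north` (`disorderLaw_eq`), and
gauge invariance gives `nishimori_identity`: in the average of a gauge invariant observable, a Gibbs
sample may be replaced by `north`. The low temperature problem thereby becomes one of estimation
from rotations planted around `ez`.

Low temperature, first ingredient: `S x` and `S y` have nearly equal `z` components. For a family of
paths from `x` to `y`, average the transports, each divided by its mean `c ^ L`, where `c = meanCos
β`. The resulting operator `M` is gauge covariant, and a second moment computation bounds the mean
of `‖M ez - ez‖ ^ 2` by `B - 1`, where `B` bounds the mean of `c⁻² ^ (number of common steps)` over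
a second path, uniformly in the first (`integral_two_paths_le`, `integral_pathAverage_le`).
Nishimori's identity turns this into `M (S y) ≈ S x`; the adjoint of `M` is the average over the
reversed paths, so `⟨ez, M (S y)⟩ ≈ ⟨ez, S y⟩` as well (`sqDiff_le_of_pathFamily`). For `B` to be `1
+ O(1 - c)` at every distance, directed paths with exponential intersection tails are needed. They
are built from two independent walks whose velocities are sums of random digits over all dyadic
scales: no past determines where such a walk will be later (`sum_walk_eq_le`), and for a pair of
walks the resulting bounds are summable in time (`sum_meetWeight_le`). Reflecting the walks fixes
the endpoint (`sqDiff_diagonal_le`).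

Second ingredient: `S x` is nearly `±ez`. The rotation `L` around a plaquette at `x` almost fixes
`ez`, hence by Nishimori almost fixes `S x`; two vectors almost fixed by `L` are both almost
parallel to its axis, unless `L` is close to the identity (`tr_mul_one_sub_inner_sq_le`). That
exception is controlled by averaging over a rotation about `ez` inserted on one edge, a Poisson
kernel integral (`integral_loop_le`), at the price of the square root in the final bound. The two
ingredients combine in `correlation_ge`, once a half turn at `x` has reduced the correlation to the
`z` components (`correlation_eq`). The input from temperature is `1 - c ≤ 10 log β / β`
(`one_sub_meanCos_le`).

High temperature: the decay holds for every disorder. The Gibbs weight is expanded into nonnegative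
weights of edge sets; sets that do not connect `x` to `y` cancel by a spin flip, and the others
contain a long trail, which a union bound makes exponentially unlikely (`integral_gibbs_inner_le`).
-/

namespace NishimoriHeisenberg

noncomputable section

/-! ### The action of rotations on vectors and on the sphere -/

lemma rot_apply (A : SO3) (v : R3) (i : Fin 3) : rot A v i = ∑ j, A.1 i j * v j := by
  simp [rot, Matrix.toLpLin_apply, Matrix.mulVec, dotProduct]

lemma rot_one (v : R3) : rot 1 v = v := by
  ext i; simp [rot]

lemma rot_mul (A B : SO3) (v : R3) : rot (A * B) v = rot A (rot B v) := by
  simp [rot, Matrix.toLpLin_mul_same]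

lemma rot_inv_rot (A : SO3) (v : R3) : rot A⁻¹ (rot A v) = v := by
  rw [← rot_mul, inv_mul_cancel, rot_one]

lemma rot_rot_inv (A : SO3) (v : R3) : rot A (rot A⁻¹ v) = v := by
  rw [← rot_mul, mul_inv_cancel, rot_one]

lemma rot_add (A : SO3) (v w : R3) : rot A (v + w) = rot A v + rot A w := by simp [rot]

lemma rot_sub (A : SO3) (v w : R3) : rot A (v - w) = rot A v - rot A w := by simp [rot]

lemma rot_neg (A : SO3) (v : R3) : rot A (-v) = -rot A v := by simp [rot]

lemma rot_smul (A : SO3) (a : ℝ) (v : R3) : rot A (a • v) = a • rot A v := by simp [rot]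

lemma inv_apply (A : SO3) (i j : Fin 3) : (A⁻¹ : SO3).1 i j = A.1 j i := rfl

lemma inner_R3 (v w : R3) : inner ℝ v w = ∑ i, v i * w i := by
  simp [PiLp.inner_apply, mul_comm]

lemma inner_rot_left (A : SO3) (v w : R3) : inner ℝ (rot A v) w = inner ℝ v (rot A⁻¹ w) := by
  simp only [inner_R3, rot_apply, inv_apply, Fin.sum_univ_three]; ring

lemma inner_rot_right (A : SO3) (v w : R3) : inner ℝ v (rot A w) = inner ℝ (rot A⁻¹ v) w := by
  simp only [inner_R3, rot_apply, inv_apply, Fin.sum_univ_three]; ring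

lemma inner_rot_rot (A : SO3) (v w : R3) : inner ℝ (rot A v) (rot A w) = inner ℝ v w := by
  rw [inner_rot_left, rot_inv_rot]

lemma norm_rot (A : SO3) (v : R3) : ‖rot A v‖ = ‖v‖ := by
  rw [@norm_eq_sqrt_real_inner, @norm_eq_sqrt_real_inner _ _ _ v, inner_rot_rot]

lemma continuous_entry (i j : Fin 3) : Continuous fun A : SO3 => A.1 i j :=
  (continuous_apply j).comp ((continuous_apply i).comp continuous_subtype_val)

lemma continuous_rot : Continuous fun p : SO3 × R3 => rot p.1 p.2 := by
  refine (PiLp.continuous_toLp 2 _).comp (continuous_pi fun i => ?_)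
  change Continuous fun p : SO3 × R3 => ∑ j, p.1.1 i j * p.2 j
  refine continuous_finsetSum _ fun j _ => ?_
  exact ((continuous_entry i j).comp continuous_fst).mul
    ((EuclideanSpace.proj (𝕜 := ℝ) j).continuous.comp continuous_snd)

@[fun_prop]
lemma cont_rot {X : Type*} [TopologicalSpace X] {A : X → SO3} {v : X → R3}
    (hA : Continuous A) (hv : Continuous v) : Continuous fun x => rot (A x) (v x) :=
  continuous_rot.comp (hA.prodMk hv)

instance : SecondCountableTopology SO3 := by
  have : SecondCountableTopology (Matrix (Fin 3) (Fin 3) ℝ) :=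
    inferInstanceAs (SecondCountableTopology (Fin 3 → Fin 3 → ℝ))
  exact TopologicalSpace.Subtype.secondCountableTopology _

/-- The action of a rotation on the sphere. -/
def rotS (A : SO3) (s : S2) : S2 :=
  ⟨rot A s, by rw [mem_sphere_zero_iff_norm, norm_rot]; exact norm_eq_of_mem_sphere s⟩

@[simp] lemma coe_rotS (A : SO3) (s : S2) : (rotS A s : R3) = rot A s := rfl

lemma rotS_one (s : S2) : rotS 1 s = s := Subtype.ext (rot_one _)

lemma rotS_mul (A B : SO3) (s : S2) : rotS (A * B) s = rotS A (rotS B s) :=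
  Subtype.ext (rot_mul _ _ _)

@[fun_prop]
lemma cont_rotS {X : Type*} [TopologicalSpace X] {A : X → SO3} {v : X → S2}
    (hA : Continuous A) (hv : Continuous v) : Continuous fun x => rotS (A x) (v x) :=
  Continuous.subtype_mk (cont_rot hA (continuous_subtype_val.comp hv)) _

/-- The north pole of the sphere. -/
def ezS : S2 := ⟨ez, by simp [ez]⟩

@[simp] lemma coe_ezS : (ezS : R3) = ez := rfl

lemma norm_ez : ‖ez‖ = 1 := by simp [ez]

lemma ez_apply (i : Fin 3) : ez i = if i = 2 then 1 else 0 := by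
  simp [ez]

lemma inner_ez (v : R3) : inner ℝ ez v = v 2 := by
  simp [inner_R3, ez_apply]

lemma inner_ez' (v : R3) : inner ℝ v ez = v 2 := by
  simp [inner_R3, ez_apply]

lemma rot_ez_apply (A : SO3) (i : Fin 3) : rot A ez i = A.1 i 2 := by
  simp [rot_apply, ez_apply]

lemma inner_ez_rot_ez (A : SO3) : inner ℝ ez (rot A ez) = A.1 2 2 := by
  rw [inner_ez, rot_ez_apply]

/-! ### Coordinate rotations and transitivity on the sphere -/

lemma mem_SO3 {A : Matrix (Fin 3) (Fin 3) ℝ} (h : A * A.transpose = 1) (hd : A.det = 1) :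
    A ∈ Matrix.specialOrthogonalGroup (Fin 3) ℝ :=
  Matrix.mem_specialOrthogonalGroup_iff.2 ⟨(Matrix.mem_orthogonalGroup_iff (Fin 3) ℝ).2 h, hd⟩

lemma mul_transpose_SO3 (A : SO3) : A.1 * A.1.transpose = 1 :=
  (Matrix.mem_orthogonalGroup_iff (Fin 3) ℝ).1 (Matrix.mem_specialOrthogonalGroup_iff.1 A.2).1

lemma transpose_mul_SO3 (A : SO3) : A.1.transpose * A.1 = 1 :=
  (Matrix.mem_orthogonalGroup_iff' (Fin 3) ℝ).1 (Matrix.mem_specialOrthogonalGroup_iff.1 A.2).1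

lemma det_SO3 (A : SO3) : A.1.det = 1 := (Matrix.mem_specialOrthogonalGroup_iff.1 A.2).2

/-- The rotation about the `z` axis with cosine `p` and sine `q`. -/
def rotZ (p q : ℝ) (h : p ^ 2 + q ^ 2 = 1) : SO3 :=
  ⟨!![p, -q, 0; q, p, 0; 0, 0, 1], by
    refine mem_SO3 ?_ ?_
    · ext i j
      fin_cases i <;> fin_cases j <;>
        simp [Matrix.mul_apply, Fin.sum_univ_three] <;> nlinarith
    · simp [Matrix.det_fin_three]; nlinarith⟩

/-- The rotation about the `y` axis with cosine `p` and sine `q`. -/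
def rotY (p q : ℝ) (h : p ^ 2 + q ^ 2 = 1) : SO3 :=
  ⟨!![p, 0, q; 0, 1, 0; -q, 0, p], by
    refine mem_SO3 ?_ ?_
    · ext i j
      fin_cases i <;> fin_cases j <;>
        simp [Matrix.mul_apply, Fin.sum_univ_three] <;> nlinarith
    · simp [Matrix.det_fin_three]; nlinarith⟩

lemma sum_sq_S2 (s : S2) : s.1 0 ^ 2 + s.1 1 ^ 2 + s.1 2 ^ 2 = 1 := by
  have h := norm_eq_of_mem_sphere s
  rw [EuclideanSpace.norm_eq, Real.sqrt_eq_one, Fin.sum_univ_three] at h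
  simpa using h

lemma exists_rotS_eq (s : S2) : ∃ A : SO3, rotS A ezS = s := by
  have hs := sum_sq_S2 s
  set r := Real.sqrt (s.1 0 ^ 2 + s.1 1 ^ 2) with hr
  have hr2 : r ^ 2 = s.1 0 ^ 2 + s.1 1 ^ 2 := Real.sq_sqrt (by positivity)
  have hY : s.1 2 ^ 2 + r ^ 2 = 1 := by rw [hr2]; linarith
  obtain ⟨p, q, hpq, hp, hq⟩ : ∃ p q : ℝ, p ^ 2 + q ^ 2 = 1 ∧ p * r = s.1 0 ∧ q * r = s.1 1 := by
    by_cases h0 : r = 0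
    · have : s.1 0 ^ 2 + s.1 1 ^ 2 = 0 := by rw [← hr2, h0]; ring
      refine ⟨1, 0, by norm_num, ?_, ?_⟩ <;> rw [h0] <;> nlinarith [sq_nonneg (s.1 0), sq_nonneg (s.1 1)]
    · refine ⟨s.1 0 / r, s.1 1 / r, ?_, by field_simp, by field_simp⟩
      rw [div_pow, div_pow, ← add_div, ← hr2, div_self (pow_ne_zero 2 h0)]
  -- Spherical coordinates: tilt the pole by the polar angle about `y`, then turn by the azimuth
  -- about `z`. At the poles the azimuth is arbitrary, whence the case `r = 0` above.
  refine ⟨rotZ p q hpq * rotY (s.1 2) r hY, Subtype.ext ?_⟩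
  rw [rotS_mul, coe_rotS, coe_rotS]
  ext i
  fin_cases i <;> simp [rot_apply, rotZ, rotY, Fin.sum_univ_three, ez_apply, hp, hq]

/-! ### Haar measure on the rotation group and the uniform measure on the sphere -/

instance : IsProbabilityMeasure haarSO3 := ⟨Measure.haarMeasure_self⟩

instance : haarSO3.IsHaarMeasure := by unfold haarSO3; infer_instance

instance : haarSO3.IsMulRightInvariant := by
  refine ⟨fun g => ?_⟩
  have : IsProbabilityMeasure (Measure.map (· * g) haarSO3) :=
    Measure.isProbabilityMeasure_map (measurable_mul_const g).aemeasurable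
  exact Measure.isHaarMeasure_eq_of_isProbabilityMeasure _ _

instance : haarSO3.IsInvInvariant := by
  refine ⟨?_⟩
  have : IsProbabilityMeasure haarSO3.inv :=
    Measure.isProbabilityMeasure_map measurable_inv.aemeasurable
  have : haarSO3.inv.IsMulLeftInvariant := inferInstance
  have : haarSO3.inv.IsHaarMeasure :=
    Measure.isHaarMeasure_of_isCompact_nonempty_interior _ Set.univ isCompact_univ
      (by simp) (by simp) (by simp)
  exact Measure.isHaarMeasure_eq_of_isProbabilityMeasure _ _

lemma toSphere_univ_ne_zero : (volume : Measure R3).toSphere Set.univ ≠ 0 := by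
  rw [Ne, Measure.measure_univ_eq_zero]; exact Measure.toSphere_ne_zero _

instance : IsProbabilityMeasure unifS2 :=
  ⟨ENNReal.inv_mul_cancel toSphere_univ_ne_zero (measure_ne_top _ _)⟩

/-- The surface measure of a set is a multiple of the volume of the cone over it, and a linear
isometry maps cones to cones and preserves volume. -/
lemma measurePreserving_unifS2 (f : R3 ≃ₗᵢ[ℝ] R3) {g : S2 → S2} (hg : Continuous g)
    (hfg : ∀ s, (g s : R3) = f s) : MeasurePreserving g unifS2 unifS2 := by
  refine ⟨hg.measurable, ?_⟩
  unfold unifS2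
  rw [Measure.map_smul]
  congr 1
  ext t ht
  rw [Measure.map_apply hg.measurable ht, Measure.toSphere_apply' _ ht,
    Measure.toSphere_apply' _ (hg.measurable ht)]
  congr 1
  conv_rhs => rw [← f.measurePreserving.measure_preimage_equiv (f := f.toHomeomorph.toMeasurableEquiv)]
  congr 1
  ext v
  simp only [Set.mem_smul, Set.mem_image, Set.mem_preimage]
  constructor
  · rintro ⟨a, ha, _, ⟨s, hs, rfl⟩, rfl⟩
    exact ⟨a, ha, _, ⟨g s, hs, rfl⟩, by rw [hfg]; exact (map_smul f a (s : R3)).symm⟩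
  · rintro ⟨a, ha, _, ⟨s, hs, rfl⟩, hv⟩
    have hmem : f.symm s ∈ Metric.sphere (0 : R3) 1 := by simp
    refine ⟨a, ha, f.symm s, ⟨⟨f.symm s, hmem⟩, ?_, rfl⟩, ?_⟩
    · have : g ⟨f.symm s, hmem⟩ = s := Subtype.ext (by simp [hfg])
      rwa [this]
    · have hv' : a • (s : R3) = f v := hv
      rw [← map_smul, hv', f.symm_apply_apply]

/-- A rotation, as a linear isometry. -/
def rotIso (A : SO3) : R3 ≃ₗᵢ[ℝ] R3 where
  toFun := rot A
  invFun := rot A⁻¹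
  left_inv := rot_inv_rot A
  right_inv := rot_rot_inv A
  map_add' := rot_add A
  map_smul' := rot_smul A
  norm_map' := norm_rot A

lemma measurePreserving_rotS (A : SO3) : MeasurePreserving (rotS A) unifS2 unifS2 :=
  measurePreserving_unifS2 (rotIso A) (by fun_prop) fun _ => rfl

lemma measurePreserving_neg_S2 : MeasurePreserving (fun s : S2 => -s) unifS2 unifS2 :=
  measurePreserving_unifS2 (LinearIsometryEquiv.neg ℝ) continuous_neg fun _ => rfl

/-- The image of a Haar distributed rotation of the north pole is uniform on the sphere. -/
lemma measurePreserving_rotS_ezS :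
    MeasurePreserving (fun A : SO3 => rotS A ezS) haarSO3 unifS2 := by
  have hc : Continuous fun A : SO3 => rotS A ezS := by fun_prop
  refine ⟨hc.measurable, ?_⟩
  ext t ht
  have hc2 : Continuous fun p : SO3 × S2 => rotS p.1 p.2 := by fun_prop
  have key : ∀ s : S2, haarSO3 ((fun A => rotS A s) ⁻¹' t) = haarSO3 ((fun A => rotS A ezS) ⁻¹' t) := by
    intro s
    obtain ⟨B, rfl⟩ := exists_rotS_eq s
    have : (fun A => rotS A (rotS B ezS)) ⁻¹' t
        = (fun A => A * B) ⁻¹' ((fun A => rotS A ezS) ⁻¹' t) := by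
      ext A; simp [rotS_mul]
    rw [this, measure_preimage_mul_right]
  -- The product measure of the pairs `(A, s)` with `rotS A s ∈ t` is computed in both orders. One
  -- order gives `unifS2 t` by invariance; in the other, `key` makes the slices independent of `s`.
  have h1 := Measure.prod_apply (μ := haarSO3) (ν := unifS2) (hc2.measurable ht)
  have h2 := Measure.prod_apply_symm (μ := haarSO3) (ν := unifS2) (hc2.measurable ht)
  rw [h1] at h2
  have e1 : ∀ A : SO3, unifS2 (Prod.mk A ⁻¹' ((fun p : SO3 × S2 => rotS p.1 p.2) ⁻¹' t)) = unifS2 t :=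
    fun A => (measurePreserving_rotS A).measure_preimage ht.nullMeasurableSet
  have e2 : ∀ s : S2, haarSO3 ((fun A => (A, s)) ⁻¹' ((fun p : SO3 × S2 => rotS p.1 p.2) ⁻¹' t))
      = haarSO3 ((fun A => rotS A ezS) ⁻¹' t) := key
  simp only [e1, e2, lintegral_const, measure_univ, mul_one] at h2
  rw [Measure.map_apply hc.measurable ht, h2]

/-! ### Tilted measures on compact spaces -/

lemma integrable_of_cont {X : Type*} [TopologicalSpace X] [CompactSpace X] [MeasurableSpace X]
    [OpensMeasurableSpace X] (μ : Measure X) [IsFiniteMeasure μ] {f : X → ℝ} (hf : Continuous f) :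
    Integrable f μ :=
  hf.integrable_of_hasCompactSupport (HasCompactSupport.of_compactSpace f)

lemma measurePreserving_tilted {X : Type*} [MeasurableSpace X] {μ : Measure X} {g : X → X}
    (hg : MeasurePreserving g μ μ) {f : X → ℝ} (hf : Measurable f) (hfg : ∀ x, f (g x) = f x) :
    MeasurePreserving g (μ.tilted f) (μ.tilted f) := by
  refine ⟨hg.measurable, ?_⟩
  ext t ht
  rw [Measure.map_apply hg.measurable ht, tilted_apply' _ _ (hg.measurable ht),
    tilted_apply' _ _ ht]
  have hm : Measurable fun a => ENNReal.ofReal (Real.exp (f a) / ∫ x, Real.exp (f x) ∂μ) := by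
    fun_prop
  rw [← hg.setLIntegral_comp_preimage ht hm]
  simp only [hfg]

/-- Both the density and its normalization factor over the coordinates, the exponential turning the
sum into a product. -/
lemma pi_tilted {ι X : Type*} [Fintype ι] [MeasurableSpace X] (μ : Measure X)
    [IsProbabilityMeasure μ] (f : X → ℝ) (hf : Integrable (fun x => Real.exp (f x)) μ) :
    Measure.pi (fun _ : ι => μ.tilted f) = (Measure.pi fun _ : ι => μ).tilted fun ω => ∑ i, f (ω i) := by
  have hp : IsProbabilityMeasure (μ.tilted f) := isProbabilityMeasure_tilted hf
  refine Measure.pi_eq fun s hs => ?_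
  have e1 : ∀ i, (μ.tilted f) (s i)
      = ENNReal.ofReal (∫ x, (s i).indicator (fun x => Real.exp (f x) / ∫ y, Real.exp (f y) ∂μ) x ∂μ) := by
    intro i
    rw [tilted_apply_eq_ofReal_integral' _ (hs i), integral_indicator (hs i)]
  simp only [e1]
  rw [← ENNReal.ofReal_prod_of_nonneg, ← integral_fintype_prod_eq_prod,
    tilted_apply_eq_ofReal_integral' _ (MeasurableSet.univ_pi hs), ← integral_indicator
      (MeasurableSet.univ_pi hs)]
  · congr 2
    ext ω
    have hZ : ∫ ω : ι → X, Real.exp (∑ i, f (ω i)) ∂(Measure.pi fun _ => μ)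
        = ∏ _i : ι, ∫ y, Real.exp (f y) ∂μ := by
      simp only [Real.exp_sum]
      exact integral_fintype_prod_eq_prod (fun _ x => Real.exp (f x))
    by_cases h : ω ∈ Set.univ.pi s
    · rw [Set.indicator_of_mem h, hZ, Real.exp_sum, ← Finset.prod_div_distrib]
      exact Finset.prod_congr rfl fun i _ => by rw [Set.indicator_of_mem (h i trivial)]
    · rw [Set.indicator_of_notMem h]
      simp only [Set.mem_pi, Set.mem_univ, true_implies, not_forall] at h
      obtain ⟨i, hi⟩ := h
      exact (Finset.prod_eq_zero (Finset.mem_univ i) (Set.indicator_of_notMem hi _)).symm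
  · intro i _
    exact integral_nonneg fun x => Set.indicator_nonneg (fun y _ => div_nonneg (Real.exp_pos _).le
      (integral_nonneg fun _ => (Real.exp_pos _).le)) _

/-- Under a product of identical probability measures, a coordinate can be resampled. -/
lemma measurePreserving_resample {ι X : Type*} [Fintype ι] [DecidableEq ι] [MeasurableSpace X]
    (μ : Measure X) [IsProbabilityMeasure μ] (i : ι) :
    MeasurePreserving (fun p : (ι → X) × X => Function.update p.1 i p.2)
      ((Measure.pi fun _ : ι => μ).prod μ) (Measure.pi fun _ : ι => μ) := by
  have hm : Measurable fun p : (ι → X) × X => Function.update p.1 i p.2 := by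
    refine measurable_pi_lambda _ fun j => ?_
    by_cases h : j = i
    · subst h; simpa using measurable_snd
    · simp only [Function.update_of_ne h]
      exact (measurable_pi_apply j).comp measurable_fst
  refine ⟨hm, (Measure.pi_eq fun s hs => ?_).symm⟩
  rw [Measure.map_apply hm (MeasurableSet.univ_pi hs)]
  have : (fun p : (ι → X) × X => Function.update p.1 i p.2) ⁻¹' Set.univ.pi s
      = (Set.univ.pi (Function.update s i Set.univ)) ×ˢ s i := by
    ext p
    simp only [Set.mem_preimage, Set.mem_pi, Set.mem_univ, true_implies, Set.mem_prod]
    constructor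
    · intro h
      refine ⟨fun j => ?_, by simpa using h i⟩
      by_cases hj : j = i
      · subst hj; simp
      · simpa [Function.update_of_ne hj] using h j
    · rintro ⟨h1, h2⟩ j
      by_cases hj : j = i
      · subst hj; simpa using h2
      · simpa [Function.update_of_ne hj] using h1 j
  rw [this, Measure.prod_prod, Measure.pi_pi, ← Finset.mul_prod_erase _ _ (Finset.mem_univ i),
    ← Finset.mul_prod_erase _ (fun j => μ (s j)) (Finset.mem_univ i)]
  simp only [Function.update_self, measure_univ, one_mul]
  rw [mul_comm]
  congr 1
  refine Finset.prod_congr rfl fun j hj => ?_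
  rw [Function.update_of_ne (Finset.ne_of_mem_erase hj)]

lemma integral_resample {ι X : Type*} [Fintype ι] [DecidableEq ι] [MeasurableSpace X]
    [TopologicalSpace X] [CompactSpace X] [SecondCountableTopology X] [BorelSpace X]
    (μ : Measure X) [IsProbabilityMeasure μ] (i : ι) {F : (ι → X) → ℝ} (hF : Continuous F) :
    ∫ ω, F ω ∂(Measure.pi fun _ : ι => μ)
      = ∫ ω, ∫ r, F (Function.update ω i r) ∂μ ∂(Measure.pi fun _ : ι => μ) := by
  have hmp := measurePreserving_resample (ι := ι) μ i
  have hc : Continuous fun p : (ι → X) × X => F (Function.update p.1 i p.2) := by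
    fun_prop
  rw [← hmp.map_eq, integral_map hmp.measurable.aemeasurable
    (hF.measurable.stronglyMeasurable.aestronglyMeasurable), hmp.map_eq,
    integral_prod _ (integrable_of_cont _ hc)]

/-! ### Edges and the logarithmic weight -/

variable {Λ : Finset Site}

lemma IsPosEdge.asymm {i j : Λ} (h : IsPosEdge i j) : ¬ IsPosEdge j i := by
  rintro ⟨l, hl⟩
  obtain ⟨k, hk⟩ := h
  rw [hk, add_assoc] at hl
  have h0 := congrFun (add_eq_left.1 hl.symm) k
  by_cases hkl : k = l
  · subst hkl; simp at h0
  · simp [Pi.single_eq_of_ne hkl] at h0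

lemma rotation_pos (ω : Disorder Λ) {i j : Λ} (h : IsPosEdge i j) :
    ω.rotation i j = ω ⟨(i, j), h⟩ := by
  simp [Disorder.rotation, h]

lemma rotation_neg (ω : Disorder Λ) {i j : Λ} (h : IsPosEdge j i) :
    ω.rotation i j = (ω ⟨(j, i), h⟩)⁻¹ := by
  simp [Disorder.rotation, h, h.asymm]

/-- The two orientations of an edge contribute equally, because the inverse of a rotation is its
adjoint; this absorbs the factor `1 / 2`. -/
lemma logWeight_eq (β : ℝ) (ω : Disorder Λ) (S : Λ → S2) :
    logWeight β ω S
      = ∑ e : PosEdge Λ, β * inner ℝ (S e.1.1 : R3) (rot (ω e) (S e.1.2 : R3)) := by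
  have hsplit : orientedEdges Λ = Finset.univ.filter (fun e : Λ × Λ => IsPosEdge e.1 e.2) ∪
      Finset.univ.filter (fun e : Λ × Λ => IsPosEdge e.2 e.1) := by
    simp [orientedEdges, Finset.filter_or]
  have hdisj : Disjoint (Finset.univ.filter (fun e : Λ × Λ => IsPosEdge e.1 e.2))
      (Finset.univ.filter (fun e : Λ × Λ => IsPosEdge e.2 e.1)) := by
    rw [Finset.disjoint_filter]
    exact fun e _ h => h.asymm
  have hpos : ∑ e ∈ Finset.univ.filter (fun e : Λ × Λ => IsPosEdge e.1 e.2),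
      β / 2 * inner ℝ (S e.1 : R3) (rot (ω.rotation e.1 e.2) (S e.2 : R3))
      = ∑ e : PosEdge Λ, β / 2 * inner ℝ (S e.1.1 : R3) (rot (ω e) (S e.1.2 : R3)) := by
    rw [Finset.sum_subtype (p := fun e : Λ × Λ => IsPosEdge e.1 e.2) _ (by simp)]
    refine Finset.sum_congr rfl fun e _ => ?_
    rw [rotation_pos ω e.2]
  have hneg : ∑ e ∈ Finset.univ.filter (fun e : Λ × Λ => IsPosEdge e.2 e.1),
      β / 2 * inner ℝ (S e.1 : R3) (rot (ω.rotation e.1 e.2) (S e.2 : R3))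
      = ∑ e ∈ Finset.univ.filter (fun e : Λ × Λ => IsPosEdge e.1 e.2),
      β / 2 * inner ℝ (S e.1 : R3) (rot (ω.rotation e.1 e.2) (S e.2 : R3)) := by
    refine Finset.sum_bij (fun e _ => e.swap) (by simp) (by simp) (fun e he => ⟨e.swap, ?_⟩) ?_
    · simpa using he
    · intro e he
      have he' : IsPosEdge e.2 e.1 := by simpa using he
      simp only [Prod.fst_swap, Prod.snd_swap]
      rw [rotation_pos ω he', rotation_neg ω he', ← inner_rot_left, real_inner_comm]
  rw [logWeight, hsplit, Finset.sum_union hdisj, hneg, hpos, ← Finset.sum_add_distrib]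
  refine Finset.sum_congr rfl fun e _ => ?_
  ring

lemma cont_coe_S2 {X : Type*} [TopologicalSpace X] {f : X → S2} (hf : Continuous f) :
    Continuous fun x => (f x : R3) := continuous_subtype_val.comp hf

@[fun_prop]
lemma cont_logWeight (β : ℝ) {X : Type*} [TopologicalSpace X] {ω : X → Disorder Λ}
    {S : X → Λ → S2} (hω : Continuous ω) (hS : Continuous S) :
    Continuous fun x => logWeight β (ω x) (S x) := by
  simp only [logWeight_eq]
  refine continuous_finsetSum _ fun e _ => continuous_const.mul (Continuous.inner ?_ (cont_rot ?_ ?_))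
  · exact cont_coe_S2 ((continuous_apply _).comp hS)
  · exact (continuous_apply _).comp hω
  · exact cont_coe_S2 ((continuous_apply _).comp hS)


/-! ### The Nishimori law -/

lemma nishimori_weight_cont (β : ℝ) : Continuous fun Ω : SO3 => β * inner ℝ ez (rot Ω ez) := by
  fun_prop

instance (β : ℝ) : IsProbabilityMeasure (nishimoriLaw β) :=
  isProbabilityMeasure_tilted (integrable_of_cont _ (Real.continuous_exp.comp (nishimori_weight_cont β)))

instance (β : ℝ) : IsProbabilityMeasure (disorderLaw β Λ) := by
  unfold disorderLaw; infer_instance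

instance (β : ℝ) (ω : Disorder Λ) : IsProbabilityMeasure (gibbs β ω) :=
  isProbabilityMeasure_tilted (integrable_of_cont _ (Real.continuous_exp.comp (by fun_prop)))

/-- The product of the Haar measures over the edges. -/
def haarEdges (Λ : Finset Site) : Measure (Disorder Λ) := Measure.pi fun _ => haarSO3

instance : IsProbabilityMeasure (haarEdges Λ) := by unfold haarEdges; infer_instance

/-- The product of the uniform measures over the sites. -/
def unifSpins (Λ : Finset Site) : Measure (Λ → S2) := Measure.pi fun _ => unifS2

instance : IsProbabilityMeasure (unifSpins Λ) := by unfold unifSpins; infer_instance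

lemma gibbs_eq (β : ℝ) (ω : Disorder Λ) : gibbs β ω = (unifSpins Λ).tilted (logWeight β ω) := rfl

/-- The spin configuration pointing to the north pole everywhere. -/
def north (Λ : Finset Site) : Λ → S2 := fun _ => ezS

/-- This is the Nishimori condition: the disorder has the same weight as the spins, frozen at the
north pole, at the same inverse temperature. -/
lemma disorderLaw_eq (β : ℝ) :
    disorderLaw β Λ = (haarEdges Λ).tilted fun ω => logWeight β ω (north Λ) := by
  unfold disorderLaw nishimoriLaw haarEdges
  rw [pi_tilted _ _ (integrable_of_cont _ (Real.continuous_exp.comp (nishimori_weight_cont β)))]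
  congr 1
  ext ω
  rw [logWeight_eq]
  rfl

/-! ### Gauge transformations -/

/-- The gauge transformation of the disorder by a field of rotations. -/
def gauge (θ : Λ → SO3) (ω : Disorder Λ) : Disorder Λ := fun e => θ e.1.1 * ω e * (θ e.1.2)⁻¹

/-- The action of a field of rotations on spin configurations. -/
def rotSpins (θ : Λ → SO3) (S : Λ → S2) : Λ → S2 := fun i => rotS (θ i) (S i)

@[fun_prop]
lemma cont_rotSpins {X : Type*} [TopologicalSpace X] {θ : X → Λ → SO3} {S : X → Λ → S2}
    (hθ : Continuous θ) (hS : Continuous S) : Continuous fun x => rotSpins (θ x) (S x) :=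
  continuous_pi fun i => cont_rotS ((continuous_apply i).comp hθ) ((continuous_apply i).comp hS)

lemma logWeight_gauge (β : ℝ) (θ : Λ → SO3) (ω : Disorder Λ) (S : Λ → S2) :
    logWeight β (gauge θ ω) (rotSpins θ S) = logWeight β ω S := by
  rw [logWeight_eq, logWeight_eq]
  refine Finset.sum_congr rfl fun e _ => ?_
  simp only [gauge, rotSpins, coe_rotS, rot_mul, rot_inv_rot, inner_rot_rot]

lemma rotation_gauge (θ : Λ → SO3) (ω : Disorder Λ) {i j : Λ} (h : IsPosEdge i j ∨ IsPosEdge j i) :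
    (gauge θ ω).rotation i j = θ i * ω.rotation i j * (θ j)⁻¹ := by
  rcases h with h | h
  · rw [rotation_pos _ h, rotation_pos _ h, gauge]
  · rw [rotation_neg _ h, rotation_neg _ h, gauge]; simp [mul_assoc]

lemma measurePreserving_gauge (θ : Λ → SO3) :
    MeasurePreserving (gauge θ) (haarEdges Λ) (haarEdges Λ) := by
  refine measurePreserving_pi (fun _ => haarSO3) (fun _ => haarSO3)
    (f := fun (e : PosEdge Λ) Ω => θ e.1.1 * Ω * (θ e.1.2)⁻¹) fun e => ?_
  exact (measurePreserving_mul_right haarSO3 _).comp (measurePreserving_mul_left haarSO3 _)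

lemma measurePreserving_rotSpins (θ : Λ → SO3) :
    MeasurePreserving (rotSpins θ) (unifSpins Λ) (unifSpins Λ) :=
  measurePreserving_pi (fun _ => unifS2) (fun _ => unifS2) fun i => measurePreserving_rotS (θ i)

lemma measurePreserving_rotSpins_north :
    MeasurePreserving (fun θ : Λ → SO3 => rotSpins θ (north Λ)) (Measure.pi fun _ => haarSO3)
      (unifSpins Λ) :=
  measurePreserving_pi (fun _ => haarSO3) (fun _ => unifS2) fun _ => measurePreserving_rotS_ezS

lemma integral_comp_of_cont {X Y : Type*} [TopologicalSpace Y] [MeasurableSpace X]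
    [MeasurableSpace Y] [OpensMeasurableSpace Y]
    {μ : Measure X} {ν : Measure Y} {g : X → Y} (hg : MeasurePreserving g μ ν) {f : Y → ℝ}
    (hf : Continuous f) : ∫ x, f (g x) ∂μ = ∫ y, f y ∂ν := by
  rw [← hg.map_eq, integral_map hg.measurable.aemeasurable
    hf.measurable.stronglyMeasurable.aestronglyMeasurable]

lemma integral_gibbs (β : ℝ) (ω : Disorder Λ) (F : (Λ → S2) → ℝ) :
    ∫ S, F S ∂(gibbs β ω) = (∫ S, Real.exp (logWeight β ω S) * F S ∂(unifSpins Λ)) /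
      ∫ S, Real.exp (logWeight β ω S) ∂(unifSpins Λ) := by
  rw [gibbs_eq, integral_tilted, ← integral_div]
  congr 1; ext S; simp only [smul_eq_mul]; ring

lemma integral_disorderLaw (β : ℝ) (F : Disorder Λ → ℝ) :
    ∫ ω, F ω ∂(disorderLaw β Λ)
      = (∫ ω, Real.exp (logWeight β ω (north Λ)) * F ω ∂(haarEdges Λ)) /
      ∫ ω, Real.exp (logWeight β ω (north Λ)) ∂(haarEdges Λ) := by
  rw [disorderLaw_eq, integral_tilted, ← integral_div]
  congr 1; ext S; simp only [smul_eq_mul]; ring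

lemma partition_pos (β : ℝ) (ω : Disorder Λ) :
    0 < ∫ S, Real.exp (logWeight β ω S) ∂(unifSpins Λ) :=
  integral_exp_pos (integrable_of_cont _ (Real.continuous_exp.comp (by fun_prop)))

lemma cont_integral {X Y : Type*} [TopologicalSpace X] [FirstCountableTopology X] [LocallyCompactSpace X]
    [TopologicalSpace Y] [CompactSpace Y]
    [MeasurableSpace Y] [OpensMeasurableSpace Y] (μ : Measure Y)
    [IsFiniteMeasure μ] {F : X → Y → ℝ} (hF : Continuous (Function.uncurry F)) :
    Continuous fun x => ∫ y, F x y ∂μ :=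
  by simpa using continuous_parametric_integral_of_continuous hF isCompact_univ (μ := μ)

lemma cont_gibbs (β : ℝ) {F : Disorder Λ → (Λ → S2) → ℝ} (hF : Continuous (Function.uncurry F)) :
    Continuous fun ω => ∫ S, F ω S ∂(gibbs β ω) := by
  simp only [integral_gibbs]
  refine Continuous.div (cont_integral _ ?_) (cont_integral _ ?_) fun ω => (partition_pos β ω).ne'
  · have h : Continuous fun p : Disorder Λ × (Λ → S2) => logWeight β p.1 p.2 := by fun_prop
    exact (Real.continuous_exp.comp h).mul hF
  · have h : Continuous fun p : Disorder Λ × (Λ → S2) => logWeight β p.1 p.2 := by fun_prop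
    exact Real.continuous_exp.comp h

lemma integral_gibbs_gauge (β : ℝ) (θ : Λ → SO3) (ω : Disorder Λ) {F : (Λ → S2) → ℝ}
    (hF : Continuous F) :
    ∫ S, F S ∂(gibbs β (gauge θ ω)) = ∫ S, F (rotSpins θ S) ∂(gibbs β ω) := by
  have hc : Continuous fun S : Λ → S2 => logWeight β (gauge θ ω) S := by fun_prop
  rw [integral_gibbs, integral_gibbs,
    ← integral_comp_of_cont (measurePreserving_rotSpins θ)
      (f := fun S => Real.exp (logWeight β (gauge θ ω) S) * F S) ((Real.continuous_exp.comp hc).mul hF),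
    ← integral_comp_of_cont (measurePreserving_rotSpins θ)
      (f := fun S => Real.exp (logWeight β (gauge θ ω) S)) (Real.continuous_exp.comp hc)]
  simp only [logWeight_gauge]

/-- For gauge invariant functions, averaging over the disorder in the fixed gauge amounts to
averaging over the Haar measure on the disorder and over uniform spins. -/
lemma integral_north_eq {Ψ : Disorder Λ → (Λ → S2) → ℝ} (hΨ : Continuous (Function.uncurry Ψ))
    (hinv : ∀ θ ω T, Ψ (gauge θ ω) (rotSpins θ T) = Ψ ω T) :
    ∫ ω, Ψ ω (north Λ) ∂(haarEdges Λ)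
      = ∫ ω, ∫ T, Ψ ω T ∂(unifSpins Λ) ∂(haarEdges Λ) := by
  have h1 : ∀ θ : Λ → SO3, ∫ ω, Ψ ω (rotSpins θ (north Λ)) ∂(haarEdges Λ)
      = ∫ ω, Ψ ω (north Λ) ∂(haarEdges Λ) := by
    intro θ
    have hc : Continuous fun ω : Disorder Λ => Ψ ω (rotSpins θ (north Λ)) :=
      hΨ.comp (by fun_prop : Continuous fun ω : Disorder Λ => (ω, rotSpins θ (north Λ)))
    rw [← integral_comp_of_cont (measurePreserving_gauge θ) hc]
    simp only [hinv]
  have hc2 : Continuous fun p : (Λ → SO3) × Disorder Λ => Ψ p.2 (rotSpins p.1 (north Λ)) :=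
    hΨ.comp (by fun_prop : Continuous fun p : (Λ → SO3) × Disorder Λ => (p.2, rotSpins p.1 (north Λ)))
  -- Since the integral does not depend on `θ`, it may be averaged over Haar distributed `θ`, under
  -- which the rotated north poles become independent uniform spins.
  have h2 : ∫ θ : Λ → SO3, ∫ ω, Ψ ω (rotSpins θ (north Λ)) ∂(haarEdges Λ) ∂(Measure.pi fun _ => haarSO3)
      = ∫ ω, Ψ ω (north Λ) ∂(haarEdges Λ) := by
    simp only [h1, integral_const, probReal_univ, one_smul]
  rw [← h2, integral_integral_swap (integrable_of_cont _ hc2)]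
  congr 1
  ext ω
  exact integral_comp_of_cont measurePreserving_rotSpins_north
    (hΨ.comp (by fun_prop : Continuous fun T : Λ → S2 => (ω, T)))

/-- Nishimori's identity: for gauge invariant observables, the fixed configuration pointing to the
north pole behaves as a sample of the quenched Gibbs measure. -/
theorem nishimori_identity (β : ℝ) {G : Disorder Λ → (Λ → S2) → ℝ}
    (hG : Continuous (Function.uncurry G))
    (hinv : ∀ θ ω T, G (gauge θ ω) (rotSpins θ T) = G ω T) :
    ∫ ω, ∫ S, G ω S ∂(gibbs β ω) ∂(disorderLaw β Λ) = ∫ ω, G ω (north Λ) ∂(disorderLaw β Λ) := by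
  have hW : Continuous fun p : Disorder Λ × (Λ → S2) => Real.exp (logWeight β p.1 p.2) :=
    Real.continuous_exp.comp (by fun_prop)
  have hGω : ∀ ω, Continuous (G ω) := fun ω =>
    hG.comp (by fun_prop : Continuous fun T : Λ → S2 => (ω, T))
  have hginv : ∀ θ ω, ∫ S, G (gauge θ ω) S ∂(gibbs β (gauge θ ω)) = ∫ S, G ω S ∂(gibbs β ω) := by
    intro θ ω
    rw [integral_gibbs_gauge β θ ω (hGω _)]
    simp only [hinv]
  rw [integral_disorderLaw, integral_disorderLaw]
  congr 1
  -- Both numerators are integrals of gauge invariant functions at `north`, so `north` may be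
  -- replaced by a uniform `T`. On the left the integral over `T` produces the partition function,
  -- which cancels the denominator of the Gibbs average.
  rw [integral_north_eq (Ψ := fun ω T => Real.exp (logWeight β ω T) * ∫ S, G ω S ∂(gibbs β ω)),
    integral_north_eq (Ψ := fun ω T => Real.exp (logWeight β ω T) * G ω T)]
  · congr 1
    ext ω
    rw [integral_mul_const, integral_gibbs, mul_div_cancel₀ _ (partition_pos β ω).ne']
  · exact hW.mul hG
  · intro θ ω T; rw [logWeight_gauge, hinv]
  · exact hW.mul ((cont_gibbs β hG).comp continuous_fst)
  · intro θ ω T; rw [logWeight_gauge, hginv]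

/-- The disorder law is invariant under gauge transformations that fix the north pole. -/
lemma measurePreserving_gauge_disorderLaw (β : ℝ) {θ : Λ → SO3} (hθ : ∀ i, rotS (θ i) ezS = ezS) :
    MeasurePreserving (gauge θ) (disorderLaw β Λ) (disorderLaw β Λ) := by
  rw [disorderLaw_eq]
  have hc : Continuous fun ω : Disorder Λ => logWeight β ω (north Λ) := by fun_prop
  refine measurePreserving_tilted (measurePreserving_gauge θ) hc.measurable fun ω => ?_
  have hn : rotSpins θ (north Λ) = north Λ := funext hθ
  conv_lhs => rw [← hn]
  exact logWeight_gauge β θ ω _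

/-! ### Moments of the Nishimori law -/

lemma measurePreserving_mul_left_nishimoriLaw (β : ℝ) {K : SO3} (hK : rot K ez = ez) :
    MeasurePreserving (fun Ω => K * Ω) (nishimoriLaw β) (nishimoriLaw β) := by
  refine measurePreserving_tilted (measurePreserving_mul_left haarSO3 K)
    (nishimori_weight_cont β).measurable fun Ω => ?_
  rw [rot_mul, inner_rot_right]
  conv_lhs => rw [← hK, rot_inv_rot, hK]

lemma measurePreserving_mul_right_nishimoriLaw (β : ℝ) {K : SO3} (hK : rot K ez = ez) :
    MeasurePreserving (fun Ω => Ω * K) (nishimoriLaw β) (nishimoriLaw β) := by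
  refine measurePreserving_tilted (measurePreserving_mul_right haarSO3 K)
    (nishimori_weight_cont β).measurable fun Ω => ?_
  rw [rot_mul, hK]

lemma measurePreserving_inv_nishimoriLaw (β : ℝ) :
    MeasurePreserving (fun Ω : SO3 => Ω⁻¹) (nishimoriLaw β) (nishimoriLaw β) := by
  refine measurePreserving_tilted (Measure.measurePreserving_inv haarSO3)
    (nishimori_weight_cont β).measurable fun Ω => ?_
  rw [inner_ez_rot_ez, inner_ez_rot_ez, inv_apply]

lemma rot_rotZ_ez (p q : ℝ) (h : p ^ 2 + q ^ 2 = 1) : rot (rotZ p q h) ez = ez := by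
  ext i; fin_cases i <;> simp [rot_apply, rotZ, ez_apply]

/-- The entries of the matrix of a rotation. -/
def ent (A : SO3) (i j : Fin 3) : ℝ := A.1 i j

@[fun_prop]
lemma cont_ent {X : Type*} [TopologicalSpace X] {A : X → SO3} (hA : Continuous A) (i j : Fin 3) :
    Continuous fun x => ent (A x) i j :=
  (continuous_entry i j).comp hA

lemma ent_mul (A B : SO3) (i j : Fin 3) : ent (A * B) i j = ∑ k, ent A i k * ent B k j :=
  Matrix.mul_apply

lemma ent_inv (A : SO3) (i j : Fin 3) : ent A⁻¹ i j = ent A j i := rfl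

lemma rot_apply' (A : SO3) (v : R3) (i : Fin 3) : rot A v i = ∑ j, ent A i j * v j := rot_apply A v i

lemma rot_ez_apply' (A : SO3) (i : Fin 3) : rot A ez i = ent A i 2 := rot_ez_apply A i

lemma ent_rotZ (p q : ℝ) (h : p ^ 2 + q ^ 2 = 1) (i j : Fin 3) :
    ent (rotZ p q h) i j = !![p, -q, 0; q, p, 0; 0, 0, 1] i j := rfl

/-- The half turn about the `z` axis. -/
def halfTurn : SO3 := rotZ (-1) 0 (by norm_num)

lemma rot_halfTurn_add (v : R3) : rot halfTurn v + v = (2 * v 2) • ez := by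
  ext i; fin_cases i <;> simp [rot_apply, halfTurn, rotZ, Fin.sum_univ_three, ez_apply]; ring

lemma rot_halfTurn_ez : rot halfTurn ez = ez := rot_rotZ_ez _ _ _

/-- The mean of the cosine under the Nishimori law. -/
def meanCos (β : ℝ) : ℝ := ∫ Ω : SO3, ent Ω 2 2 ∂(nishimoriLaw β)

/-- The mean squared cosine under the Nishimori law. -/
def meanSqCos (β : ℝ) : ℝ := ∫ Ω : SO3, ent Ω 2 2 ^ 2 ∂(nishimoriLaw β)

/-- The law is invariant under right multiplication by the half turn about `ez`; averaging `V` with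
its image leaves its `z` component only. Invariance under inversion does the same for `W`. -/
lemma integral_inner_rot (β : ℝ) (V W : R3) :
    ∫ Ω, inner ℝ (rot Ω V) W ∂(nishimoriLaw β) = meanCos β * (V 2 * W 2) := by
  have hint : ∀ V W : R3, Integrable (fun Ω => inner ℝ (rot Ω V) W) (nishimoriLaw β) :=
    fun V W => integrable_of_cont _ (by fun_prop)
  have hR : ∀ V W : R3, ∫ Ω, inner ℝ (rot Ω V) W ∂(nishimoriLaw β)
      = V 2 * ∫ Ω, inner ℝ (rot Ω ez) W ∂(nishimoriLaw β) := by
    intro V W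
    have h := integral_comp_of_cont (measurePreserving_mul_right_nishimoriLaw β rot_halfTurn_ez)
      (f := fun Ω => inner ℝ (rot Ω V) W) (by fun_prop)
    have h2 : ∫ Ω, (inner ℝ (rot (Ω * halfTurn) V) W + inner ℝ (rot Ω V) W) ∂(nishimoriLaw β)
        = ∫ Ω, (2 * V 2) * inner ℝ (rot Ω ez) W ∂(nishimoriLaw β) := by
      congr 1; ext Ω
      rw [rot_mul, ← inner_add_left, ← rot_add, rot_halfTurn_add, rot_smul, real_inner_smul_left]
    rw [integral_add (by simp only [rot_mul]; exact hint _ _) (hint _ _), h, integral_const_mul] at h2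
    linarith
  have hsymm : ∀ V W : R3, ∫ Ω, inner ℝ (rot Ω V) W ∂(nishimoriLaw β)
      = ∫ Ω, inner ℝ (rot Ω W) V ∂(nishimoriLaw β) := by
    intro V W
    rw [← integral_comp_of_cont (measurePreserving_inv_nishimoriLaw β)
      (f := fun Ω => inner ℝ (rot Ω V) W) (by fun_prop)]
    congr 1; ext Ω; rw [inner_rot_left, inv_inv, real_inner_comm]
  rw [hR, hsymm, hR]
  simp only [inner_ez', rot_ez_apply', meanCos]
  ring

lemma integral_inner_rot_inv (β : ℝ) (V W : R3) :
    ∫ Ω, inner ℝ (rot Ω⁻¹ V) W ∂(nishimoriLaw β) = meanCos β * (V 2 * W 2) := by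
  rw [← integral_inner_rot]
  exact integral_comp_of_cont (measurePreserving_inv_nishimoriLaw β)
    (f := fun Ω => inner ℝ (rot Ω V) W) (by fun_prop)

lemma row_sq_SO3 (A : SO3) : ent A 2 0 ^ 2 + ent A 2 1 ^ 2 + ent A 2 2 ^ 2 = 1 := by
  have h := congrFun (congrFun (mul_transpose_SO3 A) 2) 2
  simp [Matrix.mul_apply, Fin.sum_univ_three] at h
  simp only [ent]
  linarith

/-- The formula expresses the second moments of the last row of `Ω`. Their matrix commutes with
rotations about `ez` and has trace one, so it is diagonal with entries `(1 - d) / 2`, `(1 - d) / 2`,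
`d`, where `d = meanSqCos β`. -/
lemma integral_rot_mul_rot (β : ℝ) (V W : R3) :
    ∫ Ω, rot Ω V 2 * rot Ω W 2 ∂(nishimoriLaw β)
      = (1 - meanSqCos β) / 2 * inner ℝ V W + (3 * meanSqCos β - 1) / 2 * (V 2 * W 2) := by
  have hint : ∀ a b : Fin 3, Integrable (fun Ω : SO3 => ent Ω 2 a * ent Ω 2 b) (nishimoriLaw β) :=
    fun a b => integrable_of_cont _ (by fun_prop)
  have hpres : ∀ (p q : ℝ) (h : p ^ 2 + q ^ 2 = 1) (a b : Fin 3),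
      ∫ Ω : SO3, ent (Ω * rotZ p q h) 2 a * ent (Ω * rotZ p q h) 2 b ∂(nishimoriLaw β)
        = ∫ Ω : SO3, ent Ω 2 a * ent Ω 2 b ∂(nishimoriLaw β) := fun p q h a b =>
    integral_comp_of_cont (measurePreserving_mul_right_nishimoriLaw β (rot_rotZ_ez p q h))
      (f := fun Ω => ent Ω 2 a * ent Ω 2 b) (by fun_prop)
  -- The half turn kills the entries mixing `z` with `x` or `y`; the quarter turn kills the
  -- remaining off-diagonal entry and equates the first two diagonal ones.
  have e02 := hpres (-1) 0 (by norm_num) 0 2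
  have e12 := hpres (-1) 0 (by norm_num) 1 2
  have e01 := hpres 0 1 (by norm_num) 0 1
  have e00 := hpres 0 1 (by norm_num) 0 0
  simp only [ent_mul, ent_rotZ, Fin.sum_univ_three] at e02 e12 e01 e00
  simp [integral_neg] at e02 e12 e01 e00
  have hs : ∫ Ω : SO3, ent Ω 2 0 * ent Ω 2 0 ∂(nishimoriLaw β)
      + ∫ Ω : SO3, ent Ω 2 1 * ent Ω 2 1 ∂(nishimoriLaw β)
      + ∫ Ω : SO3, ent Ω 2 2 * ent Ω 2 2 ∂(nishimoriLaw β) = 1 := by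
    rw [← integral_add (hint _ _) (hint _ _), ← integral_add (f := fun Ω => ent Ω 2 0 * ent Ω 2 0 +
      ent Ω 2 1 * ent Ω 2 1) ((hint _ _).add (hint _ _)) (hint _ _)]
    have : ∀ Ω : SO3, ent Ω 2 0 * ent Ω 2 0 + ent Ω 2 1 * ent Ω 2 1 + ent Ω 2 2 * ent Ω 2 2 = 1 :=
      fun Ω => by linarith [row_sq_SO3 Ω]
    simp [this]
  have h22 : ∫ Ω : SO3, ent Ω 2 2 * ent Ω 2 2 ∂(nishimoriLaw β) = meanSqCos β := by
    simp only [meanSqCos, pow_two]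
  have hcomm : ∀ a b : Fin 3, ∫ Ω : SO3, ent Ω 2 a * ent Ω 2 b ∂(nishimoriLaw β)
      = ∫ Ω : SO3, ent Ω 2 b * ent Ω 2 a ∂(nishimoriLaw β) := fun a b => by
    simp only [mul_comm]
  have hexp : ∀ Ω, rot Ω V 2 * rot Ω W 2
      = ∑ a, ∑ b, V a * W b * (ent Ω 2 a * ent Ω 2 b) := fun Ω => by
    rw [rot_apply', rot_apply', Finset.sum_mul_sum]
    refine Finset.sum_congr rfl fun a _ => Finset.sum_congr rfl fun b _ => ?_
    ring
  simp only [hexp]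
  rw [integral_finsetSum _ fun a _ => integrable_finsetSum _ fun b _ => (hint a b).const_mul _]
  have hin : ∀ a, ∫ Ω, ∑ b, V a * W b * (ent Ω 2 a * ent Ω 2 b) ∂(nishimoriLaw β)
      = ∑ b, V a * W b * ∫ Ω, ent Ω 2 a * ent Ω 2 b ∂(nishimoriLaw β) := fun a => by
    rw [integral_finsetSum _ fun b _ => (hint a b).const_mul _]
    simp only [integral_const_mul]
  rw [Finset.sum_congr rfl fun a _ => hin a]
  simp only [Fin.sum_univ_three, inner_R3]
  rw [h22] at hs ⊢
  rw [hcomm 1 0, hcomm 2 0, hcomm 2 1]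
  rw [hcomm 1 0] at e01
  have z02 : ∫ Ω : SO3, ent Ω 2 0 * ent Ω 2 2 ∂(nishimoriLaw β) = 0 := by linarith
  have z12 : ∫ Ω : SO3, ent Ω 2 1 * ent Ω 2 2 ∂(nishimoriLaw β) = 0 := by linarith
  have z01 : ∫ Ω : SO3, ent Ω 2 0 * ent Ω 2 1 ∂(nishimoriLaw β) = 0 := by linarith
  have z00 : ∫ Ω : SO3, ent Ω 2 0 * ent Ω 2 0 ∂(nishimoriLaw β) = (1 - meanSqCos β) / 2 := by linarith
  have z11 : ∫ Ω : SO3, ent Ω 2 1 * ent Ω 2 1 ∂(nishimoriLaw β) = (1 - meanSqCos β) / 2 := by linarith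
  rw [z02, z12, z01, z00, z11]
  ring

lemma integral_rot_inv_mul_rot_inv (β : ℝ) (V W : R3) :
    ∫ Ω, rot Ω⁻¹ V 2 * rot Ω⁻¹ W 2 ∂(nishimoriLaw β)
      = (1 - meanSqCos β) / 2 * inner ℝ V W + (3 * meanSqCos β - 1) / 2 * (V 2 * W 2) := by
  rw [← integral_rot_mul_rot]
  exact integral_comp_of_cont (measurePreserving_inv_nishimoriLaw β)
    (f := fun Ω => rot Ω V 2 * rot Ω W 2) (by fun_prop)

lemma abs_entry_le (A : SO3) : |ent A 2 2| ≤ 1 := by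
  rw [abs_le_one_iff_mul_self_le_one]
  nlinarith [row_sq_SO3 A, sq_nonneg (ent A 2 0), sq_nonneg (ent A 2 1)]

lemma meanCos_le_one (β : ℝ) : meanCos β ≤ 1 := by
  have := integral_mono (μ := nishimoriLaw β) (integrable_of_cont _ (cont_ent continuous_id 2 2))
    (integrable_const (1 : ℝ)) fun A => (abs_le.1 (abs_entry_le A)).2
  simpa [meanCos] using this

lemma meanSqCos_le_one (β : ℝ) : meanSqCos β ≤ 1 := by
  have := integral_mono (μ := nishimoriLaw β) (integrable_of_cont _ ((cont_ent continuous_id 2 2).pow 2))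
    (integrable_const (1 : ℝ)) fun A => (sq_le_one_iff_abs_le_one _).2 (abs_entry_le A)
  simpa [meanSqCos] using this

lemma sq_meanCos_le (β : ℝ) : meanCos β ^ 2 ≤ meanSqCos β := by
  have hi1 : Integrable (fun Ω : SO3 => ent Ω 2 2) (nishimoriLaw β) :=
    integrable_of_cont _ (cont_ent continuous_id 2 2)
  have hi2 : Integrable (fun Ω : SO3 => ent Ω 2 2 ^ 2) (nishimoriLaw β) :=
    integrable_of_cont _ ((cont_ent continuous_id 2 2).pow 2)
  have h : 0 ≤ ∫ Ω : SO3, (ent Ω 2 2 - meanCos β) ^ 2 ∂(nishimoriLaw β) :=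
    integral_nonneg fun _ => sq_nonneg _
  have e : ∀ Ω : SO3, (ent Ω 2 2 - meanCos β) ^ 2
      = ent Ω 2 2 ^ 2 - 2 * meanCos β * ent Ω 2 2 + meanCos β ^ 2 := fun Ω => by ring
  simp only [e] at h
  rw [integral_add (f := fun Ω => ent Ω 2 2 ^ 2 - 2 * meanCos β * ent Ω 2 2)
    (hi2.sub (hi1.const_mul _)) (integrable_const _),
    integral_sub hi2 (hi1.const_mul _), integral_const_mul] at h
  simp only [integral_const, probReal_univ, one_smul] at h
  change 0 ≤ meanSqCos β - 2 * meanCos β * meanCos β + _ at h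
  nlinarith

/-! ### Concentration of the Nishimori law at low temperature -/

lemma sum_sq_rot_ez (A : SO3) : ent A 0 2 ^ 2 + ent A 1 2 ^ 2 + ent A 2 2 ^ 2 = 1 := by
  have h := sum_sq_S2 (rotS A ezS)
  simpa [rot_ez_apply'] using h

/-- Pigeonhole: sort the rotations by the cell of mesh `1 / N` that contains `Ω ez`. Some cell has
at least the average mass, and translating it by the inverse of one of its members moves it into the
cap. The exponent `3` is not sharp, but only its logarithm is used. -/
lemma haarSO3_cap_ge (N : ℕ) (hN : 0 < N) :
    1 / (2 * N + 1 : ℝ) ^ 3 ≤ haarSO3.real {Ω | 1 - ent Ω 2 2 ≤ 3 / (2 * (N : ℝ) ^ 2)} := by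
  have hN' : (0 : ℝ) < N := by exact_mod_cast hN
  let cell : SO3 → Fin 3 → ℤ := fun Ω i => ⌊(N : ℝ) * ent Ω i 2⌋
  let I : Finset (Fin 3 → ℤ) := Fintype.piFinset fun _ => Finset.Icc (-(N : ℤ)) N
  have hcard : I.card = (2 * N + 1) ^ 3 := by
    simp only [I, Fintype.card_piFinset, Int.card_Icc, Finset.prod_const, Finset.card_univ,
      Fintype.card_fin]
    congr 1; omega
  have hmem : ∀ Ω, cell Ω ∈ I := by
    intro Ω
    rw [Fintype.mem_piFinset]
    intro i
    have hb : |ent Ω i 2| ≤ 1 := by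
      rw [abs_le_one_iff_mul_self_le_one]
      have := sum_sq_rot_ez Ω
      fin_cases i <;> simp <;>
        nlinarith [sq_nonneg (ent Ω 0 2), sq_nonneg (ent Ω 1 2), sq_nonneg (ent Ω 2 2)]
    rw [abs_le] at hb
    rw [Finset.mem_Icc]
    constructor
    · rw [Int.le_floor]; push_cast; nlinarith
    · have : ((cell Ω i : ℤ) : ℝ) ≤ N := (Int.floor_le _).trans (by nlinarith)
      exact_mod_cast this
  obtain ⟨κ, -, hκ⟩ : ∃ κ ∈ I, 1 / (2 * N + 1 : ℝ) ^ 3 ≤ haarSO3.real (cell ⁻¹' {κ}) := by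
    by_contra! hcon
    have h1 : haarSO3.real Set.univ ≤ ∑ κ ∈ I, haarSO3.real (cell ⁻¹' {κ}) := by
      have : (Set.univ : Set SO3) = ⋃ κ ∈ I, cell ⁻¹' {κ} := by
        ext Ω; simp [hmem Ω]
      rw [this]; exact measureReal_biUnion_finset_le _ _
    have hne : I.Nonempty := Finset.card_pos.1 (by rw [hcard]; positivity)
    have h2 := Finset.sum_lt_sum_of_nonempty hne hcon
    rw [Finset.sum_const, hcard, nsmul_eq_mul] at h2
    push_cast at h2
    rw [mul_one_div_cancel (by positivity)] at h2
    simp at h1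
    linarith
  obtain ⟨Ω₀, hΩ₀⟩ : (cell ⁻¹' {κ}).Nonempty := by
    by_contra! h
    rw [h, measureReal_empty] at hκ
    have : (0 : ℝ) < 1 / (2 * N + 1 : ℝ) ^ 3 := by positivity
    linarith
  refine hκ.trans ?_
  have hpre : haarSO3.real ((fun Ω => Ω₀⁻¹ * Ω) ⁻¹' {Ω | 1 - ent Ω 2 2 ≤ 3 / (2 * (N : ℝ) ^ 2)})
      = haarSO3.real {Ω | 1 - ent Ω 2 2 ≤ 3 / (2 * (N : ℝ) ^ 2)} := by
    rw [measureReal_def, measureReal_def, measure_preimage_mul]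
  rw [← hpre]
  refine measureReal_mono fun Ω hΩ => ?_
  have hΩ' : cell Ω = cell Ω₀ := by rw [hΩ, hΩ₀]
  have hdiff : ∀ i, (ent Ω i 2 - ent Ω₀ i 2) ^ 2 ≤ 1 / (N : ℝ) ^ 2 := by
    intro i
    have h1 := Int.abs_sub_lt_one_of_floor_eq_floor (congrFun hΩ' i)
    rw [← mul_sub, abs_lt] at h1
    rw [le_div_iff₀ (by positivity)]
    nlinarith
  simp only [Set.mem_preimage, Set.mem_ofPred_eq]
  have he : ent (Ω₀⁻¹ * Ω) 2 2 = ent Ω₀ 0 2 * ent Ω 0 2 + ent Ω₀ 1 2 * ent Ω 1 2 + ent Ω₀ 2 2 * ent Ω 2 2 := by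
    rw [ent_mul, Fin.sum_univ_three]; rfl
  have h3 : 3 / (2 * (N : ℝ) ^ 2) = 3 / 2 * (1 / (N : ℝ) ^ 2) := by field_simp
  rw [he, h3]
  nlinarith [hdiff 0, hdiff 1, hdiff 2, sum_sq_rot_ez Ω, sum_sq_rot_ez Ω₀]

/-- Jensen's inequality for `exp (β (1 - cos))` under the tilted law, where the tilt cancels and
leaves `1 / Z`; the cap bounds `Z` below by a power of `β`. -/
lemma one_sub_meanCos_le {β : ℝ} (hβ : 3 ≤ β) : 1 - meanCos β ≤ 10 * Real.log β / β := by
  have hβ0 : 0 < β := by linarith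
  have hce : Continuous fun Ω : SO3 => ent Ω 2 2 := cont_ent continuous_id 2 2
  set Z := ∫ Ω : SO3, Real.exp (-(β * (1 - ent Ω 2 2))) ∂haarSO3 with hZ
  have hcZ : Continuous fun Ω : SO3 => Real.exp (-(β * (1 - ent Ω 2 2))) := by fun_prop
  have hZpos : 0 < Z := integral_exp_pos (integrable_of_cont _ hcZ)
  have hlaw : nishimoriLaw β = haarSO3.tilted fun Ω => -(β * (1 - ent Ω 2 2)) := by
    have h1 : (fun Ω : SO3 => β * inner ℝ ez (rot Ω ez))
        = fun Ω => -(β * (1 - ent Ω 2 2)) + β := by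
      ext Ω; rw [inner_ez, rot_ez_apply']; ring
    have h2 : ∀ g : ℝ, ∫ Ω : SO3, Real.exp (-(β * (1 - ent Ω 2 2)) + g) ∂haarSO3 = Z * Real.exp g := by
      intro g; simp only [Real.exp_add]; rw [integral_mul_const]
    unfold nishimoriLaw Measure.tilted
    rw [h1]
    rw [h2]
    simp only [Real.exp_add]
    congr 1
    ext Ω
    rw [mul_div_mul_right _ _ (Real.exp_pos _).ne']
  have hjensen : Real.exp (β * (1 - meanCos β)) ≤ 1 / Z := by
    have h := convexOn_exp.map_integral_le (μ := nishimoriLaw β) (f := fun Ω : SO3 => β * (1 - ent Ω 2 2))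
      Real.continuous_exp.continuousOn isClosed_univ (by simp)
      (integrable_of_cont _ (by fun_prop)) (integrable_of_cont _ (by fun_prop))
    have e1 : ∫ Ω : SO3, β * (1 - ent Ω 2 2) ∂(nishimoriLaw β) = β * (1 - meanCos β) := by
      rw [integral_const_mul, integral_sub (integrable_const _) (integrable_of_cont _ hce)]
      simp [meanCos]
    have e2 : ∫ Ω : SO3, Real.exp (β * (1 - ent Ω 2 2)) ∂(nishimoriLaw β) = 1 / Z := by
      rw [hlaw, integral_tilted, ← hZ]
      have : ∀ Ω : SO3, (Real.exp (-(β * (1 - ent Ω 2 2))) / Z) • Real.exp (β * (1 - ent Ω 2 2)) = 1 / Z := by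
        intro Ω; rw [smul_eq_mul, div_mul_eq_mul_div, ← Real.exp_add]; simp
      simp only [this]; simp
    rw [e1] at h
    exact h.trans_eq e2
  have hZlow : Real.exp (-1) * (1 / (7 * β) ^ 3) ≤ Z := by
    -- With this `N` the cap lies in `β (1 - cos) ≤ 1`, while `2 N + 1 ≤ 7 β`.
    obtain ⟨N, hN⟩ : ∃ N : ℕ, N = ⌈2 * β⌉₊ := ⟨_, rfl⟩
    have hN1 : 2 * β ≤ N := by rw [hN]; exact Nat.le_ceil _
    have hN2 : (N : ℝ) < 2 * β + 1 := by rw [hN]; exact Nat.ceil_lt_add_one (by positivity)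
    have hcap := haarSO3_cap_ge N (by have : (0 : ℝ) < N := by linarith
                                      exact_mod_cast this)
    set C : Set SO3 := {Ω | 1 - ent Ω 2 2 ≤ 3 / (2 * (N : ℝ) ^ 2)} with hC
    have hCm : MeasurableSet C := (isClosed_le (by fun_prop) continuous_const).measurableSet
    have h1 : ∫ Ω, C.indicator (fun _ => Real.exp (-1)) Ω ∂haarSO3 ≤ Z := by
      refine integral_mono ((integrable_const _).indicator hCm) (integrable_of_cont _ hcZ) fun Ω => ?_
      by_cases h : Ω ∈ C
      · rw [Set.indicator_of_mem h]
        refine Real.exp_le_exp.2 (neg_le_neg ?_)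
        have h' : 1 - ent Ω 2 2 ≤ 3 / (2 * (N : ℝ) ^ 2) := h
        have h2 : 3 / (2 * (N : ℝ) ^ 2) ≤ 1 / β := by
          rw [div_le_div_iff₀ (by nlinarith) hβ0]; nlinarith
        calc β * (1 - ent Ω 2 2) ≤ β * (1 / β) := by gcongr; linarith
          _ = 1 := by field_simp
      · rw [Set.indicator_of_notMem h]; positivity
    rw [integral_indicator hCm, setIntegral_const, smul_eq_mul, mul_comm] at h1
    refine le_trans ?_ h1
    gcongr
    refine le_trans ?_ hcap
    gcongr
    linarith
  have hlog : β * (1 - meanCos β) ≤ 1 + 3 * Real.log (7 * β) := by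
    have h1 : Real.exp (β * (1 - meanCos β)) ≤ Real.exp (1 + 3 * Real.log (7 * β)) := by
      refine hjensen.trans ?_
      have : Real.exp (1 + 3 * Real.log (7 * β)) = 1 / (Real.exp (-1) * (1 / (7 * β) ^ 3)) := by
        rw [Real.exp_add, mul_comm 3, Real.exp_mul, Real.exp_log (by positivity), Real.exp_neg]
        norm_cast
        field_simp
      rw [this]
      gcongr
    exact Real.exp_le_exp.1 h1
  have h7 : Real.log 7 ≤ 2 := by
    rw [Real.log_le_iff_le_exp (by norm_num)]
    have := Real.exp_one_gt_d9
    have h2 : Real.exp 2 = Real.exp 1 * Real.exp 1 := by rw [← Real.exp_add]; norm_num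
    nlinarith
  have hb1 : 1 ≤ Real.log β := by
    rw [Real.le_log_iff_exp_le hβ0]
    linarith [Real.exp_one_lt_d9]
  rw [Real.log_mul (by norm_num) hβ0.ne'] at hlog
  rw [le_div_iff₀ hβ0]
  linarith

/-! ### Products of random rotations along two paths -/

section TwoPaths

variable {ι : Type*}

/-- The rotation carried by an edge crossed in one of its two directions. -/
def stepRot (ω : ι → SO3) (s : ι × Bool) : SO3 := if s.2 then ω s.1 else (ω s.1)⁻¹

/-- The product of the rotations along a list of steps. -/
def transport (ω : ι → SO3) (l : List (ι × Bool)) : SO3 := (l.map (stepRot ω)).prod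

@[fun_prop]
lemma cont_stepRot {X : Type*} [TopologicalSpace X] {ω : X → ι → SO3} (hω : Continuous ω)
    (s : ι × Bool) : Continuous fun x => stepRot (ω x) s := by
  unfold stepRot
  have h : Continuous fun x => ω x s.1 := (continuous_apply s.1).comp hω
  split_ifs
  · exact h
  · exact h.inv

lemma transport_nil (ω : ι → SO3) : transport ω [] = 1 := rfl

lemma transport_cons (ω : ι → SO3) (s : ι × Bool) (l : List (ι × Bool)) :
    transport ω (s :: l) = stepRot ω s * transport ω l := by simp [transport]

@[fun_prop]
lemma cont_transport {X : Type*} [TopologicalSpace X] {ω : X → ι → SO3} (hω : Continuous ω)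
    (l : List (ι × Bool)) : Continuous fun x => transport (ω x) l := by
  induction l with
  | nil => simp only [transport_nil]; exact continuous_const
  | cons s l ih => simp only [transport_cons]; exact (cont_stepRot hω s).mul ih

/-- The same edge, crossed in the other direction. -/
def flipStep (s : ι × Bool) : ι × Bool := (s.1, !s.2)

lemma flipStep_injective : Function.Injective (flipStep : ι × Bool → ι × Bool) := by
  rintro ⟨a, b⟩ ⟨c, d⟩ h
  simpa [flipStep] using h

lemma stepRot_flip (ω : ι → SO3) (s : ι × Bool) : stepRot ω (flipStep s) = (stepRot ω s)⁻¹ := by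
  obtain ⟨i, b⟩ := s
  cases b <;> simp [stepRot, flipStep]

lemma transport_inv (ω : ι → SO3) (l : List (ι × Bool)) :
    (transport ω l)⁻¹ = transport ω (l.reverse.map flipStep) := by
  simp only [transport, List.prod_inv_reverse, List.map_map, List.map_reverse]
  congr 2
  refine List.map_congr_left fun s _ => ?_
  exact (stepRot_flip ω s).symm

variable [DecidableEq ι]

lemma stepRot_update_of_ne (ω : ι → SO3) {i : ι} (r : SO3) {s : ι × Bool} (h : s.1 ≠ i) :
    stepRot (Function.update ω i r) s = stepRot ω s := by
  simp [stepRot, Function.update_of_ne h]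

lemma transport_update (ω : ι → SO3) {i : ι} (r : SO3) {l : List (ι × Bool)}
    (h : ∀ s ∈ l, s.1 ≠ i) : transport (Function.update ω i r) l = transport ω l := by
  unfold transport
  congr 1
  exact List.map_congr_left fun s hs => stepRot_update_of_ne ω r (h s hs)

variable [Fintype ι] (β : ℝ)

/-- Independent rotations with the Nishimori law, indexed by a finite type. -/
def edgeLaw (ι : Type*) [Fintype ι] (β : ℝ) : Measure (ι → SO3) :=
  Measure.pi fun _ => nishimoriLaw β

instance : IsProbabilityMeasure (edgeLaw ι β) := by unfold edgeLaw; infer_instance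

/-- As `V` and `W` do not see the edge of `s`, its rotation can be integrated out first; this
projects both vectors onto the `z` axis at the cost of one factor `meanCos β`. -/
lemma integral_step_inner {V W : (ι → SO3) → R3} (hV : Continuous V) (hW : Continuous W)
    (s : ι × Bool) (hVs : ∀ ω r, V (Function.update ω s.1 r) = V ω)
    (hWs : ∀ ω r, W (Function.update ω s.1 r) = W ω) :
    ∫ ω, inner ℝ (rot (stepRot ω s) (V ω)) (W ω) ∂(edgeLaw ι β)
      = meanCos β * ∫ ω, V ω 2 * W ω 2 ∂(edgeLaw ι β) := by
  unfold edgeLaw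
  rw [integral_resample (nishimoriLaw β) s.1 (by fun_prop), ← integral_const_mul]
  congr 1
  ext ω
  simp only [hVs, hWs, stepRot, Function.update_self]
  cases s.2
  · exact integral_inner_rot_inv β _ _
  · exact integral_inner_rot β _ _

lemma cont_coord {X : Type*} [TopologicalSpace X] {V : X → R3} (hV : Continuous V) (i : Fin 3) :
    Continuous fun x => V x i :=
  (EuclideanSpace.proj (𝕜 := ℝ) i).continuous.comp hV

lemma integral_step_mul {V W : (ι → SO3) → R3} (hV : Continuous V) (hW : Continuous W)
    (s : ι × Bool) (hVs : ∀ ω r, V (Function.update ω s.1 r) = V ω)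
    (hWs : ∀ ω r, W (Function.update ω s.1 r) = W ω) :
    ∫ ω, rot (stepRot ω s) (V ω) 2 * rot (stepRot ω s) (W ω) 2 ∂(edgeLaw ι β)
      = (1 - meanSqCos β) / 2 * ∫ ω, inner ℝ (V ω) (W ω) ∂(edgeLaw ι β)
        + (3 * meanSqCos β - 1) / 2 * ∫ ω, V ω 2 * W ω 2 ∂(edgeLaw ι β) := by
  unfold edgeLaw
  rw [← integral_const_mul, ← integral_const_mul, ← integral_add
      (f := fun ω => (1 - meanSqCos β) / 2 * inner ℝ (V ω) (W ω))
      (g := fun ω => (3 * meanSqCos β - 1) / 2 * (V ω 2 * W ω 2))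
      ((integrable_of_cont _ (by fun_prop)).const_mul _)
      ((integrable_of_cont _ ((cont_coord hV 2).mul (cont_coord hW 2))).const_mul _),
    integral_resample (nishimoriLaw β) s.1
      (F := fun ω => rot (stepRot ω s) (V ω) 2 * rot (stepRot ω s) (W ω) 2) ((cont_coord (by fun_prop) 2).mul (cont_coord (by fun_prop) 2))]
  congr 1
  ext ω
  simp only [hVs, hWs, stepRot, Function.update_self]
  cases s.2
  · exact integral_rot_inv_mul_rot_inv β _ _
  · exact integral_rot_mul_rot β _ _

lemma integral_two_steps_inner {V W : (ι → SO3) → R3} (hV : Continuous V) (hW : Continuous W)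
    {s t : ι × Bool} (hst : s.1 ≠ t.1) (hVs : ∀ ω r, V (Function.update ω s.1 r) = V ω)
    (hWs : ∀ ω r, W (Function.update ω s.1 r) = W ω)
    (hVt : ∀ ω r, V (Function.update ω t.1 r) = V ω)
    (hWt : ∀ ω r, W (Function.update ω t.1 r) = W ω) :
    ∫ ω, inner ℝ (rot (stepRot ω s) (V ω)) (rot (stepRot ω t) (W ω)) ∂(edgeLaw ι β)
      = meanCos β ^ 2 * ∫ ω, V ω 2 * W ω 2 ∂(edgeLaw ι β) := by
  rw [integral_step_inner β hV (by fun_prop) s hVs fun ω r => by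
    rw [hWs, stepRot_update_of_ne ω r hst.symm]]
  have h := integral_step_inner β hW (W := fun ω => V ω 2 • ez)
    (by have := cont_coord hV 2; fun_prop) t hWt fun ω r => by rw [hVt]
  have e : ∀ (a : ℝ) (v : R3), inner ℝ v (a • ez) = a * v 2 := fun a v => by
    rw [real_inner_smul_right, inner_ez']
  simp only [e] at h
  rw [h, pow_two, mul_assoc]
  congr 2
  refine integral_congr_ae (.of_forall fun ω => ?_)
  simp [ez_apply, mul_comm]

lemma integral_two_steps_mul {V W : (ι → SO3) → R3} (hV : Continuous V) (hW : Continuous W)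
    {s t : ι × Bool} (hst : s.1 ≠ t.1) (hVs : ∀ ω r, V (Function.update ω s.1 r) = V ω)
    (hWs : ∀ ω r, W (Function.update ω s.1 r) = W ω)
    (hVt : ∀ ω r, V (Function.update ω t.1 r) = V ω)
    (hWt : ∀ ω r, W (Function.update ω t.1 r) = W ω) :
    ∫ ω, rot (stepRot ω s) (V ω) 2 * rot (stepRot ω t) (W ω) 2 ∂(edgeLaw ι β)
      = meanCos β ^ 2 * ∫ ω, V ω 2 * W ω 2 ∂(edgeLaw ι β) := by
  have hc : Continuous fun ω => rot (stepRot ω t) (W ω) 2 := cont_coord (by fun_prop) 2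
  have e : ∀ (a : ℝ) (v : R3), inner ℝ v (a • ez) = v 2 * a := fun a v => by
    rw [real_inner_smul_right, inner_ez', mul_comm]
  have h1 := integral_step_inner β hV (W := fun ω => rot (stepRot ω t) (W ω) 2 • ez)
    (by fun_prop) s hVs fun ω r => by rw [hWs, stepRot_update_of_ne ω r hst.symm]
  have h2 := integral_step_inner β hV (W := fun ω => rot (stepRot ω t) (W ω))
    (by fun_prop) s hVs fun ω r => by rw [hWs, stepRot_update_of_ne ω r hst.symm]
  simp only [e] at h1
  rw [h1, ← integral_two_steps_inner β hV hW hst hVs hWs hVt hWt, h2]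
  simp [ez_apply]

/-- Two paths cross their common edges at the same time and in the same direction, and no edge
more than once. -/
def Aligned (l : List ((ι × Bool) × (ι × Bool))) : Prop :=
  l.Pairwise (fun p q => p.1.1 ≠ q.1.1 ∧ p.1.1 ≠ q.2.1 ∧ p.2.1 ≠ q.1.1 ∧ p.2.1 ≠ q.2.1) ∧
    ∀ p ∈ l, p.1.1 = p.2.1 → p.1 = p.2

/-- Induction on the first step, with both quantities carried along. A common step preserves the
inner product and replaces the product of `z` components by a combination of the two quantities,
whose weights are nonnegative when `meanSqCos β ≥ 1 / 3` and add up to `meanSqCos β ≤ 1`. Distinct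
steps each project onto the axis and together give `meanCos β ^ 2`. -/
lemma integral_two_paths_le (hd : 1 / 3 ≤ meanSqCos β)
    (l : List ((ι × Bool) × (ι × Bool))) (hl : Aligned l) :
    ∫ ω, inner ℝ (rot (transport ω (l.map Prod.fst)) ez) (rot (transport ω (l.map Prod.snd)) ez)
        ∂(edgeLaw ι β) ≤ (meanCos β ^ 2) ^ l.countP (fun p => p.1 ≠ p.2) ∧
    ∫ ω, rot (transport ω (l.map Prod.fst)) ez 2 * rot (transport ω (l.map Prod.snd)) ez 2
        ∂(edgeLaw ι β) ≤ (meanCos β ^ 2) ^ l.countP (fun p => p.1 ≠ p.2) := by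
  induction l with
  | nil =>
    simp [transport_nil, rot_one, ez_apply, norm_ez]
  | cons p l ih =>
    obtain ⟨hpw, hsame⟩ := hl
    rw [List.pairwise_cons] at hpw
    obtain ⟨ih1, ih2⟩ := ih ⟨hpw.2, fun q hq => hsame q (List.mem_cons_of_mem _ hq)⟩
    set V := fun ω : ι → SO3 => rot (transport ω (l.map Prod.fst)) ez with hV
    set W := fun ω : ι → SO3 => rot (transport ω (l.map Prod.snd)) ez with hW
    have hVc : Continuous V := by fun_prop
    have hWc : Continuous W := by fun_prop
    have hVi : ∀ i, (∀ q ∈ l, q.1.1 ≠ i) → ∀ ω r, V (Function.update ω i r) = V ω := by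
      intro i hi ω r
      simp only [hV]
      rw [transport_update ω r fun t ht => by
        obtain ⟨q, hq, rfl⟩ := List.mem_map.1 ht; exact hi q hq]
    have hWi : ∀ i, (∀ q ∈ l, q.2.1 ≠ i) → ∀ ω r, W (Function.update ω i r) = W ω := by
      intro i hi ω r
      simp only [hW]
      rw [transport_update ω r fun t ht => by
        obtain ⟨q, hq, rfl⟩ := List.mem_map.1 ht; exact hi q hq]
    have hV1 := hVi p.1.1 fun q hq => (hpw.1 q hq).1.symm
    have hW1 := hWi p.1.1 fun q hq => (hpw.1 q hq).2.1.symm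
    have hV2 := hVi p.2.1 fun q hq => (hpw.1 q hq).2.2.1.symm
    have hW2 := hWi p.2.1 fun q hq => (hpw.1 q hq).2.2.2.symm
    simp only [List.map_cons, transport_cons, rot_mul]
    by_cases hp : p.1 = p.2
    · rw [List.countP_cons_of_neg (by simpa using hp), ← hp]
      simp only [inner_rot_rot]
      refine ⟨ih1, ?_⟩
      rw [integral_step_mul β hVc hWc p.1 hV1 hW1]
      have h1 := meanSqCos_le_one β
      have e1 := mul_le_mul_of_nonneg_left ih1 (by linarith : 0 ≤ (1 - meanSqCos β) / 2)
      have e2 := mul_le_mul_of_nonneg_left ih2 (by linarith : 0 ≤ (3 * meanSqCos β - 1) / 2)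
      have e3 : 0 ≤ (meanCos β ^ 2) ^ l.countP (fun p => p.1 ≠ p.2) := by positivity
      nlinarith
    · have hp' : p.1.1 ≠ p.2.1 := fun h => hp (hsame p (by simp) h)
      rw [List.countP_cons_of_pos (by simpa using hp), pow_succ']
      rw [integral_two_steps_inner β hVc hWc hp' hV1 hW1 hV2 hW2,
        integral_two_steps_mul β hVc hWc hp' hV1 hW1 hV2 hW2]
      constructor <;> gcongr

lemma integral_path_eq (l : List (ι × Bool)) (hl : (l.map Prod.fst).Nodup) :
    ∫ ω, rot (transport ω l) ez 2 ∂(edgeLaw ι β) = meanCos β ^ l.length := by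
  induction l with
  | nil => simp [transport_nil, rot_one, ez_apply]
  | cons s l ih =>
    rw [List.map_cons, List.nodup_cons] at hl
    have h := integral_step_inner β (V := fun ω => rot (transport ω l) ez) (W := fun _ => ez)
      (by fun_prop) (by fun_prop) s (fun ω r => by
        rw [transport_update ω r]
        intro t ht hts
        exact hl.1 (hts ▸ List.mem_map_of_mem ht)) fun _ _ => rfl
    simp only [inner_ez', ← rot_mul, ← transport_cons] at h
    rw [h, List.length_cons, pow_succ', ← ih hl.2]
    simp [ez_apply]

/-! ### Averages over families of paths. -/

variable {β}

/-- The average of the normalized parallel transports along a finite family of paths with `L`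
steps. -/
def pathAverage {Γ : Type*} [Fintype Γ] (c : ℝ) (L : ℕ) (s : Γ → ℕ → ι × Bool) (ω : ι → SO3)
    (v : R3) : R3 :=
  (c ^ L * Fintype.card Γ)⁻¹ • ∑ γ, rot (transport ω ((List.range L).map (s γ))) v

/-- A finite family of paths with `L` steps, each of which crosses its edges in an order and in
directions that are compatible with those of the other paths. -/
structure PathFamily {Γ : Type*} (L : ℕ) (s : Γ → ℕ → ι × Bool) : Prop where
  ne : ∀ γ γ' i j, i < j → j < L → (s γ i).1 ≠ (s γ' j).1
  same : ∀ γ γ' i, i < L → (s γ i).1 = (s γ' i).1 → s γ i = s γ' i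

/-- The number of common steps of two paths. -/
def common {Γ : Type*} (L : ℕ) (s : Γ → ℕ → ι × Bool) (γ γ' : Γ) : ℕ :=
  ((Finset.range L).filter fun i => s γ i = s γ' i).card

omit [DecidableEq ι] [Fintype ι] in
lemma PathFamily.aligned {Γ : Type*} {L : ℕ} {s : Γ → ℕ → ι × Bool} (h : PathFamily L s)
    (γ γ' : Γ) : Aligned ((List.range L).map fun i => (s γ i, s γ' i)) := by
  constructor
  · rw [List.pairwise_map]
    refine List.Pairwise.imp_of_mem ?_ (List.pairwise_lt_range (n := L))
    intro i j _ hj hij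
    have hj' := List.mem_range.1 hj
    exact ⟨h.ne _ _ _ _ hij hj', h.ne _ _ _ _ hij hj', h.ne _ _ _ _ hij hj', h.ne _ _ _ _ hij hj'⟩
  · intro p hp
    obtain ⟨i, hi, rfl⟩ := List.mem_map.1 hp
    exact h.same γ γ' i (List.mem_range.1 hi)

/-- Expand the square. The normalization makes the mean `z` component of the average exactly one, so
the cross term is `-2`; the second moment is a double sum over pairs of paths in which only common
steps are not compensated by the normalization, and it is at most `B`. -/
lemma integral_pathAverage_le {Γ : Type*} [Fintype Γ] [Nonempty Γ] {L : ℕ}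
    {s : Γ → ℕ → ι × Bool} (h : PathFamily L s) (hc : 0 < meanCos β) (hd : 1 / 3 ≤ meanSqCos β)
    {B : ℝ} (hB : ∀ γ, ∑ γ', ((meanCos β)⁻¹ ^ 2) ^ common L s γ γ' ≤ Fintype.card Γ * B) :
    ∫ ω, ‖pathAverage (meanCos β) L s ω ez - ez‖ ^ 2 ∂(edgeLaw ι β) ≤ B - 1 := by
  set c := meanCos β
  set l : Γ → List (ι × Bool) := fun γ => (List.range L).map (s γ)
  have hcard : (0 : ℝ) < Fintype.card Γ := by exact_mod_cast Fintype.card_pos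
  have hpt : ∀ γ γ', ∫ ω, inner ℝ (rot (transport ω (l γ)) ez) (rot (transport ω (l γ')) ez)
      ∂(edgeLaw ι β) ≤ c ^ L * c ^ L * (c⁻¹ ^ 2) ^ common L s γ γ' := by
    intro γ γ'
    have h1 := (integral_two_paths_le β hd _ (h.aligned γ γ')).1
    rw [List.map_map, List.map_map] at h1
    refine h1.trans_eq ?_
    have h2 : ((List.range L).map fun i => (s γ i, s γ' i)).countP (fun p => p.1 ≠ p.2)
        + common L s γ γ' = L := by
      rw [List.countP_map, common]
      have := List.length_eq_countP_add_countP (fun i => decide (s γ i = s γ' i)) (l := List.range L)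
      rw [List.length_range] at this
      have e : ((Finset.range L).filter fun i => s γ i = s γ' i).card
          = (List.range L).countP (fun i => decide (s γ i = s γ' i)) := by
        rw [List.countP_eq_length_filter]; rfl
      have e2 : (List.range L).countP ((fun p : (ι × Bool) × (ι × Bool) => decide (p.1 ≠ p.2)) ∘
          fun i => (s γ i, s γ' i))
          = (List.range L).countP (fun a => decide ¬decide (s γ a = s γ' a) = true) := by
        congr 1; ext i; simp
      rw [e, e2]
      omega
    set a := ((List.range L).map fun i => (s γ i, s γ' i)).countP (fun p => p.1 ≠ p.2)
    rw [show c ^ L = c ^ a * c ^ common L s γ γ' by rw [← pow_add, h2], inv_pow, inv_pow, ← pow_mul,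
      ← pow_mul]
    have : (c : ℝ) ^ common L s γ γ' ≠ 0 := pow_ne_zero _ hc.ne'
    change c ^ (2 * a) = _
    field_simp
    ring
  have hone : ∀ γ, ∫ ω, rot (transport ω (l γ)) ez 2 ∂(edgeLaw ι β) = c ^ L := by
    intro γ
    have := integral_path_eq β (l γ) (by
      rw [List.map_map, List.Nodup, List.pairwise_map]
      refine List.Pairwise.imp_of_mem ?_ (List.pairwise_lt_range (n := L))
      intro i j _ hj hij
      exact h.ne _ _ _ _ hij (List.mem_range.1 hj))
    simpa [l] using this
  have hexp : ∀ ω, ‖pathAverage c L s ω ez - ez‖ ^ 2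
      = (c ^ L * Fintype.card Γ)⁻¹ ^ 2 * ∑ γ, ∑ γ', inner ℝ (rot (transport ω (l γ)) ez)
        (rot (transport ω (l γ')) ez)
        - 2 * (c ^ L * Fintype.card Γ)⁻¹ * ∑ γ, rot (transport ω (l γ)) ez 2 + 1 := by
    intro ω
    rw [norm_sub_sq_real, norm_ez, pathAverage, norm_smul, mul_pow, Real.norm_eq_abs, sq_abs,
      ← real_inner_self_eq_norm_sq, real_inner_smul_left, sum_inner, sum_inner]
    simp only [inner_sum, inner_ez', l]
    ring
  have hi1 : ∀ γ γ', Integrable (fun ω => inner ℝ (rot (transport ω (l γ)) ez)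
      (rot (transport ω (l γ')) ez)) (edgeLaw ι β) := fun γ γ' => integrable_of_cont _ (by fun_prop)
  have hi2 : ∀ γ, Integrable (fun ω => rot (transport ω (l γ)) ez 2) (edgeLaw ι β) :=
    fun γ => integrable_of_cont _ (cont_coord (by fun_prop) 2)
  have hi3 : Integrable (fun ω => ∑ γ, ∑ γ', inner ℝ (rot (transport ω (l γ)) ez)
      (rot (transport ω (l γ')) ez)) (edgeLaw ι β) :=
    integrable_finsetSum _ fun γ _ => integrable_finsetSum _ fun γ' _ => hi1 γ γ'
  have hi4 : Integrable (fun ω => ∑ γ, rot (transport ω (l γ)) ez 2) (edgeLaw ι β) :=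
    integrable_finsetSum _ fun γ _ => hi2 γ
  simp only [hexp]
  rw [integral_add (f := fun ω => (c ^ L * Fintype.card Γ : ℝ)⁻¹ ^ 2 *
      ∑ γ, ∑ γ', inner ℝ (rot (transport ω (l γ)) ez) (rot (transport ω (l γ')) ez)
        - 2 * (c ^ L * Fintype.card Γ : ℝ)⁻¹ * ∑ γ, rot (transport ω (l γ)) ez 2)
      ((hi3.const_mul _).sub (hi4.const_mul _)) (integrable_const _),
    integral_sub (hi3.const_mul _) (hi4.const_mul _), integral_const_mul, integral_const_mul,
    integral_finsetSum _ fun γ _ => integrable_finsetSum _ fun γ' _ => hi1 γ γ',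
    integral_finsetSum _ fun γ _ => hi2 γ]
  rw [Finset.sum_congr rfl fun γ _ => integral_finsetSum _ fun γ' _ => hi1 γ γ']
  have h1 : ∑ γ, ∑ γ', ∫ ω, inner ℝ (rot (transport ω (l γ)) ez) (rot (transport ω (l γ')) ez)
      ∂(edgeLaw ι β) ≤ c ^ L * c ^ L * (Fintype.card Γ * (Fintype.card Γ * B)) := by
    calc _ ≤ ∑ γ, ∑ γ', c ^ L * c ^ L * (c⁻¹ ^ 2) ^ common L s γ γ' :=
          Finset.sum_le_sum fun γ _ => Finset.sum_le_sum fun γ' _ => hpt γ γ'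
      _ = c ^ L * c ^ L * ∑ γ, ∑ γ', (c⁻¹ ^ 2) ^ common L s γ γ' := by
          simp only [Finset.mul_sum]
      _ ≤ c ^ L * c ^ L * ∑ _γ : Γ, Fintype.card Γ * B := by
          gcongr with γ _; exact hB γ
      _ = _ := by simp
  simp only [hone, Finset.sum_const, Finset.card_univ, nsmul_eq_mul, integral_const, probReal_univ,
    one_smul]
  have hcL : 0 < c ^ L := by positivity
  have h2 : (c ^ L * Fintype.card Γ)⁻¹ ^ 2 * (c ^ L * c ^ L * (Fintype.card Γ * (Fintype.card Γ * B)))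
      = B := by field_simp
  have h3 : 2 * (c ^ L * Fintype.card Γ)⁻¹ * (Fintype.card Γ * c ^ L) = 2 := by field_simp
  have h4 := mul_le_mul_of_nonneg_left h1 (by positivity : 0 ≤ (c ^ L * Fintype.card Γ : ℝ)⁻¹ ^ 2)
  rw [h2] at h4
  rw [h3]
  linarith

/-- The reversed paths. -/
def revSteps {Γ : Type*} (L : ℕ) (s : Γ → ℕ → ι × Bool) (γ : Γ) (i : ℕ) : ι × Bool :=
  flipStep (s γ (L - 1 - i))

omit [DecidableEq ι] [Fintype ι] in
lemma PathFamily.rev {Γ : Type*} {L : ℕ} {s : Γ → ℕ → ι × Bool} (h : PathFamily L s) :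
    PathFamily L (revSteps L s) where
  ne γ γ' i j hij hj := (h.ne γ' γ (L - 1 - j) (L - 1 - i) (by omega) (by omega)).symm
  same γ γ' i hi he := congrArg flipStep (h.same γ γ' (L - 1 - i) (by omega) he)

omit [Fintype ι] in
lemma common_rev {Γ : Type*} {L : ℕ} (s : Γ → ℕ → ι × Bool) (γ γ' : Γ) :
    common L (revSteps L s) γ γ' = common L s γ γ' := by
  unfold common
  refine Finset.card_bij (fun i _ => L - 1 - i) ?_ ?_ ?_
  · intro i hi
    have hi := Finset.mem_filter.1 hi
    have hi1 := Finset.mem_range.1 hi.1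
    exact Finset.mem_filter.2 ⟨Finset.mem_range.2 (by omega), flipStep_injective hi.2⟩
  · intro i hi j hj hij
    have hi1 := Finset.mem_range.1 (Finset.mem_filter.1 hi).1
    have hj1 := Finset.mem_range.1 (Finset.mem_filter.1 hj).1
    omega
  · intro i hi
    have hi := Finset.mem_filter.1 hi
    have hi1 := Finset.mem_range.1 hi.1
    have he : L - 1 - (L - 1 - i) = i := by omega
    refine ⟨L - 1 - i, Finset.mem_filter.2 ⟨Finset.mem_range.2 (by omega), ?_⟩, he⟩
    change flipStep _ = flipStep _
    rw [he, hi.2]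

omit [DecidableEq ι] [Fintype ι] in
lemma transport_rev {Γ : Type*} {L : ℕ} (s : Γ → ℕ → ι × Bool) (γ : Γ) (ω : ι → SO3) :
    transport ω ((List.range L).map (revSteps L s γ))
      = (transport ω ((List.range L).map (s γ)))⁻¹ := by
  rw [transport_inv]
  congr 1
  refine List.ext_getElem (by simp) fun i h1 h2 => ?_
  simp [revSteps]

-- The adjoint of a transport is its inverse, which is the transport along the reversed path.
omit [DecidableEq ι] [Fintype ι] in
lemma inner_pathAverage_rev {Γ : Type*} [Fintype Γ] (c : ℝ) (L : ℕ) (s : Γ → ℕ → ι × Bool)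
    (ω : ι → SO3) (v w : R3) :
    inner ℝ v (pathAverage c L s ω w) = inner ℝ (pathAverage c L (revSteps L s) ω v) w := by
  simp only [pathAverage, real_inner_smul_left, real_inner_smul_right, inner_sum, sum_inner,
    transport_rev, inner_rot_right]

omit [DecidableEq ι] [Fintype ι] in
@[fun_prop]
lemma cont_pathAverage {Γ : Type*} [Fintype Γ] (c : ℝ) (L : ℕ) (s : Γ → ℕ → ι × Bool)
    {X : Type*} [TopologicalSpace X] {ω : X → ι → SO3} {v : X → R3} (hω : Continuous ω)
    (hv : Continuous v) : Continuous fun x => pathAverage c L s (ω x) (v x) := by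
  unfold pathAverage
  have h : Continuous fun x => ∑ γ, rot (transport (ω x) ((List.range L).map (s γ))) (v x) :=
    continuous_finsetSum _ fun γ _ => cont_rot (cont_transport hω _) hv
  exact (continuous_const_smul (T := R3) ((c ^ L * Fintype.card Γ : ℝ)⁻¹)).comp h

end TwoPaths

/-! ### Unpredictable walks -/

section Unpredictable

lemma sum_resample {ι α : Type*} [Fintype ι] [DecidableEq ι] [Fintype α] (κ : ι)
    (f : (ι → α) → ℝ) :
    ∑ ζ, ∑ q, f (Function.update ζ κ q) = Fintype.card α * ∑ ζ, f ζ := by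
  have h : ∀ F : (ι → α) → ℝ, ∑ ζ, F ζ = ∑ p : α × ({j // j ≠ κ} → α),
      F ((Equiv.funSplitAt κ α).symm p) := fun F =>
    (Equiv.sum_comp (Equiv.funSplitAt κ α).symm F).symm
  have hu : ∀ (b q : α) (g : {j // j ≠ κ} → α),
      Function.update ((Equiv.funSplitAt κ α).symm (b, g)) κ q
        = (Equiv.funSplitAt κ α).symm (q, g) := by
    intro b q g
    ext j
    by_cases hj : j = κ
    · subst hj; simp [Equiv.funSplitAt]
    · simp [Equiv.funSplitAt, hj]
  rw [h, h, Fintype.sum_prod_type, Fintype.sum_prod_type]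
  simp only [hu]
  rw [Finset.sum_const, Finset.card_univ, nsmul_eq_mul, Finset.sum_comm]

/-- The randomness of a walk: one digit for each scale and each dyadic interval of this scale. -/
abbrev Noise (m : ℕ) : Type := Fin (m + 1) × Fin (2 ^ m) → Fin (2 ^ m)

variable {m : ℕ}

/-- The digit of the `i`-th dyadic interval of scale `k`, as a number in `[0, 1)`. -/
def digit (ζ : Noise m) (k i : ℕ) : ℝ :=
  if h : k < m + 1 ∧ i < 2 ^ m then (ζ (⟨k, h.1⟩, ⟨i, h.2⟩) : ℝ) / 2 ^ m else 0

/-- The velocity at time `t`, a sum of independent contributions of all scales. -/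
def velocity (ζ : Noise m) (t : ℕ) : ℝ :=
  ∑ k ∈ Finset.range (m + 1), 1 / 4 * (3 / 4) ^ k * digit ζ k (t / 2 ^ k)

/-- The walk with the given velocity. -/
def walkR (ζ : Noise m) (h : ℕ) : ℝ := ∑ t ∈ Finset.range h, velocity ζ t

/-- The integer part of the walk. -/
def walk (ζ : Noise m) (h : ℕ) : ℤ := ⌊walkR ζ h⌋

lemma digit_nonneg (ζ : Noise m) (k i : ℕ) : 0 ≤ digit ζ k i := by
  unfold digit; split_ifs <;> positivity

lemma digit_le_one (ζ : Noise m) (k i : ℕ) : digit ζ k i ≤ 1 := by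
  unfold digit; split_ifs with h
  · rw [div_le_one (by positivity)]
    exact_mod_cast (ζ (⟨k, h.1⟩, ⟨i, h.2⟩)).2.le
  · exact zero_le_one

lemma velocity_nonneg (ζ : Noise m) (t : ℕ) : 0 ≤ velocity ζ t :=
  Finset.sum_nonneg fun k _ => mul_nonneg (by positivity) (digit_nonneg _ _ _)

/-- The weights `1 / 4 * (3 / 4) ^ k` have sum less than one, so that the integer part of the walk
moves by `0` or `1`. They decay slower than `2 ^ (-k)`: a digit of scale `k` acts during `2 ^ k`
steps, and displaces the walk by up to order `(3 / 2) ^ k`. -/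
lemma velocity_lt_one (ζ : Noise m) (t : ℕ) : velocity ζ t < 1 := by
  have h1 : velocity ζ t ≤ ∑ k ∈ Finset.range (m + 1), 1 / 4 * (3 / 4 : ℝ) ^ k :=
    Finset.sum_le_sum fun k _ =>
      mul_le_of_le_one_right (by positivity) (digit_le_one _ _ _)
  have e : ((3 / 4 : ℝ) ^ (m + 1) - 1) / (3 / 4 - 1) = 4 * (1 - (3 / 4) ^ (m + 1)) := by
    rw [div_eq_iff (by norm_num)]; ring
  rw [← Finset.mul_sum, geom_sum_eq (by norm_num), e] at h1
  have : (0 : ℝ) < (3 / 4) ^ (m + 1) := by positivity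
  linarith

lemma walk_zero (ζ : Noise m) : walk ζ 0 = 0 := by simp [walk, walkR]

lemma walk_succ (ζ : Noise m) (h : ℕ) : walk ζ (h + 1) = walk ζ h ∨ walk ζ (h + 1) = walk ζ h + 1 := by
  have e : walkR ζ (h + 1) = walkR ζ h + velocity ζ h := Finset.sum_range_succ _ _
  have h1 : walk ζ h ≤ walk ζ (h + 1) := Int.floor_mono (by rw [e]; linarith [velocity_nonneg ζ h])
  have h2 : walk ζ (h + 1) < walk ζ h + 2 := by
    unfold walk
    rw [Int.floor_lt, e]
    push_cast
    linarith [velocity_lt_one ζ h, Int.lt_floor_add_one (walkR ζ h)]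
  omega

/-- The time spent before `h` in the `i`-th dyadic interval of scale `k`. -/
def timeIn (k i h : ℕ) : ℕ := ((Finset.range h).filter fun t => t / 2 ^ k = i).card

lemma timeIn_eq_zero {k i h : ℕ} (hi : h ≤ i * 2 ^ k) : timeIn k i h = 0 := by
  rw [timeIn, Finset.card_eq_zero, Finset.filter_eq_empty_iff]
  intro t ht hti
  have h1 := Finset.mem_range.1 ht
  have h2 := Nat.div_mul_le_self t (2 ^ k)
  rw [hti] at h2
  omega

lemma timeIn_eq {k i h : ℕ} (hi : (i + 1) * 2 ^ k ≤ h) : timeIn k i h = 2 ^ k := by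
  have : (Finset.range h).filter (fun t => t / 2 ^ k = i) = Finset.Ico (i * 2 ^ k) ((i + 1) * 2 ^ k) := by
    ext t
    rw [Finset.mem_filter, Finset.mem_range, Finset.mem_Ico, Nat.div_eq_iff (by positivity)]
    have : (i + 1) * 2 ^ k = i * 2 ^ k + 2 ^ k := by ring
    have : 0 < 2 ^ k := by positivity
    omega
  rw [timeIn, this, Nat.card_Ico, add_mul, one_mul, Nat.add_sub_cancel_left]

lemma digit_update (ζ : Noise m) {k i : ℕ} (hk : k < m + 1) (hi : i < 2 ^ m) (q : Fin (2 ^ m))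
    (k' i' : ℕ) : digit (Function.update ζ (⟨k, hk⟩, ⟨i, hi⟩) q) k' i'
      = if k' = k ∧ i' = i then (q : ℝ) / 2 ^ m else digit ζ k' i' := by
  unfold digit
  by_cases h : k' = k ∧ i' = i
  · obtain ⟨rfl, rfl⟩ := h
    simp [hk, hi]
  · rw [if_neg h]
    split_ifs with h'
    · rw [Function.update_of_ne]
      intro he
      simp only [Prod.mk.injEq, Fin.mk.injEq] at he
      exact h he
    · rfl

lemma walkR_update (ζ : Noise m) {k i : ℕ} (hk : k < m + 1) (hi : i < 2 ^ m) (q : Fin (2 ^ m))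
    (h : ℕ) : walkR (Function.update ζ (⟨k, hk⟩, ⟨i, hi⟩) q) h
      = walkR ζ h + 1 / 4 * (3 / 4) ^ k * timeIn k i h * ((q : ℝ) / 2 ^ m - digit ζ k i) := by
  have hv : ∀ t, velocity (Function.update ζ (⟨k, hk⟩, ⟨i, hi⟩) q) t
      = velocity ζ t + if t / 2 ^ k = i then
        1 / 4 * (3 / 4) ^ k * ((q : ℝ) / 2 ^ m - digit ζ k i) else 0 := by
    intro t
    unfold velocity
    simp only [digit_update]
    rw [← Finset.add_sum_erase _ _ (Finset.mem_range.2 hk),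
      ← Finset.add_sum_erase _ (fun k' => 1 / 4 * (3 / 4 : ℝ) ^ k' * digit ζ k' (t / 2 ^ k'))
      (Finset.mem_range.2 hk)]
    have : ∀ x ∈ (Finset.range (m + 1)).erase k, 1 / 4 * (3 / 4 : ℝ) ^ x *
        (if x = k ∧ t / 2 ^ x = i then (q : ℝ) / 2 ^ m else digit ζ x (t / 2 ^ x))
        = 1 / 4 * (3 / 4) ^ x * digit ζ x (t / 2 ^ x) := by
      intro x hx
      rw [if_neg fun hh => Finset.ne_of_mem_erase hx hh.1]
    rw [Finset.sum_congr rfl this]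
    by_cases ht : t / 2 ^ k = i
    · simp only [ht, and_self, if_true]; ring
    · simp [ht]
  unfold walkR
  simp only [hv]
  rw [Finset.sum_add_distrib, ← Finset.sum_filter, Finset.sum_const, nsmul_eq_mul, timeIn]
  ring

lemma walk_update_of_le (ζ : Noise m) {k i : ℕ} (hk : k < m + 1) (hi : i < 2 ^ m) (q : Fin (2 ^ m))
    {h : ℕ} (hh : h ≤ i * 2 ^ k) : walk (Function.update ζ (⟨k, hk⟩, ⟨i, hi⟩) q) h = walk ζ h := by
  simp [walk, walkR_update, timeIn_eq_zero hh]

lemma card_fin_filter_le {Q : ℕ} {p : Fin Q → Prop} [DecidablePred p] {l : ℝ} (hl : 0 ≤ l)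
    (hp : ∀ a b, p a → p b → ((b : ℕ) : ℝ) - ((a : ℕ) : ℝ) ≤ l) :
    ((Finset.univ.filter p).card : ℝ) ≤ l + 1 := by
  by_cases hne : (Finset.univ.filter p).Nonempty
  · set a := (Finset.univ.filter p).min' hne
    set b := (Finset.univ.filter p).max' hne
    have ha : p a := (Finset.mem_filter.1 (Finset.min'_mem _ hne)).2
    have hb : p b := (Finset.mem_filter.1 (Finset.max'_mem _ hne)).2
    have hsub : Finset.univ.filter p ⊆ Finset.Icc a b := fun x hx =>
      Finset.mem_Icc.2 ⟨Finset.min'_le _ _ hx, Finset.le_max' _ _ hx⟩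
    have h1 := Finset.card_le_card hsub
    rw [Fin.card_Icc] at h1
    have hab : (a : ℕ) ≤ b := Finset.min'_le _ _ (Finset.max'_mem _ hne)
    have h2 : ((Finset.univ.filter p).card : ℝ) ≤ (b : ℕ) + 1 - (a : ℕ) := by
      have : (Finset.univ.filter p).card + (a : ℕ) ≤ (b : ℕ) + 1 := by omega
      have : ((Finset.univ.filter p).card : ℝ) + (a : ℕ) ≤ (b : ℕ) + 1 := by exact_mod_cast this
      linarith
    linarith [hp a b ha hb]
  · rw [Finset.not_nonempty_iff_eq_empty.1 hne]
    simp; linarith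

/-- A digit that has not been used before time `h` makes the position at time `h'` spread out. -/
lemma sum_walk_eq_le {k i h' : ℕ} (hk : k < m + 1) (hi : i < 2 ^ m) (hih : (i + 1) * 2 ^ k ≤ h')
    {F : Noise m → ℝ} (hF : ∀ ζ, 0 ≤ F ζ)
    (hFu : ∀ ζ q, F (Function.update ζ (⟨k, hk⟩, ⟨i, hi⟩) q) = F ζ) (z : ℤ) :
    ∑ ζ, F ζ * (if walk ζ h' = z then 1 else 0) ≤ 8 * (2 / 3) ^ k * ∑ ζ, F ζ := by
  have hQ : (0 : ℝ) < 2 ^ m := by positivity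
  have hA : (1 / 4 * (3 / 4 : ℝ) ^ k * (2 ^ k : ℕ)) = 1 / 4 * (3 / 2) ^ k := by
    push_cast
    rw [mul_assoc, ← mul_pow]; norm_num
  have hApos : (0 : ℝ) < 1 / 4 * (3 / 2) ^ k := by positivity
  have hAle : 1 / 4 * (3 / 2 : ℝ) ^ k ≤ 2 ^ m := by
    have h1 : (3 / 2 : ℝ) ^ k ≤ 2 ^ k := by gcongr; norm_num
    have h2 : (2 : ℝ) ^ k ≤ 2 ^ m := pow_le_pow_right₀ (by norm_num) (by omega)
    have h3 : (0 : ℝ) < (3 / 2) ^ k := by positivity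
    linarith
  -- As the digit of this interval varies, the walk at time `h'` moves linearly with range `A = 1 /
  -- 4 * (3 / 2) ^ k`. Values with the same integer part differ by at most `2 ^ m / A`, so there are
  -- at most `2 ^ m / A + 1 ≤ 2 * 2 ^ m / A` of them.
  have key : ∀ ζ : Noise m, ∑ q : Fin (2 ^ m),
      (if walk (Function.update ζ (⟨k, hk⟩, ⟨i, hi⟩) q) h' = z then (1 : ℝ) else 0)
      ≤ 2 ^ m * (8 * (2 / 3) ^ k) := by
    intro ζ
    rw [Finset.sum_boole]
    have h1 := card_fin_filter_le (Q := 2 ^ m)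
      (p := fun q => walk (Function.update ζ (⟨k, hk⟩, ⟨i, hi⟩) q) h' = z)
      (l := 2 ^ m / (1 / 4 * (3 / 2 : ℝ) ^ k)) (by positivity) (by
        intro a b ha hb
        simp only [walk, walkR_update, timeIn_eq hih, hA] at ha hb
        rw [Int.floor_eq_iff] at ha hb
        rw [le_div_iff₀ hApos]
        have h2 : 1 / 4 * (3 / 2 : ℝ) ^ k * ((b : ℕ) / 2 ^ m) - 1 / 4 * (3 / 2 : ℝ) ^ k * ((a : ℕ) / 2 ^ m)
            ≤ 1 := by linarith [ha.1, hb.2]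
        have h3 : ((b : ℕ) - (a : ℕ) : ℝ) * (1 / 4 * (3 / 2) ^ k)
            = 2 ^ m * (1 / 4 * (3 / 2 : ℝ) ^ k * ((b : ℕ) / 2 ^ m)
              - 1 / 4 * (3 / 2 : ℝ) ^ k * ((a : ℕ) / 2 ^ m)) := by field_simp
        rw [h3]
        nlinarith)
    refine h1.trans ?_
    have h4 : (8 * (2 / 3 : ℝ) ^ k) = 2 / (1 / 4 * (3 / 2 : ℝ) ^ k) := by
      rw [div_pow, div_pow]; field_simp; norm_num
    have h5 : 1 ≤ 2 ^ m / (1 / 4 * (3 / 2 : ℝ) ^ k) := (one_le_div hApos).2 hAle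
    rw [h4, mul_div_left_comm]
    linarith
  have hres := sum_resample (⟨k, hk⟩, ⟨i, hi⟩)
    (fun ζ : Noise m => F ζ * (if walk ζ h' = z then 1 else 0))
  simp only [hFu, ← Finset.mul_sum, Fintype.card_fin] at hres
  have hle : ∑ ζ : Noise m, F ζ * ∑ q : Fin (2 ^ m),
      (if walk (Function.update ζ (⟨k, hk⟩, ⟨i, hi⟩) q) h' = z then (1 : ℝ) else 0)
      ≤ ∑ ζ, F ζ * (2 ^ m * (8 * (2 / 3) ^ k)) :=
    Finset.sum_le_sum fun ζ _ => mul_le_mul_of_nonneg_left (key ζ) (hF ζ)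
  rw [hres, ← Finset.sum_mul] at hle
  push_cast at hle
  rw [← mul_le_mul_iff_right₀ hQ]
  linarith

/-- A bound on the probability that a pair of walks is at a given point, `l` steps after the last
time it was observed. -/
def spread (l : ℕ) : ℝ := 144 * (4 / 9) ^ Nat.log 2 l

/-! ### Meetings of a pair of walks with a fixed path. -/

lemma spread_nonneg (l : ℕ) : 0 ≤ spread l := by unfold spread; positivity

/-- A dyadic block of `2 ^ J` times contributes `144 * (8 / 9) ^ J`, a convergent geometric series.
A single walk would give `2 * (2 / 3) > 1` as ratio; this is where two transverse walks, hence three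
dimensions, are used. -/
lemma sum_spread_pow (J : ℕ) :
    ∑ l ∈ Finset.Ico 1 (2 ^ J), spread l ≤ 1296 * (1 - (8 / 9) ^ J) := by
  induction J with
  | zero => simp
  | succ J ih =>
    rw [← Finset.sum_Ico_consecutive _ Nat.one_le_two_pow
      (Nat.pow_le_pow_right (by norm_num) J.le_succ)]
    have h1 : ∑ l ∈ Finset.Ico (2 ^ J) (2 ^ (J + 1)), spread l = 144 * (8 / 9) ^ J := by
      have : ∀ l ∈ Finset.Ico (2 ^ J) (2 ^ (J + 1)), spread l = 144 * (4 / 9) ^ J := by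
        intro l hl
        have hl := Finset.mem_Ico.1 hl
        rw [spread, Nat.log_eq_of_pow_le_of_lt_pow hl.1 hl.2]
      rw [Finset.sum_congr rfl this, Finset.sum_const, Nat.card_Ico, nsmul_eq_mul,
        show 2 ^ (J + 1) - 2 ^ J = 2 ^ J by rw [pow_succ]; omega]
      push_cast
      rw [mul_left_comm, ← mul_pow]; norm_num
    rw [h1, pow_succ]
    linarith

lemma sum_spread_le (H : ℕ) : ∑ l ∈ Finset.range H, spread (l + 1) ≤ 1296 := by
  have h1 : ∑ l ∈ Finset.range H, spread (l + 1) = ∑ l ∈ Finset.Ico 1 (H + 1), spread l := by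
    rw [Finset.sum_Ico_eq_sum_range]; simp [add_comm]
  have h2 : ∑ l ∈ Finset.Ico 1 (H + 1), spread l ≤ ∑ l ∈ Finset.Ico 1 (2 ^ (H + 1)), spread l :=
    Finset.sum_le_sum_of_subset_of_nonneg
      (Finset.Ico_subset_Ico_right Nat.lt_two_pow_self.le) fun l _ _ => spread_nonneg l
  have h3 := sum_spread_pow (H + 1)
  have : (0 : ℝ) < (8 / 9) ^ (H + 1) := by positivity
  linarith

/-- Whether a pair of walks is at the point `(z, w)` at time `h`. -/
def meets (z w : ℕ → ℤ) (h : ℕ) (γ : Noise m × Noise m) : ℝ :=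
  if walk γ.1 h = z h ∧ walk γ.2 h = w h then 1 else 0

lemma meets_eq (z w : ℕ → ℤ) (h : ℕ) (γ : Noise m × Noise m) :
    meets z w h γ = (if walk γ.1 h = z h then 1 else 0) * (if walk γ.2 h = w h then 1 else 0) := by
  unfold meets
  by_cases h1 : walk γ.1 h = z h <;> by_cases h2 : walk γ.2 h = w h <;> simp [h1, h2]

lemma meets_nonneg (z w : ℕ → ℤ) (h : ℕ) (γ : Noise m × Noise m) : 0 ≤ meets z w h γ := by
  unfold meets; split_ifs <;> norm_num

lemma meets_le_one (z w : ℕ → ℤ) (h : ℕ) (γ : Noise m × Noise m) : meets z w h γ ≤ 1 := by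
  unfold meets; split_ifs <;> norm_num

/-- A function of a pair of walks that depends on the walks up to time `h` only. -/
def Past (h : ℕ) (F : Noise m × Noise m → ℝ) : Prop :=
  ∀ γ γ' : Noise m × Noise m, (∀ j ≤ h, walk γ.1 j = walk γ'.1 j ∧ walk γ.2 j = walk γ'.2 j) →
    F γ = F γ'

/-- Between `h` and `h'` lies an entire dyadic interval of length `2 ^ k` with `k + 1 = log₂ (h' -
h)`. The digits of both walks on it are independent of the past, and each spreads its walk: `(8
(2/3)^k)^2 = 144 (4/9)^(k+1)`. -/
lemma sum_meets_le (z w : ℕ → ℤ) {h h' : ℕ} (hh : h < h') (hm : h' ≤ 2 ^ m)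
    {F : Noise m × Noise m → ℝ} (hF : ∀ γ, 0 ≤ F γ) (hP : Past h F) :
    ∑ γ, F γ * meets z w h' γ ≤ spread (h' - h) * ∑ γ, F γ := by
  obtain ⟨l, rfl⟩ := Nat.exists_eq_add_of_lt hh
  rw [show h + l + 1 - h = l + 1 by omega]
  -- For a gap of one there is no room for such an interval, but `spread 1 = 144` makes the bound
  -- trivial.
  rcases Nat.eq_zero_or_pos l with rfl | hl
  · have h1 : ∑ γ, F γ * meets z w (h + 0 + 1) γ ≤ ∑ γ, F γ :=
      Finset.sum_le_sum fun γ _ => mul_le_of_le_one_right (hF γ) (meets_le_one _ _ _ _)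
    have h2 : 0 ≤ ∑ γ, F γ := Finset.sum_nonneg fun γ _ => hF γ
    have : spread (0 + 1) = 144 := by simp [spread]
    rw [this]; linarith
  · obtain ⟨k, hk⟩ : ∃ k, Nat.log 2 (l + 1) = k + 1 :=
      Nat.exists_eq_succ_of_ne_zero (Nat.log_pos (by norm_num) (by omega)).ne'
    have hkl : 2 ^ (k + 1) ≤ l + 1 := by
      rw [← hk]; exact Nat.pow_log_le_self 2 (by omega)
    have h2k : 0 < 2 ^ k := by positivity
    -- `i * 2 ^ k` is the first multiple of `2 ^ k` from `h` on; a window of length `2 ^ (k + 1)`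
    -- leaves room for the interval that starts there.
    obtain ⟨i, hi1, hi2⟩ : ∃ i, h ≤ i * 2 ^ k ∧ (i + 1) * 2 ^ k ≤ h + l + 1 := by
      refine ⟨(h + 2 ^ k - 1) / 2 ^ k, ?_, ?_⟩
      · have := Nat.lt_div_mul_add (a := h + 2 ^ k - 1) h2k
        omega
      · have := Nat.div_mul_le_self (h + 2 ^ k - 1) (2 ^ k)
        rw [pow_succ] at hkl
        rw [add_mul]
        omega
    have hkm : k < m + 1 := by
      have : 2 ^ k < 2 ^ (m + 1) := by
        rw [pow_succ] at *; omega
      exact (Nat.pow_lt_pow_iff_right (by norm_num)).1 this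
    have him : i < 2 ^ m := by
      have : i + 1 ≤ (i + 1) * 2 ^ k := Nat.le_mul_of_pos_right _ h2k
      omega
    have hsp : spread (l + 1) = 8 * (2 / 3) ^ k * (8 * (2 / 3) ^ k) := by
      rw [spread, hk, pow_succ, show (4 / 9 : ℝ) = 2 / 3 * (2 / 3) by norm_num, mul_pow]; ring
    rw [hsp, Fintype.sum_prod_type, Fintype.sum_prod_type]
    have inner : ∀ ζ, ∑ ξ, F (ζ, ξ) * meets z w (h + l + 1) (ζ, ξ)
        ≤ (8 * (2 / 3) ^ k * ∑ ξ, F (ζ, ξ)) * (if walk ζ (h + l + 1) = z (h + l + 1) then 1 else 0) := by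
      intro ζ
      have h1 := sum_walk_eq_le hkm him hi2 (F := fun ξ => F (ζ, ξ)) (fun ξ => hF _)
        (fun ξ q => hP _ _ fun j hj => ⟨rfl, walk_update_of_le ξ hkm him q (hj.trans hi1)⟩)
        (w (h + l + 1))
      have h2 := mul_le_mul_of_nonneg_right h1
        (by split_ifs <;> norm_num : (0 : ℝ) ≤ if walk ζ (h + l + 1) = z (h + l + 1) then 1 else 0)
      refine le_of_eq_of_le ?_ h2
      rw [Finset.sum_mul]
      refine Finset.sum_congr rfl fun ξ _ => ?_
      rw [meets_eq]; ring
    refine (Finset.sum_le_sum fun ζ _ => inner ζ).trans ?_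
    refine (sum_walk_eq_le hkm him hi2 (F := fun ζ => 8 * (2 / 3) ^ k * ∑ ξ, F (ζ, ξ))
      (fun ζ => mul_nonneg (by positivity) (Finset.sum_nonneg fun ξ _ => hF _)) (fun ζ q => ?_) _).trans_eq ?_
    · congr 1
      refine Finset.sum_congr rfl fun ξ _ => ?_
      exact hP _ _ fun j hj => ⟨walk_update_of_le ζ hkm him q (hj.trans hi1), rfl⟩
    · rw [← Finset.mul_sum]; ring

/-- The weight `K ^ N`, where `N` is the number of meetings at times `1, …, h`. -/
def meetWeight (K : ℝ) (z w : ℕ → ℤ) (h : ℕ) (γ : Noise m × Noise m) : ℝ :=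
  ∏ j ∈ Finset.range h, (1 + (K - 1) * meets z w (j + 1) γ)

/-- Telescoping: the weight grows only at meetings, each time by `K - 1` times its previous value.
-/
lemma meetWeight_eq (K : ℝ) (z w : ℕ → ℤ) (h : ℕ) (γ : Noise m × Noise m) :
    meetWeight K z w h γ
      = 1 + (K - 1) * ∑ j ∈ Finset.range h, meets z w (j + 1) γ * meetWeight K z w j γ := by
  induction h with
  | zero => simp [meetWeight]
  | succ h ih =>
    have : meetWeight K z w (h + 1) γ
        = meetWeight K z w h γ * (1 + (K - 1) * meets z w (h + 1) γ) := Finset.prod_range_succ _ _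
    rw [this, Finset.sum_range_succ]
    linear_combination ih

lemma meetWeight_nonneg {K : ℝ} (hK : 1 ≤ K) (z w : ℕ → ℤ) (h : ℕ) (γ : Noise m × Noise m) :
    0 ≤ meetWeight K z w h γ :=
  Finset.prod_nonneg fun j _ => by
    have := mul_nonneg (sub_nonneg.2 hK) (meets_nonneg z w (j + 1) γ)
    linarith

lemma past_meets_mul (K : ℝ) (z w : ℕ → ℤ) (h : ℕ) :
    Past (m := m) (h + 1) fun γ => meets z w (h + 1) γ * meetWeight K z w h γ := by
  intro γ γ' hγ
  have h1 : ∀ j ≤ h + 1, meets z w j γ = meets z w j γ' := fun j hj => by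
    simp [meets, hγ j hj]
  simp only [meetWeight]
  rw [h1 _ le_rfl]
  congr 1
  refine Finset.prod_congr rfl fun j hj => ?_
  rw [h1]
  have := Finset.mem_range.1 hj
  omega

/-- Exponential intersection tails: the number of meetings with a fixed path has a uniformly
bounded exponential moment. -/
theorem sum_meetWeight_le {K : ℝ} (hK : 1 ≤ K) (hK2 : (K - 1) * 2592 ≤ 1) (z w : ℕ → ℤ) {H : ℕ}
    (hH : H ≤ 2 ^ m) :
    ∑ γ : Noise m × Noise m, meetWeight K z w H γ
      ≤ Fintype.card (Noise m × Noise m) * (1 + 2592 * (K - 1)) := by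
  set C : ℝ := ((Fintype.card (Noise m × Noise m) : ℕ) : ℝ)
  set b : ℕ → ℝ := fun h => ∑ γ : Noise m × Noise m, meets z w (h + 1) γ * meetWeight K z w h γ with hb
  have hb0 : ∀ h, 0 ≤ b h := fun h => Finset.sum_nonneg fun γ _ =>
    mul_nonneg (meets_nonneg _ _ _ _) (meetWeight_nonneg hK _ _ _ _)
  -- Expand the weight according to an earlier meeting `j + 1`. Whatever happened up to that
  -- meeting, the next one at `h + 1` costs `spread (h - j)`; the term without an earlier meeting
  -- counts from time `0`.
  have hrec : ∀ h < H, b h ≤ spread (h + 1) * C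
      + (K - 1) * ∑ j ∈ Finset.range h, spread (h - j) * b j := by
    intro h hh
    have e : b h = ∑ γ : Noise m × Noise m, 1 * meets z w (h + 1) γ
        + (K - 1) * ∑ j ∈ Finset.range h,
          ∑ γ : Noise m × Noise m, (meets z w (j + 1) γ * meetWeight K z w j γ) * meets z w (h + 1) γ := by
      rw [Finset.sum_comm, Finset.mul_sum, ← Finset.sum_add_distrib, hb]
      refine Finset.sum_congr rfl fun γ _ => ?_
      rw [meetWeight_eq, ← Finset.sum_mul]; ring
    rw [e]
    refine add_le_add ?_ (mul_le_mul_of_nonneg_left (Finset.sum_le_sum fun j hj => ?_) (by linarith))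
    · have := sum_meets_le (m := m) z w (h := 0) (h' := h + 1) (by omega) (by omega) (F := fun _ => 1)
        (fun _ => zero_le_one) fun _ _ _ => rfl
      simpa [C] using this
    · have hj := Finset.mem_range.1 hj
      have := sum_meets_le (m := m) z w (h := j + 1) (h' := h + 1) (by omega) (by omega)
        (fun γ => mul_nonneg (meets_nonneg _ _ _ _) (meetWeight_nonneg hK _ _ _ _))
        (past_meets_mul K z w j)
      rwa [show h + 1 - (j + 1) = h - j by omega] at this
  set B := ∑ h ∈ Finset.range H, b h with hB
  have hdouble : ∑ h ∈ Finset.range H, ∑ j ∈ Finset.range h, spread (h - j) * b j ≤ 1296 * B := by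
    rw [Finset.sum_comm' (t' := Finset.range H) (s' := fun j => Finset.Ico (j + 1) H) (by
      intro x y; simp only [Finset.mem_range, Finset.mem_Ico]; omega), hB, Finset.mul_sum]
    refine Finset.sum_le_sum fun j _ => ?_
    rw [← Finset.sum_mul, Finset.sum_Ico_eq_sum_range]
    refine mul_le_mul_of_nonneg_right ?_ (hb0 j)
    refine le_of_eq_of_le (Finset.sum_congr rfl fun i _ => ?_) (sum_spread_le (H - (j + 1)))
    congr 1; omega
  -- Summing the convolution inequality over `h` multiplies by the total mass `1296` of `spread`;
  -- since `(K - 1) * 1296 ≤ 1 / 2`, the term with `B` is absorbed on the left.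
  have hsum : B ≤ 1296 * C + (K - 1) * (1296 * B) := by
    have h1 : B ≤ ∑ h ∈ Finset.range H, (spread (h + 1) * C
      + (K - 1) * ∑ j ∈ Finset.range h, spread (h - j) * b j) :=
      Finset.sum_le_sum fun h hh => hrec h (Finset.mem_range.1 hh)
    rw [Finset.sum_add_distrib, ← Finset.sum_mul, ← Finset.mul_sum] at h1
    refine h1.trans (add_le_add ?_ (mul_le_mul_of_nonneg_left hdouble (by linarith)))
    exact mul_le_mul_of_nonneg_right (sum_spread_le H) (by positivity)
  have hB0 : 0 ≤ B := Finset.sum_nonneg fun h _ => hb0 h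
  have hB2 : B ≤ 2592 * C := by nlinarith
  have hfin : ∑ γ : Noise m × Noise m, meetWeight K z w H γ = C + (K - 1) * B := by
    rw [hB, Finset.sum_comm, Finset.mul_sum]
    simp only [meetWeight_eq K z w H]
    rw [Finset.sum_add_distrib]
    simp [C]
  rw [hfin]
  nlinarith

end Unpredictable

/-! ### Spin differences along families of paths -/

section SpinDifferences

variable {Λ : Finset Site}

/-- The averaged mean square of the difference of the `z` components of the spins at two sites. -/
def sqDiff (β : ℝ) (x y : Λ) : ℝ :=
  ∫ ω, ∫ S, ((S x : R3) 2 - (S y : R3) 2) ^ 2 ∂(gibbs β ω) ∂(disorderLaw β Λ)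

lemma cont_spin {X : Type*} [TopologicalSpace X] {S : X → Λ → S2} (hS : Continuous S) (x : Λ) :
    Continuous fun p => (S p x : R3) :=
  cont_coe_S2 ((continuous_apply x).comp hS)

attribute [fun_prop] cont_spin

lemma integrable_gibbs_integral (β : ℝ) {F : Disorder Λ → (Λ → S2) → ℝ}
    (hF : Continuous (Function.uncurry F)) :
    Integrable (fun ω => ∫ S, F ω S ∂(gibbs β ω)) (disorderLaw β Λ) :=
  integrable_of_cont _ (cont_gibbs β hF)

lemma integral_gibbs_mono (β : ℝ) {F G : Disorder Λ → (Λ → S2) → ℝ}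
    (hF : Continuous (Function.uncurry F)) (hG : Continuous (Function.uncurry G))
    (h : ∀ ω S, F ω S ≤ G ω S) :
    ∫ ω, ∫ S, F ω S ∂(gibbs β ω) ∂(disorderLaw β Λ)
      ≤ ∫ ω, ∫ S, G ω S ∂(gibbs β ω) ∂(disorderLaw β Λ) :=
  integral_mono (integrable_gibbs_integral β hF) (integrable_gibbs_integral β hG) fun ω =>
    integral_mono
      (integrable_of_cont _ (hF.comp (by fun_prop : Continuous fun S : Λ → S2 => (ω, S))))
      (integrable_of_cont _ (hG.comp (by fun_prop : Continuous fun S : Λ → S2 => (ω, S))))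
      fun S => h ω S

lemma integral_gibbs_add (β : ℝ) {F G : Disorder Λ → (Λ → S2) → ℝ}
    (hF : Continuous (Function.uncurry F)) (hG : Continuous (Function.uncurry G)) :
    ∫ ω, ∫ S, (F ω S + G ω S) ∂(gibbs β ω) ∂(disorderLaw β Λ)
      = ∫ ω, ∫ S, F ω S ∂(gibbs β ω) ∂(disorderLaw β Λ)
        + ∫ ω, ∫ S, G ω S ∂(gibbs β ω) ∂(disorderLaw β Λ) := by
  rw [← integral_add (integrable_gibbs_integral β hF) (integrable_gibbs_integral β hG)]
  congr 1
  ext ω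
  exact integral_add
    (integrable_of_cont _ (hF.comp (by fun_prop : Continuous fun S : Λ → S2 => (ω, S))))
    (integrable_of_cont _ (hG.comp (by fun_prop : Continuous fun S : Λ → S2 => (ω, S))))

lemma integral_gibbs_const_mul (β : ℝ) (a : ℝ) (F : Disorder Λ → (Λ → S2) → ℝ) :
    ∫ ω, ∫ S, a * F ω S ∂(gibbs β ω) ∂(disorderLaw β Λ)
      = a * ∫ ω, ∫ S, F ω S ∂(gibbs β ω) ∂(disorderLaw β Λ) := by
  simp only [integral_const_mul]

lemma sqDiff_triangle (β : ℝ) (x y z : Λ) :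
    sqDiff β x z ≤ 2 * sqDiff β x y + 2 * sqDiff β y z := by
  unfold sqDiff
  rw [← integral_gibbs_const_mul, ← integral_gibbs_const_mul, ← integral_gibbs_add]
  · refine integral_gibbs_mono β ?_ ?_ fun ω S => ?_
    · unfold Function.uncurry; fun_prop
    · unfold Function.uncurry; fun_prop
    · nlinarith [sq_nonneg ((S x : R3) 2 - 2 * (S y : R3) 2 + (S z : R3) 2)]
  · unfold Function.uncurry; fun_prop
  · unfold Function.uncurry; fun_prop

/-- If a gauge covariant estimator of the rotation between `x` and `y` is given by averages over
families of paths in both directions, then the spins at `x` and `y` are close. -/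
lemma sqDiff_le_of_pathFamily (β : ℝ) {Γ : Type*} [Fintype Γ] [Nonempty Γ] {L : ℕ}
    {s : Γ → ℕ → PosEdge Λ × Bool} (h : PathFamily L s) {x y : Λ}
    (hcov : ∀ γ (θ : Λ → SO3) (ω : Disorder Λ), transport (gauge θ ω) ((List.range L).map (s γ))
      = θ x * transport ω ((List.range L).map (s γ)) * (θ y)⁻¹)
    (hc : 0 < meanCos β) (hd : 1 / 3 ≤ meanSqCos β) {B : ℝ}
    (hB : ∀ γ, ∑ γ', ((meanCos β)⁻¹ ^ 2) ^ common L s γ γ' ≤ Fintype.card Γ * B) :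
    sqDiff β x y ≤ 4 * (B - 1) := by
  set M := pathAverage (meanCos β) L s with hM
  set M' := pathAverage (meanCos β) L (revSteps L s) with hM'
  have hMcont : Continuous fun p : Disorder Λ × R3 => M p.1 p.2 :=
    cont_pathAverage _ _ _ continuous_fst continuous_snd
  have h1 : ∫ ω, ‖M ω ez - ez‖ ^ 2 ∂(disorderLaw β Λ) ≤ B - 1 :=
    integral_pathAverage_le h hc hd hB
  have h2 : ∫ ω, ‖M' ω ez - ez‖ ^ 2 ∂(disorderLaw β Λ) ≤ B - 1 :=
    integral_pathAverage_le h.rev hc hd fun γ => by simpa only [common_rev] using hB γ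
  have hGcont : Continuous (Function.uncurry fun (ω : Disorder Λ) (S : Λ → S2) =>
      ‖M ω (S y : R3) - (S x : R3)‖ ^ 2) := by
    have : Continuous fun p : Disorder Λ × (Λ → S2) => M p.1 (p.2 y : R3) :=
      cont_pathAverage _ _ _ continuous_fst (cont_spin continuous_snd y)
    unfold Function.uncurry
    fun_prop
  have hHcont : Continuous fun ω : Disorder Λ => ‖M' ω ez - ez‖ ^ 2 := by
    have : Continuous fun ω : Disorder Λ => M' ω ez :=
      cont_pathAverage _ _ _ continuous_id continuous_const
    fun_prop
  -- Covariance of `M` makes `‖M (S y) - S x‖` gauge invariant, although neither vector is.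
  have hnish := nishimori_identity β hGcont (by
    intro θ ω S
    have : M (gauge θ ω) (rotSpins θ S y : R3) = rot (θ x) (M ω (S y : R3)) := by
      simp only [hM, pathAverage, hcov, rotSpins, coe_rotS, rot_mul, rot_inv_rot, rot_smul]
      congr 1
      exact (map_sum (rotIso (θ x)) (fun γ => rot (transport ω ((List.range L).map (s γ)))
        (S y : R3)) Finset.univ).symm
    have hx : (rotSpins θ S x : R3) = rot (θ x) (S x : R3) := coe_rotS _ _
    simp only [this, hx, ← rot_sub, norm_rot])
  have hpt : ∀ (ω : Disorder Λ) (S : Λ → S2), ((S x : R3) 2 - (S y : R3) 2) ^ 2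
      ≤ 2 * ‖M ω (S y : R3) - (S x : R3)‖ ^ 2 + 2 * ‖M' ω ez - ez‖ ^ 2 := by
    intro ω S
    -- The `z` component is not gauge invariant, so Nishimori's identity cannot treat the difference
    -- directly. Passing `M` to the other side as `M'` splits it into an error that depends on the
    -- disorder only and a gauge invariant one.
    have e : (S x : R3) 2 - (S y : R3) 2
        = inner ℝ (M' ω ez - ez) (S y : R3) - inner ℝ ez (M ω (S y : R3) - (S x : R3)) := by
      rw [inner_sub_left, inner_sub_right, hM, inner_pathAverage_rev, inner_ez, inner_ez]
      ring
    have b1 : |inner ℝ (M' ω ez - ez) (S y : R3)| ≤ ‖M' ω ez - ez‖ := by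
      have := abs_real_inner_le_norm (M' ω ez - ez) (S y : R3)
      rwa [norm_eq_of_mem_sphere, mul_one] at this
    have b2 : |inner ℝ ez (M ω (S y : R3) - (S x : R3))| ≤ ‖M ω (S y : R3) - (S x : R3)‖ := by
      have := abs_real_inner_le_norm ez (M ω (S y : R3) - (S x : R3))
      rwa [norm_ez, one_mul] at this
    rw [e]
    have c1 := sq_le_sq' (abs_le.1 b1).1 (abs_le.1 b1).2
    have c2 := sq_le_sq' (abs_le.1 b2).1 (abs_le.1 b2).2
    nlinarith [sq_nonneg (inner ℝ (M' ω ez - ez) (S y : R3)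
      + inner ℝ ez (M ω (S y : R3) - (S x : R3)))]
  calc sqDiff β x y
      ≤ ∫ ω, ∫ S, (2 * ‖M ω (S y : R3) - (S x : R3)‖ ^ 2 + 2 * ‖M' ω ez - ez‖ ^ 2) ∂(gibbs β ω)
        ∂(disorderLaw β Λ) := by
        refine integral_gibbs_mono β ?_ ?_ hpt
        · unfold Function.uncurry; fun_prop
        · exact (hGcont.const_mul 2).add ((hHcont.comp continuous_fst).const_mul 2)
    _ = 2 * ∫ ω, ∫ S, ‖M ω (S y : R3) - (S x : R3)‖ ^ 2 ∂(gibbs β ω) ∂(disorderLaw β Λ)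
        + 2 * ∫ ω, ‖M' ω ez - ez‖ ^ 2 ∂(disorderLaw β Λ) := by
        rw [integral_gibbs_add (F := fun ω S => 2 * ‖M ω (S y : R3) - (S x : R3)‖ ^ 2)
          (G := fun ω _ => 2 * ‖M' ω ez - ez‖ ^ 2) β (hGcont.const_mul 2)
          ((hHcont.comp continuous_fst).const_mul 2), integral_gibbs_const_mul]
        simp only [integral_const, probReal_univ, one_smul, integral_const_mul]
    _ ≤ 4 * (B - 1) := by
        rw [hnish]
        simp only [north, coe_ezS]
        linarith

/-! ### Steps between neighbouring sites -/

/-- The edge between two neighbouring sites of `Λ`, with the direction in which it is crossed. -/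
def stepOf (e₀ : PosEdge Λ) (u v : Λ) : PosEdge Λ × Bool :=
  if h : IsPosEdge u v then (⟨(u, v), h⟩, true)
  else if h : IsPosEdge v u then (⟨(v, u), h⟩, false)
  else (e₀, true)

lemma stepRot_stepOf (e₀ : PosEdge Λ) {u v : Λ} (h : IsPosEdge u v ∨ IsPosEdge v u)
    (ω : Disorder Λ) : stepRot ω (stepOf e₀ u v) = ω.rotation u v := by
  rcases h with h | h
  · simp [stepOf, h, rotation_pos ω h, stepRot]
  · simp [stepOf, h, h.asymm, rotation_neg ω h, stepRot]

lemma stepOf_ends (e₀ : PosEdge Λ) {u v : Λ} (h : IsPosEdge u v ∨ IsPosEdge v u) :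
    (stepOf e₀ u v).1.1 = (u, v) ∨ (stepOf e₀ u v).1.1 = (v, u) := by
  rcases h with h | h
  · simp [stepOf, h]
  · simp [stepOf, h, h.asymm]

lemma isPosEdge_of_add_single {u v : Λ} {k : Fin 3} {σ : ℤ} (hσ : σ = 1 ∨ σ = -1)
    (h : (v : Site) = (u : Site) + Pi.single k σ) : IsPosEdge u v ∨ IsPosEdge v u := by
  rcases hσ with rfl | rfl
  · exact Or.inl ⟨k, h⟩
  · refine Or.inr ⟨k, ?_⟩
    rw [h, add_assoc, ← Pi.single_add]; simp

lemma transport_gauge_of_adj (e₀ : PosEdge Λ) (pos : ℕ → Λ) (L : ℕ)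
    (hadj : ∀ i < L, IsPosEdge (pos i) (pos (i + 1)) ∨ IsPosEdge (pos (i + 1)) (pos i))
    (θ : Λ → SO3) (ω : Disorder Λ) :
    transport (gauge θ ω) ((List.range L).map fun i => stepOf e₀ (pos i) (pos (i + 1)))
      = θ (pos 0) * transport ω ((List.range L).map fun i => stepOf e₀ (pos i) (pos (i + 1)))
        * (θ (pos L))⁻¹ := by
  induction L with
  | zero => simp [transport_nil]
  | succ L ih =>
    have happ : ∀ (ω : Disorder Λ) (l : List (PosEdge Λ × Bool)) (t), transport ω (l ++ [t])
        = transport ω l * stepRot ω t := by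
      intro ω l t; simp [transport]
    rw [List.range_succ, List.map_append, List.map_singleton, happ, happ,
      ih fun i hi => hadj i (by omega), stepRot_stepOf _ (hadj L (by omega)),
      stepRot_stepOf _ (hadj L (by omega)), rotation_gauge _ _ (hadj L (by omega))]
    group

/-- Monotone paths, along each of which an additive functional increases by one in each step,
form a path family. -/
lemma pathFamily_of_height (e₀ : PosEdge Λ) {Γ : Type*} (pos : Γ → ℕ → Λ) (L : ℕ)
    (hadj : ∀ γ, ∀ i < L, IsPosEdge (pos γ i) (pos γ (i + 1)) ∨ IsPosEdge (pos γ (i + 1)) (pos γ i))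
    (φ : Site → ℤ) (h₀ : ℤ) (hφ : ∀ γ, ∀ i ≤ L, φ (pos γ i) = h₀ + i) :
    PathFamily L (fun γ i => stepOf e₀ (pos γ i) (pos γ (i + 1))) ∧
    ∀ γ γ', ∀ i < L, stepOf e₀ (pos γ i) (pos γ (i + 1)) = stepOf e₀ (pos γ' i) (pos γ' (i + 1)) →
      pos γ i = pos γ' i ∧ pos γ (i + 1) = pos γ' (i + 1) := by
  -- The heights of the two ends of an edge determine the time at which it is crossed, so no edge is
  -- crossed at two different times; the direction is that of increasing height.
  have hsum : ∀ γ, ∀ i < L, φ (stepOf e₀ (pos γ i) (pos γ (i + 1))).1.1.1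
      + φ (stepOf e₀ (pos γ i) (pos γ (i + 1))).1.1.2 = 2 * h₀ + 2 * i + 1 := by
    intro γ i hi
    have h1 := hφ γ i hi.le
    have h2 := hφ γ (i + 1) hi
    push_cast at h2
    rcases stepOf_ends e₀ (hadj γ i hi) with h | h <;> rw [h] <;> simp only [h1, h2] <;> ring
  have hends : ∀ γ γ', ∀ i < L, (stepOf e₀ (pos γ i) (pos γ (i + 1))).1
      = (stepOf e₀ (pos γ' i) (pos γ' (i + 1))).1 →
      pos γ i = pos γ' i ∧ pos γ (i + 1) = pos γ' (i + 1) := by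
    intro γ γ' i hi he
    have h1 := hφ γ i hi.le
    have h2 := hφ γ (i + 1) hi
    have h3 := hφ γ' i hi.le
    have h4 := hφ γ' (i + 1) hi
    push_cast at h2 h4
    have he' := congrArg Subtype.val he
    rcases stepOf_ends e₀ (hadj γ i hi) with h | h <;>
      rcases stepOf_ends e₀ (hadj γ' i hi) with h' | h' <;> rw [h, h', Prod.mk.injEq] at he'
    · exact he'
    · rw [he'.1] at h1; omega
    · rw [he'.1] at h2; omega
    · exact ⟨he'.2, he'.1⟩
  refine ⟨⟨fun γ γ' i j hij hj he => ?_, fun γ γ' i hi he => ?_⟩, fun γ γ' i hi he => ?_⟩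
  · have h1 := hsum γ i (by omega)
    have h2 := hsum γ' j hj
    change (stepOf e₀ (pos γ i) (pos γ (i + 1))).1 = (stepOf e₀ (pos γ' j) (pos γ' (j + 1))).1 at he
    rw [he] at h1
    omega
  · obtain ⟨h1, h2⟩ := hends γ γ' i hi he
    simp only [h1, h2]
  · exact hends γ γ' i hi (congrArg Prod.fst he)

/-- Bernoulli's inequality, then `1 / (1 - 8 ε) ≤ 1 + 16 ε` for `ε ≤ 1 / 16`. The power `8` is `2 *
4`: a factor `c⁻²` for each common step, and up to four common steps for each meeting of the walks.
-/
lemma inv_pow_sub_one_le {c : ℝ} (hc : 1 - c ≤ 1 / 16) (hc1 : c ≤ 1) :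
    c⁻¹ ^ 8 - 1 ≤ 16 * (1 - c) := by
  have hb : 1 - 8 * (1 - c) ≤ c ^ 8 := by
    have := one_add_mul_le_pow (a := c - 1) (by linarith) 8
    norm_num at this
    linarith
  have hpos : 0 < c ^ 8 := by have : 0 < c := by linarith
                              positivity
  rw [inv_pow, sub_le_iff_le_add, inv_le_comm₀ hpos (by linarith)]
  refine le_trans ?_ hb
  rw [inv_le_iff_one_le_mul₀ (by linarith)]
  nlinarith

/-- The family is the single edge. The value `B = c⁻¹ ^ 8` is generous, and is taken to reuse
`inv_pow_sub_one_le`. -/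
lemma sqDiff_neighbour_le (β : ℝ) (hc : 1 - meanCos β ≤ 1 / 41472) {x y : Λ}
    (h : IsPosEdge x y ∨ IsPosEdge y x) : sqDiff β x y ≤ 400000 * (1 - meanCos β) := by
  have hc1 := meanCos_le_one β
  have hc0 : 0 < meanCos β := by linarith
  have hd : 1 / 3 ≤ meanSqCos β := by nlinarith [sq_meanCos_le β]
  obtain ⟨e₀⟩ : Nonempty (PosEdge Λ) := by
    rcases h with h | h
    · exact ⟨⟨(x, y), h⟩⟩
    · exact ⟨⟨(y, x), h⟩⟩
  have hinv : 1 ≤ (meanCos β)⁻¹ := (one_le_inv₀ hc0).2 hc1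
  have := sqDiff_le_of_pathFamily β (Γ := Unit) (L := 1) (s := fun _ _ => stepOf e₀ x y)
    ⟨fun _ _ i j hij hj => by omega, fun _ _ _ _ _ => rfl⟩ (x := x) (y := y)
    (fun _ θ ω => by
      simp [transport, stepRot_stepOf e₀ h, rotation_gauge θ ω h])
    hc0 hd (B := (meanCos β)⁻¹ ^ 8) (fun _ => by
      simp only [common, Finset.univ_unique, Finset.sum_const, Finset.card_singleton, one_smul,
        Fintype.card_unit, Nat.cast_one, one_mul, Finset.filter_true, Finset.card_range, pow_one]
      exact pow_le_pow_right₀ hinv (by norm_num))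
  have h2 := inv_pow_sub_one_le (by linarith) hc1
  linarith

end SpinDifferences

/-! ### Random directed lattice paths -/

/-- A walk up to time `n`, slowed down by a factor two, followed by its mirrored complement. -/
def mirrored (n r : ℕ) (S : ℕ → ℤ) (i : ℕ) : ℤ :=
  if i ≤ 2 * n then S ((i + r) / 2)
  else n - ((4 * n - i + r) / 2 : ℕ) + S ((4 * n - i + r) / 2)

/-- A walk on the integers that starts at `0` and has steps `0` and `1`. -/
structure IsLazyWalk (S : ℕ → ℤ) : Prop where
  zero : S 0 = 0
  succ : ∀ h, S (h + 1) = S h ∨ S (h + 1) = S h + 1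

lemma isLazyWalk_walk {m : ℕ} (ζ : Noise m) : IsLazyWalk (walk ζ) := ⟨walk_zero ζ, walk_succ ζ⟩

namespace IsLazyWalk

variable {S T : ℕ → ℤ}

lemma nonneg (hS : IsLazyWalk S) (h : ℕ) : 0 ≤ S h := by
  induction h with
  | zero => exact hS.zero.ge
  | succ h ih => rcases hS.succ h with h | h <;> omega

lemma le (hS : IsLazyWalk S) (h : ℕ) : S h ≤ h := by
  induction h with
  | zero => exact hS.zero.le
  | succ h ih => rcases hS.succ h with h | h <;> push_cast <;> omega

lemma mirrored_zero (hS : IsLazyWalk S) (n : ℕ) {r : ℕ} (hr : r ≤ 1) : mirrored n r S 0 = 0 := by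
  simp [mirrored, show r / 2 = 0 by omega, hS.zero]

lemma mirrored_last (hS : IsLazyWalk S) {n : ℕ} (hn : 0 < n) {r : ℕ} (hr : r ≤ 1) :
    mirrored n r S (4 * n) = n := by
  simp [mirrored, show ¬ 4 * n ≤ 2 * n by omega, show r / 2 = 0 by omega, hS.zero]

lemma mirrored_bounds (hS : IsLazyWalk S) (hT : IsLazyWalk T) (n i : ℕ) (hi : i ≤ 4 * n) :
    (0 ≤ mirrored n 1 S i ∧ mirrored n 1 S i ≤ n) ∧ (0 ≤ mirrored n 0 T i ∧ mirrored n 0 T i ≤ n) ∧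
      0 ≤ i - mirrored n 1 S i - mirrored n 0 T i ∧
      i - mirrored n 1 S i - mirrored n 0 T i ≤ 2 * n := by
  unfold mirrored
  split_ifs with h
  · have h1 := hS.nonneg ((i + 1) / 2)
    have h2 := hS.le ((i + 1) / 2)
    have h3 := hT.nonneg ((i + 0) / 2)
    have h4 := hT.le ((i + 0) / 2)
    omega
  · have h1 := hS.nonneg ((4 * n - i + 1) / 2)
    have h2 := hS.le ((4 * n - i + 1) / 2)
    have h3 := hT.nonneg ((4 * n - i + 0) / 2)
    have h4 := hT.le ((4 * n - i + 0) / 2)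
    omega

/-- The parity shift `r` lets the two walks move at alternating times, so they never move together;
when neither moves, the remaining coordinate takes the step. -/
lemma mirrored_step (hS : IsLazyWalk S) (hT : IsLazyWalk T) {n i : ℕ} (hi : i < 4 * n) :
    (mirrored n 1 S (i + 1) = mirrored n 1 S i ∧ mirrored n 0 T (i + 1) = mirrored n 0 T i) ∨
    (mirrored n 1 S (i + 1) = mirrored n 1 S i + 1 ∧ mirrored n 0 T (i + 1) = mirrored n 0 T i) ∨
    (mirrored n 1 S (i + 1) = mirrored n 1 S i ∧ mirrored n 0 T (i + 1) = mirrored n 0 T i + 1) := by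
  rcases lt_or_ge i (2 * n) with h | h
  · unfold mirrored
    simp only [show i ≤ 2 * n by omega, show i + 1 ≤ 2 * n by omega, if_true, add_zero]
    rcases Nat.even_or_odd' i with ⟨k, rfl | rfl⟩
    · rw [show (2 * k + 1 + 1) / 2 = k + 1 by omega, show (2 * k + 1) / 2 = k by omega,
        show 2 * k / 2 = k by omega]
      rcases hS.succ k with h | h <;> simp [h]
    · rw [show (2 * k + 1 + 1 + 1) / 2 = k + 1 by omega, show (2 * k + 1 + 1) / 2 = k + 1 by omega,
        show (2 * k + 1) / 2 = k by omega]
      rcases hT.succ k with h | h <;> simp [h]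
  · obtain ⟨j, rfl⟩ : ∃ j, i = 4 * n - (j + 1) := ⟨4 * n - 1 - i, by omega⟩
    -- Counted backwards from the end, the second half has a single formula; it also covers the
    -- middle time `l = 2 * n`, where both branches agree.
    have e : ∀ r, r ≤ 1 → ∀ S : ℕ → ℤ, ∀ l ≤ 2 * n,
        mirrored n r S (4 * n - l) = n - ((l + r) / 2 : ℕ) + S ((l + r) / 2) := by
      intro r hr S l hl
      unfold mirrored
      split_ifs with h
      · have : l = 2 * n := by omega
        subst this
        rw [show 4 * n - 2 * n = 2 * n by omega, show (2 * n + r) / 2 = n by omega]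
        ring
      · rw [show 4 * n - (4 * n - l) = l by omega]
    rw [show 4 * n - (j + 1) + 1 = 4 * n - j by omega, e 1 le_rfl S j (by omega),
      e 1 le_rfl S (j + 1) (by omega), e 0 zero_le_one T j (by omega),
      e 0 zero_le_one T (j + 1) (by omega)]
    rcases Nat.even_or_odd' j with ⟨k, rfl | rfl⟩
    · rw [show (2 * k + 1 + 1) / 2 = k + 1 by omega, show (2 * k + 1) / 2 = k by omega,
        show (2 * k + 0) / 2 = k by omega]
      rcases hS.succ k with h | h <;> rw [h] <;> push_cast <;> omega
    · rw [show (2 * k + 1 + 1 + 1) / 2 = k + 1 by omega, show (2 * k + 1 + 1) / 2 = k + 1 by omega,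
        show (2 * k + 1 + 0) / 2 = k by omega]
      rcases hT.succ k with h | h <;> rw [h] <;> push_cast <;> omega

end IsLazyWalk

/-- A common step fixes the positions at both of its ends. As the two coordinates are sampled at
alternating times, one end shows `S` and the other shows `T` at the same walk time `h`; each `h`
arises from at most four steps, two in each half. -/
lemma mirrored_meet {S T S' T' : ℕ → ℤ} {n i : ℕ} (hi : i < 4 * n)
    (h1 : mirrored n 1 S i = mirrored n 1 S' i) (h2 : mirrored n 0 T i = mirrored n 0 T' i)
    (h3 : mirrored n 1 S (i + 1) = mirrored n 1 S' (i + 1))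
    (h4 : mirrored n 0 T (i + 1) = mirrored n 0 T' (i + 1)) :
    ∃ h ≤ n, (S h = S' h ∧ T h = T' h) ∧
      (i = 2 * h - 1 ∨ i = 2 * h ∨ i = 4 * n - 2 * h ∨ i = 4 * n - 2 * h - 1) := by
  rcases lt_or_ge i (2 * n) with h | h
  · refine ⟨(i + 1) / 2, by omega, ?_, by omega⟩
    simp only [mirrored, show i ≤ 2 * n by omega, show i + 1 ≤ 2 * n by omega, if_true] at h1 h4
    exact ⟨h1, h4⟩
  · refine ⟨(4 * n - i) / 2, by omega, ?_, by omega⟩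
    have h5 : S ((4 * n - i) / 2) = S' ((4 * n - i) / 2) := by
      simp only [mirrored, show ¬ i + 1 ≤ 2 * n by omega, if_false] at h3
      rw [show 4 * n - (i + 1) + 1 = 4 * n - i by omega] at h3
      omega
    refine ⟨h5, ?_⟩
    unfold mirrored at h2
    split_ifs at h2 with h6
    · rwa [show (i + 0) / 2 = (4 * n - i) / 2 by omega] at h2
    · rw [add_zero] at h2
      omega

lemma meetWeight_eq_pow {m : ℕ} (K : ℝ) (z w : ℕ → ℤ) (n : ℕ) (γ : Noise m × Noise m) :
    meetWeight K z w n γ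
      = K ^ ((Finset.range n).filter fun h => walk γ.1 (h + 1) = z (h + 1) ∧
          walk γ.2 (h + 1) = w (h + 1)).card := by
  unfold meetWeight
  rw [← Finset.prod_const, Finset.prod_filter]
  refine Finset.prod_congr rfl fun h _ => ?_
  unfold meets
  split_ifs <;> ring

section Diagonal

variable {Λ : Finset Site} {a b c : Fin 3} {s t u : ℤ} {n : ℕ} {x y : Λ}

/-- The sites reached from `x` by steps in three given directions. -/
def siteAt (x : Site) (a b c : Fin 3) (s t u α β γ : ℤ) : Site :=
  x + Pi.single a (s * α) + Pi.single b (t * β) + Pi.single c (u * γ)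

lemma siteAt_apply_a (x : Site) (hab : a ≠ b) (hac : a ≠ c) (α β γ : ℤ) :
    siteAt x a b c s t u α β γ a = x a + s * α := by
  simp [siteAt, hab, hac]

lemma siteAt_apply_b (x : Site) (hab : a ≠ b) (hbc : b ≠ c) (α β γ : ℤ) :
    siteAt x a b c s t u α β γ b = x b + t * β := by
  simp [siteAt, hab.symm, hbc]

lemma siteAt_apply_c (x : Site) (hac : a ≠ c) (hbc : b ≠ c) (α β γ : ℤ) :
    siteAt x a b c s t u α β γ c = x c + u * γ := by
  simp [siteAt, hac.symm, hbc.symm]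

lemma eq_of_sign_mul {s i j v : ℤ} (hs : s = 1 ∨ s = -1) (h : v + s * i = v + s * j) : i = j := by
  rcases hs with rfl | rfl <;> omega

/-- The spins at two sites that differ by a multiple of `(±2, ±1, ±1)` are close. -/
lemma sqDiff_diagonal_le (β : ℝ) (hc : 1 - meanCos β ≤ 1 / 41472) (hab : a ≠ b) (hac : a ≠ c)
    (hbc : b ≠ c) (hs : s = 1 ∨ s = -1) (ht : t = 1 ∨ t = -1) (hu : u = 1 ∨ u = -1)
    (hn : 0 < n) (hy : (y : Site) = siteAt x a b c s t u (2 * n) n n)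
    (hΛ : ∀ i j k : ℤ, 0 ≤ i → i ≤ 2 * n → 0 ≤ j → j ≤ n → 0 ≤ k → k ≤ n →
      siteAt x a b c s t u i j k ∈ Λ) :
    sqDiff β x y ≤ 400000 * (1 - meanCos β) := by
  set κ := meanCos β with hκ
  have hc1 : κ ≤ 1 := meanCos_le_one β
  have hc0 : 0 < κ := by linarith
  have hd : 1 / 3 ≤ meanSqCos β := by nlinarith [sq_meanCos_le β]
  have hinv : 1 ≤ κ⁻¹ := (one_le_inv₀ hc0).2 hc1
  have hK1 : 1 ≤ κ⁻¹ ^ 8 := one_le_pow₀ hinv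
  have hK := inv_pow_sub_one_le (c := κ) (by linarith) hc1
  obtain ⟨m, hm⟩ : ∃ m, n ≤ 2 ^ m := ⟨n, Nat.lt_two_pow_self.le⟩
  let q2 : Noise m × Noise m → ℕ → ℤ := fun γ i => mirrored n 1 (walk γ.1) i
  let q3 : Noise m × Noise m → ℕ → ℤ := fun γ i => mirrored n 0 (walk γ.2) i
  let site : Noise m × Noise m → ℕ → Site := fun γ i =>
    siteAt x a b c s t u (i - q2 γ i - q3 γ i) (q2 γ i) (q3 γ i)
  have hmem : ∀ γ, ∀ i ≤ 4 * n, site γ i ∈ Λ := by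
    intro γ i hi
    obtain ⟨h1, h2, h3⟩ := (isLazyWalk_walk γ.1).mirrored_bounds (isLazyWalk_walk γ.2) n i hi
    exact hΛ _ _ _ h3.1 h3.2 h1.1 h1.2 h2.1 h2.2
  let pos : Noise m × Noise m → ℕ → Λ := fun γ i =>
    ⟨site γ (min i (4 * n)), hmem γ _ (min_le_right _ _)⟩
  have hpos : ∀ γ, ∀ i ≤ 4 * n, (pos γ i : Site) = site γ i := fun γ i hi => by
    simp only [pos, min_eq_left hi]
  have hadj : ∀ γ, ∀ i < 4 * n,
      IsPosEdge (pos γ i) (pos γ (i + 1)) ∨ IsPosEdge (pos γ (i + 1)) (pos γ i) := by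
    intro γ i hi
    have hstep := (isLazyWalk_walk γ.1).mirrored_step (isLazyWalk_walk γ.2) hi
    rcases hstep with ⟨h1, h2⟩ | ⟨h1, h2⟩ | ⟨h1, h2⟩
    · refine isPosEdge_of_add_single (k := a) hs ?_
      rw [hpos γ i hi.le, hpos γ (i + 1) hi]
      simp only [site, siteAt, q2, q3, h1, h2]
      rw [show s * (((i + 1 : ℕ) : ℤ) - mirrored n 1 (walk γ.1) i - mirrored n 0 (walk γ.2) i)
        = s * ((i : ℤ) - mirrored n 1 (walk γ.1) i - mirrored n 0 (walk γ.2) i) + s by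
          push_cast; ring, Pi.single_add]
      abel
    · refine isPosEdge_of_add_single (k := b) ht ?_
      rw [hpos γ i hi.le, hpos γ (i + 1) hi]
      simp only [site, siteAt, q2, q3, h1, h2]
      rw [mul_add, mul_one, Pi.single_add, show ((i + 1 : ℕ) : ℤ) - (mirrored n 1 (walk γ.1) i + 1)
        - mirrored n 0 (walk γ.2) i
        = (i : ℤ) - mirrored n 1 (walk γ.1) i - mirrored n 0 (walk γ.2) i by push_cast; ring]
      abel
    · refine isPosEdge_of_add_single (k := c) hu ?_
      rw [hpos γ i hi.le, hpos γ (i + 1) hi]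
      simp only [site, siteAt, q2, q3, h1, h2]
      rw [mul_add, mul_one, Pi.single_add, show ((i + 1 : ℕ) : ℤ) - mirrored n 1 (walk γ.1) i
        - (mirrored n 0 (walk γ.2) i + 1)
        = (i : ℤ) - mirrored n 1 (walk γ.1) i - mirrored n 0 (walk γ.2) i by push_cast; ring]
      abel
  have hstart : ∀ γ, pos γ 0 = x := by
    intro γ
    refine Subtype.ext ?_
    rw [hpos γ 0 (Nat.zero_le _)]
    simp [site, siteAt, q2, q3, (isLazyWalk_walk γ.1).mirrored_zero,
      (isLazyWalk_walk γ.2).mirrored_zero]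
  have hend : ∀ γ, pos γ (4 * n) = y := by
    intro γ
    refine Subtype.ext ?_
    rw [hpos γ _ le_rfl, hy]
    simp only [site, q2, q3, (isLazyWalk_walk γ.1).mirrored_last hn le_rfl,
      (isLazyWalk_walk γ.2).mirrored_last hn zero_le_one]
    congr 1
    push_cast; ring
  obtain ⟨e₀⟩ : Nonempty (PosEdge Λ) := by
    rcases hadj (fun _ => 0, fun _ => 0) 0 (by omega) with h | h
    exacts [⟨⟨(_, _), h⟩⟩, ⟨⟨(_, _), h⟩⟩]
  have hs2 : s * s = 1 := by rcases hs with rfl | rfl <;> rfl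
  have ht2 : t * t = 1 := by rcases ht with rfl | rfl <;> rfl
  have hu2 : u * u = 1 := by rcases hu with rfl | rfl <;> rfl
  -- The signed sum of the coordinates increases by one in each step.
  obtain ⟨hfam, hsame⟩ := pathFamily_of_height e₀ pos (4 * n) hadj
    (fun z => s * z a + t * z b + u * z c) (s * x.1 a + t * x.1 b + u * x.1 c) (by
      intro γ i hi
      simp only [hpos γ i hi, site, siteAt_apply_a _ hab hac, siteAt_apply_b _ hab hbc,
        siteAt_apply_c _ hac hbc]
      linear_combination (i - q2 γ i - q3 γ i) * hs2 + q2 γ i * ht2 + q3 γ i * hu2)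
  -- Every common step belongs to a meeting time of the walks, at most four to each. The extra `1`
  -- is time `0`, where all walks meet and which `meetWeight` does not count.
  have hmeet : ∀ γ γ', common (4 * n) (fun γ i => stepOf e₀ (pos γ i) (pos γ (i + 1))) γ γ'
      ≤ 4 * (1 + ((Finset.range n).filter fun h => walk γ'.1 (h + 1) = walk γ.1 (h + 1) ∧
          walk γ'.2 (h + 1) = walk γ.2 (h + 1)).card) := by
    intro γ γ'
    set G := insert 0 (((Finset.range n).filter fun h => walk γ'.1 (h + 1) = walk γ.1 (h + 1) ∧
          walk γ'.2 (h + 1) = walk γ.2 (h + 1)).image Nat.succ) with hG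
    have hGcard : G.card ≤ 1 + ((Finset.range n).filter fun h =>
        walk γ'.1 (h + 1) = walk γ.1 (h + 1) ∧ walk γ'.2 (h + 1) = walk γ.2 (h + 1)).card := by
      rw [add_comm]
      exact (Finset.card_insert_le _ _).trans (Nat.add_le_add_right Finset.card_image_le 1)
    refine le_trans ?_ (Nat.mul_le_mul_left 4 hGcard)
    refine le_trans (Finset.card_le_card (t := G.biUnion fun h =>
      ({2 * h - 1, 2 * h, 4 * n - 2 * h, 4 * n - 2 * h - 1} : Finset ℕ)) ?_)
      ((Finset.card_biUnion_le_card_mul _ _ 4 fun h _ => Finset.card_le_four).trans_eq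
        (mul_comm _ _))
    intro i hi
    simp only [Finset.mem_filter] at hi
    obtain ⟨hi, he⟩ := hi
    have hi := Finset.mem_range.1 hi
    obtain ⟨h1, h2⟩ := hsame γ γ' i hi he
    have h1 := congrArg Subtype.val h1
    have h2 := congrArg Subtype.val h2
    rw [hpos γ i hi.le, hpos γ' i hi.le] at h1
    rw [hpos γ (i + 1) hi, hpos γ' (i + 1) hi] at h2
    have hb : ∀ j, site γ j = site γ' j → q2 γ j = q2 γ' j := fun j hj => by
      have := congrFun hj b
      simp only [site, siteAt_apply_b _ hab hbc] at this
      exact eq_of_sign_mul ht this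
    have hc : ∀ j, site γ j = site γ' j → q3 γ j = q3 γ' j := fun j hj => by
      have := congrFun hj c
      simp only [site, siteAt_apply_c _ hac hbc] at this
      exact eq_of_sign_mul hu this
    obtain ⟨h, hn', ⟨hm1, hm2⟩, hcase⟩ :=
      mirrored_meet hi (hb _ h1) (hc _ h1) (hb _ h2) (hc _ h2)
    refine Finset.mem_biUnion.2 ⟨h, ?_, by simpa using hcase⟩
    rcases Nat.eq_zero_or_pos h with rfl | hpos'
    · exact Finset.mem_insert_self _ _
    · refine Finset.mem_insert_of_mem (Finset.mem_image.2 ⟨h - 1, Finset.mem_filter.2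
        ⟨Finset.mem_range.2 (by omega), ?_⟩, by omega⟩)
      rw [Nat.sub_add_cancel hpos']
      exact ⟨hm1.symm, hm2.symm⟩
  have hmain := sqDiff_le_of_pathFamily β hfam (x := x) (y := y) (fun γ θ ω => by
    rw [transport_gauge_of_adj e₀ (pos γ) (4 * n) (hadj γ) θ ω, hstart, hend]) hc0 hd
    (B := κ⁻¹ ^ 8 * (1 + 2592 * (κ⁻¹ ^ 8 - 1))) (fun γ => by
      have hsum := sum_meetWeight_le (m := m) hK1 (by linarith) (walk γ.1) (walk γ.2) hm
      calc _ ≤ ∑ γ' : Noise m × Noise m, κ⁻¹ ^ 8 * meetWeight (κ⁻¹ ^ 8) (walk γ.1) (walk γ.2) n γ' := by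
            refine Finset.sum_le_sum fun γ' _ => ?_
            refine (pow_le_pow_right₀ (one_le_pow₀ hinv) (hmeet γ γ')).trans (le_of_eq ?_)
            rw [meetWeight_eq_pow, ← pow_mul, ← pow_mul]
            ring
        _ ≤ _ := by
            rw [← Finset.mul_sum]
            calc _ ≤ κ⁻¹ ^ 8 * _ := mul_le_mul_of_nonneg_left hsum (by positivity)
              _ = _ := by ring)
  -- The assumption on `meanCos β` is `16 * 2592 * (1 - κ) ≤ 1`, hence `2592 * k ≤ 1`; then `B - 1 =
  -- 2593 k + 2592 k²` is at most `2594 k`, and `k ≤ 16 (1 - κ)`.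
  set k := κ⁻¹ ^ 8 - 1 with hk
  have hk1 : κ⁻¹ ^ 8 = k + 1 := by rw [hk]; ring
  rw [hk1] at hmain
  have hk0 : 0 ≤ k := by linarith
  have : 2592 * k ≤ 1 := by linarith
  nlinarith

lemma sqDiff_self (β : ℝ) (x : Λ) : sqDiff β x x = 0 := by simp [sqDiff]

/-- The spins at two sites on a line parallel to a coordinate axis are close. -/
lemma sqDiff_straight_le (β : ℝ) (hc : 1 - meanCos β ≤ 1 / 41472) (a : Fin 3)
    (hs : s = 1 ∨ s = -1) (m : ℕ) (hy : (y : Site) = (x : Site) + Pi.single a (s * m))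
    (hΛ : ∀ z : Site, (∃ i : ℤ, 0 ≤ i ∧ i ≤ m ∧ z a = x.1 a + s * i) →
      (∀ k, k ≠ a → 4 * |z k - x.1 k| ≤ m) → z ∈ Λ) :
    sqDiff β x y ≤ 46 * (400000 * (1 - meanCos β)) := by
  have hD := meanCos_le_one β
  set D := 400000 * (1 - meanCos β) with hDdef
  have hD0 : 0 ≤ D := by linarith
  obtain ⟨b, c, hab, hac, hbc⟩ : ∃ b c, a ≠ b ∧ a ≠ c ∧ b ≠ c := by clear hy hΛ; revert a; decide
  have habc : ∀ k, k ≠ a → k = b ∨ k = c := by clear hy hΛ; revert a b c; decide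
  have hmem : ∀ (z : Site) (i j k : ℤ), z = siteAt x a b c s 1 1 i j k → 0 ≤ i → i ≤ m →
      4 * |j| ≤ m → 4 * |k| ≤ m → z ∈ Λ := by
    rintro z i j k rfl h1 h2 h3 h4
    refine hΛ _ ⟨i, h1, h2, siteAt_apply_a _ hab hac _ _ _⟩ fun l hl => ?_
    rcases habc l hl with rfl | rfl
    · simpa [siteAt_apply_b _ hab hbc] using h3
    · simpa [siteAt_apply_c _ hac hbc] using h4
  set n := m / 4 with hn
  have h4n : 4 * n ≤ m := by omega
  -- Two diagonal legs with opposite sideways components, `(2n, n, n)` and `(2n, -n, -n)`, add up to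
  -- a straight one.
  have hbase : ∀ v : Λ, (v : Site) = (x : Site) + Pi.single a (s * (4 * n)) →
      sqDiff β x v ≤ 4 * D := by
    intro v hv
    rcases Nat.eq_zero_or_pos n with h0 | h0
    · have : v = x := Subtype.ext (by rw [hv]; simp [h0])
      rw [this, sqDiff_self]; linarith
    · let w : Λ := ⟨siteAt x a b c s 1 1 (2 * n) n n, hmem _ _ _ _ rfl (by omega) (by omega)
        (by rw [abs_of_nonneg] <;> omega) (by rw [abs_of_nonneg] <;> omega)⟩
      have h1 : sqDiff β x w ≤ D := by
        refine sqDiff_diagonal_le β hc hab hac hbc hs (Or.inl rfl) (Or.inl rfl) h0 rfl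
          fun i j k hi hi' hj hj' hk hk' => hmem _ i j k rfl hi (by omega) ?_ ?_
        · rw [abs_of_nonneg hj]; omega
        · rw [abs_of_nonneg hk]; omega
      have h2 : sqDiff β w v ≤ D := by
        refine sqDiff_diagonal_le β hc hab hac hbc hs (Or.inr rfl) (Or.inr rfl) h0 ?_
          fun i j k hi hi' hj hj' hk hk' => hmem _ (2 * n + i) (n - j) (n - k) ?_ (by omega)
            (by omega) ?_ ?_
        · rw [hv]
          funext l
          simp only [w, siteAt, Pi.add_apply, Pi.single_apply]
          split_ifs <;> ring
        · funext l
          simp only [w, siteAt, Pi.add_apply, Pi.single_apply]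
          split_ifs <;> ring
        · rw [abs_of_nonneg] <;> omega
        · rw [abs_of_nonneg] <;> omega
      have := sqDiff_triangle β x w v
      linarith
  -- The remainder modulo `4` is covered edge by edge. The constants satisfy `a₀ = 4` and `aᵣ₊₁ = 2
  -- aᵣ + 2`, and `a₃ = 46`.
  have hstep : ∀ r : ℕ, 4 * n + r ≤ m → ∀ v : Λ,
      (v : Site) = (x : Site) + Pi.single a (s * (4 * n + r)) →
      sqDiff β x v ≤ (6 * 2 ^ r - 2) * D := by
    intro r
    induction r with
    | zero =>
      intro _ v hv
      refine (hbase v (by simpa using hv)).trans (le_of_eq (by norm_num))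
    | succ r ih =>
      intro hr v hv
      let w : Λ := ⟨(x : Site) + Pi.single a (s * (4 * n + r)), hmem _ (4 * n + r) 0 0
        (by simp [siteAt]) (by omega) (by omega) (by simp) (by simp)⟩
      have h1 := ih (by omega) w rfl
      have h2 : sqDiff β w v ≤ D := sqDiff_neighbour_le β hc (isPosEdge_of_add_single (k := a) hs (by
        rw [hv, add_assoc, ← Pi.single_add]
        congr 2
        push_cast; ring))
      have := sqDiff_triangle β x w v
      rw [pow_succ]
      linarith
  have hfin := hstep (m % 4) (by omega) y (by
    rw [hy]
    congr 3
    omega)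
  have h4 : m % 4 ≤ 3 := by omega
  have h5 : (2 : ℝ) ^ (m % 4) ≤ 2 ^ 3 := pow_le_pow_right₀ (by norm_num) h4
  refine hfin.trans (mul_le_mul_of_nonneg_right (by linarith) hD0)

lemma exists_sign_mul (v : ℤ) : ∃ s : ℤ, (s = 1 ∨ s = -1) ∧ v = s * v.natAbs := by
  rcases le_total 0 v with h | h
  · exact ⟨1, Or.inl rfl, by omega⟩
  · exact ⟨-1, Or.inr rfl, by omega⟩

/-- The spins at two sites are close if the domain contains a suitable box around these sites. -/
lemma sqDiff_le_of_box (β : ℝ) (hc : 1 - meanCos β ≤ 1 / 41472) {R : ℤ}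
    (hR : ∀ k, |x.1 k - y.1 k| ≤ R)
    (hΛ : ∀ z : Site, (∀ k, 2 * |2 * z k - x.1 k - y.1 k| ≤ 3 * R) → z ∈ Λ) :
    sqDiff β x y ≤ 460 * (400000 * (1 - meanCos β)) := by
  set D := 400000 * (1 - meanCos β) with hD
  -- The route from `x` to `y` changes one coordinate at a time; three legs cost `2 * 46 + 2 * (2 *
  -- 46 + 2 * 46) = 460`.
  let corner : ℕ → Site := fun l k => if (k : ℕ) < l then y.1 k else x.1 k
  have hcorner : ∀ l, corner l ∈ Λ := fun l => hΛ _ fun k => by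
    have h1 := hR k
    have h2 := abs_nonneg (x.1 k - y.1 k)
    simp only [corner]
    split_ifs
    · rw [show 2 * y.1 k - x.1 k - y.1 k = -(x.1 k - y.1 k) by ring, abs_neg]; omega
    · rw [show 2 * x.1 k - x.1 k - y.1 k = x.1 k - y.1 k by ring]; omega
  have hleg : ∀ a : Fin 3, sqDiff β (⟨corner a, hcorner a⟩ : Λ) ⟨corner (a + 1), hcorner (a + 1)⟩
      ≤ 46 * D := by
    intro a
    obtain ⟨s, hs, hsv⟩ := exists_sign_mul (y.1 a - x.1 a)
    refine sqDiff_straight_le β hc a hs (y.1 a - x.1 a).natAbs ?_ ?_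
    · simp only
      rw [← hsv]
      funext k
      simp only [corner, Pi.add_apply, Pi.single_apply]
      rcases lt_trichotomy k a with h | h | h
      · simp [h.ne, show (k : ℕ) < a from h, show (k : ℕ) < a + 1 from Nat.lt_succ_of_lt h]
      · subst h; simp
      · simp [h.ne', show ¬ (k : ℕ) < a from not_lt.2 h.le,
          show ¬ (k : ℕ) < a + 1 from not_lt.2 (Nat.succ_le_of_lt h)]
    · rintro z ⟨i, hi, hi', hz⟩ hz'
      -- A leg strays sideways by at most a quarter of its length, so every coordinate stays within
      -- `R / 2 + R / 4` of the midpoint.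
      refine hΛ z fun k => ?_
      have h1 := hR k
      have h2 := hR a
      by_cases hk : k = a
      · subst hk
        have hcx : corner k k = x.1 k := by simp [corner]
        simp only [hcx] at hz
        rcases abs_cases (2 * z k - x.1 k - y.1 k) with ⟨h, _⟩ | ⟨h, _⟩ <;>
          rcases abs_cases (x.1 k - y.1 k) with ⟨h', _⟩ | ⟨h', _⟩ <;>
          rcases hs with rfl | rfl <;> omega
      · have h3 := hz' k hk
        have hcx : corner a k = y.1 k ∨ corner a k = x.1 k := by
          simp only [corner]; split_ifs <;> simp
        simp only at h3
        rcases hcx with h | h <;> rw [h] at h3 <;> simp only [abs_le, ← Int.abs_eq_natAbs] at * <;>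
          grind
  have h0 : (⟨corner 0, hcorner 0⟩ : Λ) = x := Subtype.ext (by simp [corner])
  have h3 : (⟨corner 3, hcorner 3⟩ : Λ) = y := Subtype.ext (by
    funext k; simp [corner])
  have l0 := hleg 0
  have l1 := hleg 1
  have l2 := hleg 2
  have t1 := sqDiff_triangle β (⟨corner 0, hcorner 0⟩ : Λ) ⟨corner 1, hcorner 1⟩ ⟨corner 3, hcorner 3⟩
  have t2 := sqDiff_triangle β (⟨corner 1, hcorner 1⟩ : Λ) ⟨corner 2, hcorner 2⟩ ⟨corner 3, hcorner 3⟩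
  change sqDiff β (⟨corner 0, hcorner 0⟩ : Λ) ⟨corner 1, hcorner 1⟩ ≤ _ at l0
  change sqDiff β (⟨corner 1, hcorner 1⟩ : Λ) ⟨corner 2, hcorner 2⟩ ≤ _ at l1
  change sqDiff β (⟨corner 2, hcorner 2⟩ : Λ) ⟨corner 3, hcorner 3⟩ ≤ _ at l2
  rw [h0, h3] at t1
  rw [h3] at t2 l2
  rw [h0] at l0
  linarith

/-! ### From boxes to Euclidean balls. -/

lemma norm_toR3_sub_sq (x y : Site) :
    ‖toR3 x - toR3 y‖ ^ 2 = ∑ k, ((x k : ℝ) - y k) ^ 2 := by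
  rw [EuclideanSpace.norm_sq_eq]
  simp [toR3]

lemma abs_le_norm_toR3_sub (x y : Site) (k : Fin 3) : |((x k : ℝ) - y k)| ≤ ‖toR3 x - toR3 y‖ := by
  have h := norm_toR3_sub_sq x y
  refine abs_le_of_sq_le_sq ?_ (norm_nonneg _)
  rw [h]
  exact Finset.single_le_sum (f := fun k => ((x k : ℝ) - y k) ^ 2) (fun _ _ => sq_nonneg _)
    (Finset.mem_univ k)

lemma FarFromBoundary.mem {Λ : Finset Site} {x y z : Site} (h : FarFromBoundary Λ x y)
    (hz : ∑ k, (2 * (z k : ℝ) - x k - y k) ^ 2 < 16 * ‖toR3 x - toR3 y‖ ^ 2) : z ∈ Λ := by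
  refine h z ?_
  rw [Metric.mem_ball, dist_eq_norm]
  refine lt_of_pow_lt_pow_left₀ 2 (by positivity) ?_
  have e : ‖toR3 z - midpoint ℝ (toR3 x) (toR3 y)‖ ^ 2
      = 1 / 4 * ∑ k, (2 * (z k : ℝ) - x k - y k) ^ 2 := by
    rw [EuclideanSpace.norm_sq_eq, Finset.mul_sum]
    refine Finset.sum_congr rfl fun k _ => ?_
    simp [toR3, midpoint_eq_smul_add]
    ring
  rw [e, mul_pow]
  linarith

/-- Let `R` be the sup distance of `x` and `y`, and `r ≥ R` the Euclidean one. Points of the box lie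
at squared distance at most `3 * (3 / 4) ^ 2 * r ^ 2 < (2 r) ^ 2` from the midpoint. -/
lemma FarFromBoundary.sqDiff_le (β : ℝ) (hc : 1 - meanCos β ≤ 1 / 41472)
    (h : FarFromBoundary Λ x y) : sqDiff β x y ≤ 460 * (400000 * (1 - meanCos β)) := by
  by_cases hxy : x = y
  · subst hxy
    rw [sqDiff_self]
    have := meanCos_le_one β
    linarith
  obtain ⟨k₀, -, hk₀⟩ := Finset.exists_max_image Finset.univ (fun k => |x.1 k - y.1 k|)
    ⟨0, Finset.mem_univ _⟩
  refine sqDiff_le_of_box β hc (R := |x.1 k₀ - y.1 k₀|) (fun k => hk₀ k (Finset.mem_univ k))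
    fun z hz => h.mem ?_
  have hr := abs_le_norm_toR3_sub x.1 y.1 k₀
  have hr0 : 0 < ‖toR3 x.1 - toR3 y.1‖ := by
    rw [norm_pos_iff, sub_ne_zero]
    intro he
    refine hxy (Subtype.ext (funext fun k => ?_))
    have := congrArg (fun v : R3 => v k) he
    simpa [toR3] using this
  have hk : ∀ k, (2 * (z k : ℝ) - x.1 k - y.1 k) ^ 2 ≤ 9 / 4 * ‖toR3 x.1 - toR3 y.1‖ ^ 2 := by
    intro k
    have h1 : 2 * |2 * (z k : ℝ) - x.1 k - y.1 k| ≤ 3 * |(x.1 k₀ : ℝ) - y.1 k₀| := by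
      exact_mod_cast hz k
    have h2 : |2 * (z k : ℝ) - x.1 k - y.1 k| ≤ 3 / 2 * ‖toR3 x.1 - toR3 y.1‖ := by linarith
    have h3 := sq_le_sq' (abs_le.1 h2).1 (abs_le.1 h2).2
    linarith
  rw [Fin.sum_univ_three]
  nlinarith [hk 0, hk 1, hk 2]

end Diagonal

/-! ### Averages over a circle -/

/-- The average of the Poisson kernel over the circle, in real form. -/
lemma integral_inv_sub_cos_sub_sin {A p q : ℝ} (hA : 0 < A) (h : p ^ 2 + q ^ 2 < A ^ 2) :
    ∫ α in (0 : ℝ)..2 * Real.pi, (A - p * Real.cos α - q * Real.sin α)⁻¹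
      = 2 * Real.pi / √(A ^ 2 - p ^ 2 - q ^ 2) := by
  set Q := √(A ^ 2 - p ^ 2 - q ^ 2) with hQ
  have hQ2 : Q ^ 2 = A ^ 2 - p ^ 2 - q ^ 2 := Real.sq_sqrt (by linarith)
  have hQ0 : 0 < Q := Real.sqrt_pos.2 (by linarith)
  have hAQ : 0 < A + Q := by linarith
  -- Since `p² + q² = A² - Q²`, the Poisson kernel of the unit disc at this `w` is `Q` times the
  -- integrand; its mean over the circle is one.
  set w : ℂ := ⟨p / (A + Q), q / (A + Q)⟩ with hw
  have hw2 : ‖w‖ ^ 2 = (A - Q) / (A + Q) := by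
    rw [← Complex.normSq_eq_norm_sq, hw, Complex.normSq_mk]
    field_simp
    linear_combination hQ2
  have hwb : w ∈ Metric.ball (0 : ℂ) 1 := by
    rw [mem_ball_zero_iff]
    refine lt_of_pow_lt_pow_left₀ 2 zero_le_one ?_
    rw [hw2, one_pow, div_lt_one hAQ]
    linarith
  have hmain := DiffContOnCl.circleAverage_re_herglotzRieszKernel_smul (E := ℂ) (f := fun _ => 1)
    (R := 1) (c := 0) diffContOnCl_const hwb
  rw [Real.circleAverage_def, ← poissonKernel_eq_re_herglotzRieszKernel] at hmain
  have hker : ∀ α : ℝ, poissonKernel 0 w (circleMap 0 1 α)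
      = Q * (A - p * Real.cos α - q * Real.sin α)⁻¹ := by
    intro α
    have hn : ‖circleMap 0 1 α‖ ^ 2 = 1 := by simp
    have hd : ‖circleMap 0 1 α - w‖ ^ 2
        = 2 / (A + Q) * (A - p * Real.cos α - q * Real.sin α) := by
      rw [← Complex.normSq_eq_norm_sq, Complex.normSq_sub, Complex.normSq_eq_norm_sq,
        Complex.normSq_eq_norm_sq, hn, hw2]
      simp [circleMap, Complex.exp_ofReal_mul_I, hw, Complex.mul_re, Complex.cos_ofReal_re,
        Complex.sin_ofReal_re]
      field_simp
      ring
    rw [poissonKernel_def]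
    simp only [sub_zero]
    rw [hn, hd, hw2]
    rw [mul_comm (2 / (A + Q)), ← div_div, div_eq_mul_inv _ (2 / (A + Q)), div_eq_mul_inv _ (A - _ - _)]
    field_simp
    ring
  simp only [Pi.smul_apply', hker] at hmain
  rw [intervalIntegral.integral_smul_const] at hmain
  have hm2 : (2 * Real.pi)⁻¹ * (Q * ∫ α in (0 : ℝ)..2 * Real.pi,
      (A - p * Real.cos α - q * Real.sin α)⁻¹) = 1 := by
    rw [intervalIntegral.integral_const_mul] at hmain
    have := congrArg Complex.re hmain
    simpa using this
  have hpi := Real.pi_pos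
  field_simp at hm2 ⊢
  linarith

/-! ### The axis of a rotation -/

lemma col_mul_col (A : SO3) (i j : Fin 3) :
    ent A 0 i * ent A 0 j + ent A 1 i * ent A 1 j + ent A 2 i * ent A 2 j = if i = j then 1 else 0 := by
  have h := congrFun (congrFun (transpose_mul_SO3 A) i) j
  simpa [Matrix.mul_apply, Fin.sum_univ_three, Matrix.one_apply, ent] using h

lemma row_mul_row (A : SO3) (i j : Fin 3) :
    ent A i 0 * ent A j 0 + ent A i 1 * ent A j 1 + ent A i 2 * ent A j 2 = if i = j then 1 else 0 := by
  have h := congrFun (congrFun (mul_transpose_SO3 A) i) j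
  simpa [Matrix.mul_apply, Fin.sum_univ_three, Matrix.one_apply, ent] using h

lemma adjugate_SO3 (A : SO3) : Matrix.adjugate A.1 = A.1.transpose := by
  have h1 : A.1 * Matrix.adjugate A.1 = 1 := by rw [Matrix.mul_adjugate, det_SO3, one_smul]
  calc Matrix.adjugate A.1 = (A.1.transpose * A.1) * Matrix.adjugate A.1 := by
        rw [transpose_mul_SO3, one_mul]
    _ = A.1.transpose := by rw [mul_assoc, h1, mul_one]

/-- The inverse is both the transpose and the adjugate, so each entry is its own cofactor; cyclic
indices modulo `3` absorb the signs. -/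
lemma cofactor_SO3 (A : SO3) (i j : Fin 3) :
    ent A i j = ent A (i + 1) (j + 1) * ent A (i + 2) (j + 2)
      - ent A (i + 1) (j + 2) * ent A (i + 2) (j + 1) := by
  have h := congrFun (congrFun (adjugate_SO3 A) j) i
  rw [Matrix.adjugate_fin_three, Matrix.transpose_apply] at h
  simp only [ent]
  fin_cases i <;> fin_cases j <;> simp at h ⊢ <;> linarith

/-- The trace of a rotation. -/
def tr (A : SO3) : ℝ := ent A 0 0 + ent A 1 1 + ent A 2 2

@[fun_prop]
lemma cont_tr {X : Type*} [TopologicalSpace X] {A : X → SO3} (hA : Continuous A) :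
    Continuous fun x => tr (A x) := by
  unfold tr; fun_prop

lemma tr_le (A : SO3) : tr A ≤ 3 := by
  have h0 := row_mul_row A 0 0
  have h1 := row_mul_row A 1 1
  have h2 := row_mul_row A 2 2
  simp only [if_true] at h0 h1 h2
  unfold tr
  nlinarith [sq_nonneg (ent A 0 0 - 1), sq_nonneg (ent A 1 1 - 1), sq_nonneg (ent A 2 2 - 1),
    sq_nonneg (ent A 0 1), sq_nonneg (ent A 0 2), sq_nonneg (ent A 1 0), sq_nonneg (ent A 1 2),
    sq_nonneg (ent A 2 0), sq_nonneg (ent A 2 1)]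

lemma tr_conj (A B : SO3) : tr (B * A * B⁻¹) = tr A := by
  have h : ∀ A : SO3, tr A = Matrix.trace A.1 := fun A => by simp [tr, ent, Matrix.trace_fin_three]
  rw [h, h]
  change Matrix.trace ((B.1 * A.1) * (B⁻¹ : SO3).1) = _
  rw [Matrix.trace_mul_comm, ← mul_assoc]
  change Matrix.trace ((B⁻¹ * B : SO3).1 * A.1) = _
  simp

lemma tr_rotZ_mul (A : SO3) {p q : ℝ} (h : p ^ 2 + q ^ 2 = 1) :
    tr (rotZ p q h * A) = ent A 2 2 + (ent A 0 0 + ent A 1 1) * p + (ent A 0 1 - ent A 1 0) * q := by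
  simp [tr, ent_mul, Fin.sum_univ_three, ent_rotZ]
  ring

/-- This is the squared amplitude of `tr (rotZ * A)` as a function of the angle; it makes the
discriminant of the circle integral depend on `ent A 2 2` only. -/
lemma sq_add_sq_SO3 (A : SO3) :
    (ent A 0 0 + ent A 1 1) ^ 2 + (ent A 0 1 - ent A 1 0) ^ 2 = (1 + ent A 2 2) ^ 2 := by
  have h0 := row_mul_row A 0 0
  have h1 := row_mul_row A 1 1
  have h2 := col_mul_col A 2 2
  have h3 := cofactor_SO3 A 2 2
  simp only [if_true] at h0 h1 h2
  simp only [Fin.reduceAdd] at h3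
  linear_combination h0 + h1 - h2 - 2 * h3

/-- The Gram identity for a symmetric matrix of rank one. -/
lemma sq_bilin_eq_of_minors {a b c d e f : ℝ} (h1 : a * b = d ^ 2) (h2 : a * c = e ^ 2)
    (h3 : b * c = f ^ 2) (h4 : a * f = d * e) (h5 : b * e = d * f) (h6 : c * d = e * f)
    (t₀ t₁ t₂ s₀ s₁ s₂ : ℝ) :
    (a * (t₀ * s₀) + b * (t₁ * s₁) + c * (t₂ * s₂) + d * (t₀ * s₁ + t₁ * s₀)
        + e * (t₀ * s₂ + t₂ * s₀) + f * (t₁ * s₂ + t₂ * s₁)) ^ 2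
      = (a * t₀ ^ 2 + b * t₁ ^ 2 + c * t₂ ^ 2 + 2 * d * (t₀ * t₁) + 2 * e * (t₀ * t₂)
          + 2 * f * (t₁ * t₂))
        * (a * s₀ ^ 2 + b * s₁ ^ 2 + c * s₂ ^ 2 + 2 * d * (s₀ * s₁) + 2 * e * (s₀ * s₂)
          + 2 * f * (s₁ * s₂)) := by
  linear_combination -(t₀ * s₁ - t₁ * s₀) ^ 2 * h1 - (t₀ * s₂ - t₂ * s₀) ^ 2 * h2
    - (t₁ * s₂ - t₂ * s₁) ^ 2 * h3
    - 2 * (t₀ * s₁ - t₁ * s₀) * (t₀ * s₂ - t₂ * s₀) * h4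
    + 2 * (t₀ * s₁ - t₁ * s₀) * (t₁ * s₂ - t₂ * s₁) * h5
    - 2 * (t₀ * s₂ - t₂ * s₀) * (t₁ * s₂ - t₂ * s₁) * h6

/-- The quadratic form of the symmetric part of a rotation has rank one, up to a multiple of the
identity. -/
lemma sq_symm_part_eq (L : SO3) (T S : R3) (hT : ‖T‖ = 1) (hS : ‖S‖ = 1) :
    ((1 - tr L) * inner ℝ T S + inner ℝ T (rot L S) + inner ℝ S (rot L T)) ^ 2
      = (1 - tr L + 2 * inner ℝ T (rot L T)) * (1 - tr L + 2 * inner ℝ S (rot L S)) := by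
  have nT : T 0 ^ 2 + T 1 ^ 2 + T 2 ^ 2 = 1 := by
    have := EuclideanSpace.norm_sq_eq T
    rw [hT, Fin.sum_univ_three] at this
    simpa using this.symm
  have nS : S 0 ^ 2 + S 1 ^ 2 + S 2 ^ 2 = 1 := by
    have := EuclideanSpace.norm_sq_eq S
    rw [hS, Fin.sum_univ_three] at this
    simpa using this.symm
  have r := row_mul_row L
  have c := col_mul_col L
  have k := cofactor_SO3 L
  have r00 := r 0 0; have r11 := r 1 1; have r22 := r 2 2
  have r01 := r 0 1; have r02 := r 0 2; have r12 := r 1 2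
  have c00 := c 0 0; have c11 := c 1 1; have c22 := c 2 2
  have c01 := c 0 1; have c02 := c 0 2; have c12 := c 1 2
  have k00 := k 0 0; have k11 := k 1 1; have k22 := k 2 2
  have k01 := k 0 1; have k02 := k 0 2; have k12 := k 1 2
  have k10 := k 1 0; have k20 := k 2 0; have k21 := k 2 1
  simp at r00 r11 r22 r01 r02 r12 c00 c11 c22 c01 c02 c12 k00 k11 k22 k01 k02 k12 k10 k20 k21
  -- The matrix `(1 - tr L) + L + Lᵀ` equals `(3 - tr L) a aᵀ` with `a` a unit vector along the
  -- axis. Its minors vanish by the orthogonality and cofactor relations, so the axis need not be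
  -- constructed.
  have key := sq_bilin_eq_of_minors (a := 1 + ent L 0 0 - ent L 1 1 - ent L 2 2)
    (b := 1 - ent L 0 0 + ent L 1 1 - ent L 2 2) (c := 1 - ent L 0 0 - ent L 1 1 + ent L 2 2)
    (d := ent L 0 1 + ent L 1 0) (e := ent L 0 2 + ent L 2 0) (f := ent L 1 2 + ent L 2 1)
    (by linear_combination -r00 - r11 + c22 - 2 * k22)
    (by linear_combination -r00 - r22 + c11 - 2 * k11)
    (by linear_combination -r11 - r22 + c00 - 2 * k00)
    (by linear_combination k12 + k21 - c12 - r12)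
    (by linear_combination k02 + k20 - c02 - r02)
    (by linear_combination k01 + k10 - c01 - r01)
    (T 0) (T 1) (T 2) (S 0) (S 1) (S 2)
  have e1 : ∀ A B : ℝ, ∀ U : R3, U 0 ^ 2 + U 1 ^ 2 + U 2 ^ 2 = 1 →
      1 - tr L + 2 * inner ℝ U (rot L U) = (1 - tr L) * (U 0 ^ 2 + U 1 ^ 2 + U 2 ^ 2)
        + 2 * inner ℝ U (rot L U) := by
    intro A B U hU; rw [hU, mul_one]
  rw [e1 0 0 T nT, e1 0 0 S nS]
  simp only [inner_R3, rot_apply', Fin.sum_univ_three, tr]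
  linear_combination key

/-- A vector that is almost fixed by a rotation is almost parallel to its axis. -/
lemma tr_mul_one_sub_inner_sq_le (L : SO3) {T S : R3} (hT : ‖T‖ = 1) (hS : ‖S‖ = 1) :
    (3 - tr L) * (1 - inner ℝ T S ^ 2) ≤ 2 * (‖rot L T - T‖ ^ 2 + ‖rot L S - S‖ ^ 2) := by
  have hX : ∀ U : R3, ‖U‖ = 1 → ‖rot L U - U‖ ^ 2 = 2 - 2 * inner ℝ U (rot L U) := by
    intro U hU
    rw [norm_sub_sq_real, norm_rot, hU, real_inner_comm]; ring
  have hW : inner ℝ (rot L T - T) (rot L S - S)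
      = 2 * inner ℝ T S - inner ℝ T (rot L S) - inner ℝ S (rot L T) := by
    rw [inner_sub_left, inner_sub_right, inner_sub_right, inner_rot_rot, real_inner_comm S (rot L T)]
    ring
  have key := sq_symm_part_eq L T S hT hS
  have hcs := abs_real_inner_le_norm (rot L T - T) (rot L S - S)
  have hu := abs_real_inner_le_norm T S
  rw [hT, hS, mul_one] at hu
  have hXT := hX T hT
  have hXS := hX S hS
  set W := inner ℝ (rot L T - T) (rot L S - S)
  set x := ‖rot L T - T‖
  set y := ‖rot L S - S‖
  set u := inner ℝ T S
  have hx : 0 ≤ x := norm_nonneg _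
  have hy : 0 ≤ y := norm_nonneg _
  rcases (tr_le L).eq_or_lt with h | h
  · rw [h]; nlinarith
  · set D := 3 - tr L with hD
    have hD0 : 0 < D := by linarith
    -- Expanded, this reads `D² (1 - u²) = D (x² + y² - 2 u W) + W² - x² y²`. Cauchy–Schwarz for `W`
    -- and `|u| ≤ 1` bound the right side by `D (x + y)²`.
    have key2 : (D * u - W) ^ 2 = (D - x ^ 2) * (D - y ^ 2) := by
      rw [hW, hXT, hXS, hD]
      linear_combination key
    have hW2 : W ^ 2 ≤ x ^ 2 * y ^ 2 := by
      rw [← mul_pow]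
      exact sq_le_sq' (abs_le.1 hcs).1 (abs_le.1 hcs).2
    have huW : -(x * y) ≤ u * W := by
      have : |u * W| ≤ x * y := by
        rw [abs_mul]
        calc |u| * |W| ≤ 1 * (x * y) := mul_le_mul hu hcs (abs_nonneg _) zero_le_one
          _ = x * y := one_mul _
      exact (abs_le.1 this).1
    refine le_of_mul_le_mul_left ?_ hD0
    nlinarith [sq_nonneg (x - y), mul_nonneg hD0.le (sq_nonneg (x - y)),
      mul_le_mul_of_nonneg_left huW hD0.le]

/-! ### Loops -/

section Loops

variable {ι : Type*} [Fintype ι] [DecidableEq ι]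

/-- Multiplication of the rotation on one edge by a given rotation. -/
def twist (i : ι) (K : SO3) (ω : ι → SO3) : ι → SO3 := Function.update ω i (K * ω i)

lemma measurePreserving_twist (β : ℝ) (i : ι) {K : SO3} (hK : rot K ez = ez) :
    MeasurePreserving (twist i K) (edgeLaw ι β) (edgeLaw ι β) := by
  have h := measurePreserving_pi (fun _ : ι => nishimoriLaw β) (fun _ => nishimoriLaw β)
    (f := fun j Ω => if j = i then K * Ω else Ω) (fun j => by
      by_cases hj : j = i
      · simpa [hj] using measurePreserving_mul_left_nishimoriLaw β hK
      · simp only [hj, if_false]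
        exact MeasurePreserving.id _)
  unfold edgeLaw
  convert h using 1
  funext ω j
  by_cases hj : j = i
  · subst hj; simp [twist]
  · simp [twist, hj]

omit [Fintype ι] in
lemma transport_twist (i : ι) (K : SO3) (ω : ι → SO3) {l : List (ι × Bool)}
    (h : ∀ s ∈ l, s.1 ≠ i) :
    transport (twist i K ω) ((i, true) :: l) = K * transport ω ((i, true) :: l) := by
  rw [transport_cons, transport_cons, twist, transport_update ω _ h]
  simp [stepRot, mul_assoc]

omit [Fintype ι] [DecidableEq ι] in
lemma cont_circle_integral {F : (ι → SO3) → ℝ → ℝ} (hF : Continuous fun p : (ι → SO3) × ℝ => F p.1 p.2) :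
    Continuous fun ω => ∫ α in (0 : ℝ)..2 * Real.pi, F ω α :=
  intervalIntegral.continuous_parametric_intervalIntegral_of_continuous' hF _ _

/-- The mean of the regularized bound on the angle between a vector that is almost fixed by a
random loop and the axis of the loop. -/
lemma integral_loop_le (β : ℝ) (i : ι) {l : List (ι × Bool)} (h : ∀ s ∈ l, s.1 ≠ i)
    (hl : (l.map Prod.fst).Nodup) {η : ℝ} (hη : 0 < η) :
    ∫ ω, (4 * (2 - 2 * ent (transport ω ((i, true) :: l)) 2 2) + η ^ 2)
        / (3 - tr (transport ω ((i, true) :: l)) + η ^ 2) ∂(edgeLaw ι β)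
      ≤ 2 * (1 - meanCos β ^ (l.length + 1)) / η + 2 * η := by
  set L : (ι → SO3) → SO3 := fun ω => transport ω ((i, true) :: l) with hL
  have hLc : Continuous L := by fun_prop
  set δ := η ^ 2 with hδ
  have hδ0 : 0 < δ := by positivity
  set G : ℝ → SO3 → ℝ := fun α A => (4 * (2 - 2 * ent A 2 2) + δ)
    * ((3 + δ - ent A 2 2) - (ent A 0 0 + ent A 1 1) * Real.cos α
      - (ent A 0 1 - ent A 1 0) * Real.sin α)⁻¹ with hG
  have hden : ∀ α A, ((3 + δ - ent A 2 2) - (ent A 0 0 + ent A 1 1) * Real.cos α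
      - (ent A 0 1 - ent A 1 0) * Real.sin α)
      = 3 - tr (rotZ (Real.cos α) (Real.sin α) (Real.cos_sq_add_sin_sq α) * A) + δ := by
    intro α A
    rw [tr_rotZ_mul]; ring
  have hdenpos : ∀ α A, δ ≤ ((3 + δ - ent A 2 2) - (ent A 0 0 + ent A 1 1) * Real.cos α
      - (ent A 0 1 - ent A 1 0) * Real.sin α) := by
    intro α A
    rw [hden]
    linarith [tr_le (rotZ (Real.cos α) (Real.sin α) (Real.cos_sq_add_sin_sq α) * A)]
  have hent : ∀ A : SO3, -1 ≤ ent A 2 2 ∧ ent A 2 2 ≤ 1 := fun A => abs_le.1 (by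
    have := row_sq_SO3 A
    rw [← sq_le_one_iff_abs_le_one]
    nlinarith [sq_nonneg (ent A 2 0), sq_nonneg (ent A 2 1)])
  have hGcont : Continuous fun p : ℝ × (ι → SO3) => G p.1 (L p.2) := by
    simp only [hG]
    refine Continuous.mul (by fun_prop) (Continuous.inv₀ (by fun_prop) fun p => ?_)
    exact (lt_of_lt_of_le hδ0 (hdenpos p.1 (L p.2))).ne'
  have hGbound : ∀ α A, ‖G α A‖ ≤ (16 + δ) * δ⁻¹ := by
    intro α A
    have h1 := hdenpos α A
    have h2 := hent A
    rw [Real.norm_of_nonneg (mul_nonneg (by linarith) (inv_nonneg.2 (by linarith)))]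
    exact mul_le_mul (by linarith) (inv_anti₀ hδ0 h1) (inv_nonneg.2 (by linarith)) (by linarith)
  -- Turning one edge of the loop by `α` about `ez` preserves the law and the `z` component of `L
  -- ez`, but changes the trace. The averaging over `α` below keeps the singularity at small `3 -
  -- tr` under control.
  have hrot : ∀ α, ∫ ω, (4 * (2 - 2 * ent (L ω) 2 2) + δ) / (3 - tr (L ω) + δ) ∂(edgeLaw ι β)
      = ∫ ω, G α (L ω) ∂(edgeLaw ι β) := by
    intro α
    have hc : Continuous fun ω => (4 * (2 - 2 * ent (L ω) 2 2) + δ) / (3 - tr (L ω) + δ) := by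
      refine Continuous.div (by fun_prop) (by fun_prop) fun ω => ?_
      linarith [tr_le (L ω)]
    rw [← integral_comp_of_cont (measurePreserving_twist β i
      (rot_rotZ_ez (Real.cos α) (Real.sin α) (Real.cos_sq_add_sin_sq α))) hc]
    congr 1
    funext ω
    simp only [hG, hL, transport_twist i _ ω h]
    rw [hden, div_eq_mul_inv]
    congr 3
    simp [ent_mul, Fin.sum_univ_three, ent_rotZ]
  have hpi := Real.pi_pos
  have hswap : 2 * Real.pi * ∫ ω, (4 * (2 - 2 * ent (L ω) 2 2) + δ) / (3 - tr (L ω) + δ) ∂(edgeLaw ι β)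
      = ∫ ω, (∫ α in (0 : ℝ)..2 * Real.pi, G α (L ω)) ∂(edgeLaw ι β) := by
    rw [← intervalIntegral_integral_swap]
    · simp only [← hrot, intervalIntegral.integral_const, sub_zero, smul_eq_mul]
    · have : IsFiniteMeasure ((volume : Measure ℝ).restrict (Set.uIoc 0 (2 * Real.pi))) :=
        ⟨by
          rw [Measure.restrict_apply_univ, Set.uIoc_of_le Real.two_pi_pos.le, Real.volume_Ioc]
          exact ENNReal.ofReal_lt_top⟩
      exact Integrable.of_bound hGcont.aestronglyMeasurable _ (Filter.Eventually.of_forall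
        fun p => hGbound p.1 (L p.2))
  -- With `Y = 2 - 2 ℓ + δ` the discriminant is `Y (4 + δ) ≥ 4 Y`, and the numerator is at most `4
  -- Y`. The average over the circle is thus at most `2 √Y`, hence at most `Y / η + η`, which is
  -- linear in `ℓ` and can be integrated.
  have hinner : ∀ A, ∫ α in (0 : ℝ)..2 * Real.pi, G α A
      ≤ 2 * Real.pi * ((2 - 2 * ent A 2 2 + δ) / η + η) := by
    intro A
    obtain ⟨h1, h2⟩ := hent A
    have hid := sq_add_sq_SO3 A
    set ℓ := ent A 2 2
    have hlt : (ent A 0 0 + ent A 1 1) ^ 2 + (ent A 0 1 - ent A 1 0) ^ 2 < (3 + δ - ℓ) ^ 2 := by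
      rw [hid]; nlinarith
    simp only [hG]
    rw [intervalIntegral.integral_const_mul, integral_inv_sub_cos_sub_sin (by linarith) hlt]
    set Y := 2 - 2 * ℓ + δ with hY
    have hY0 : 0 < Y := by linarith
    have hY2 : Y = √Y ^ 2 := (Real.sq_sqrt hY0.le).symm
    have hsY : 0 < √Y := Real.sqrt_pos.2 hY0
    have hQ : 2 * √Y ≤ √((3 + δ - ℓ) ^ 2 - (ent A 0 0 + ent A 1 1) ^ 2
        - (ent A 0 1 - ent A 1 0) ^ 2) := by
      refine Real.le_sqrt_of_sq_le ?_
      have e : (3 + δ - ℓ) ^ 2 - (ent A 0 0 + ent A 1 1) ^ 2 - (ent A 0 1 - ent A 1 0) ^ 2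
          = Y * (4 + δ) := by rw [hY]; linear_combination -hid
      rw [e, mul_pow, ← hY2]
      nlinarith
    calc (4 * (2 - 2 * ℓ) + δ) * (2 * Real.pi / √((3 + δ - ℓ) ^ 2 - (ent A 0 0 + ent A 1 1) ^ 2
        - (ent A 0 1 - ent A 1 0) ^ 2)) ≤ (4 * √Y ^ 2) * (2 * Real.pi / (2 * √Y)) := by
          refine mul_le_mul ?_ (div_le_div_of_nonneg_left (by positivity) (by positivity) hQ)
            (by positivity) (by positivity)
          rw [← hY2]; linarith
      _ = 2 * Real.pi * (2 * √Y) := by field_simp; norm_num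
      _ ≤ 2 * Real.pi * (Y / η + η) := by
          refine mul_le_mul_of_nonneg_left ?_ (by positivity)
          rw [div_add' _ _ _ hη.ne', le_div_iff₀ hη]
          nlinarith [sq_nonneg (√Y - η)]
  have hmean : ∫ ω, ent (L ω) 2 2 ∂(edgeLaw ι β) = meanCos β ^ (l.length + 1) := by
    have := integral_path_eq (β := β) ((i, true) :: l) (by
      rw [List.map_cons, List.nodup_cons]
      refine ⟨fun hm => ?_, hl⟩
      obtain ⟨s, hs, hsi⟩ := List.mem_map.1 hm
      exact h s hs hsi)
    rw [List.length_cons] at this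
    rw [← this]
    simp only [rot_ez_apply', hL]
  have hfin : ∫ ω, (∫ α in (0 : ℝ)..2 * Real.pi, G α (L ω)) ∂(edgeLaw ι β)
      ≤ ∫ ω, 2 * Real.pi * ((2 - 2 * ent (L ω) 2 2 + δ) / η + η) ∂(edgeLaw ι β) := by
    have hc : Continuous fun p : (ι → SO3) × ℝ => G p.2 (L p.1) := by
      clear_value G
      have := hGcont.comp (continuous_swap (X := ι → SO3) (Y := ℝ))
      simpa only [Function.comp_def, Prod.fst_swap, Prod.snd_swap] using this
    have hc1 := cont_circle_integral (F := fun ω α => G α (L ω)) hc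
    have hc2 : Continuous fun ω => 2 * Real.pi * ((2 - 2 * ent (L ω) 2 2 + δ) / η + η) := by fun_prop
    exact integral_mono (integrable_of_cont _ hc1) (integrable_of_cont _ hc2) fun ω => hinner (L ω)
  have hval : ∫ ω, 2 * Real.pi * ((2 - 2 * ent (L ω) 2 2 + δ) / η + η) ∂(edgeLaw ι β)
      = 2 * Real.pi * (2 * (1 - meanCos β ^ (l.length + 1)) / η + 2 * η) := by
    have hi : Integrable (fun ω => ent (L ω) 2 2) (edgeLaw ι β) :=
      integrable_of_cont _ (by fun_prop)
    have e : ∀ ω, 2 * Real.pi * ((2 - 2 * ent (L ω) 2 2 + δ) / η + η)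
        = 2 * Real.pi * (2 / η + 2 * η) - 4 * Real.pi / η * ent (L ω) 2 2 := by
      intro ω; rw [hδ]; field_simp; ring
    simp only [e]
    rw [integral_sub (integrable_const _) (hi.const_mul _)]
    simp only [integral_const_mul, hmean, integral_const, probReal_univ, one_smul]
    field_simp
    ring
  rw [← hswap, hval] at hfin
  exact le_of_mul_le_mul_left hfin (by positivity)

end Loops

section Plaquettes

variable {Λ : Finset Site} {x : Λ}

lemma norm_rot_ez_sub_ez_sq (A : SO3) : ‖rot A ez - ez‖ ^ 2 = 2 - 2 * ent A 2 2 := by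
  rw [norm_sub_sq_real, norm_rot, norm_ez, inner_ez', rot_ez_apply']
  ring

/-- A loop at a site forces the spin at this site to be close to the axis. -/
lemma integral_one_sub_sq_le_of_loop (β : ℝ) (e : PosEdge Λ) {l : List (PosEdge Λ × Bool)}
    (h : ∀ s ∈ l, s.1 ≠ e) (hl : (l.map Prod.fst).Nodup)
    (hcov : ∀ (θ : Λ → SO3) (ω : Disorder Λ), transport (gauge θ ω) ((e, true) :: l)
      = θ x * transport ω ((e, true) :: l) * (θ x)⁻¹) {η : ℝ} (hη : 0 < η) :
    ∫ ω, ∫ S, (1 - (S x : R3) 2 ^ 2) ∂(gibbs β ω) ∂(disorderLaw β Λ)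
      ≤ 2 * (1 - meanCos β ^ (l.length + 1)) / η + 2 * η := by
  refine le_trans ?_ (integral_loop_le β e h hl hη)
  set L : Disorder Λ → SO3 := fun ω => transport ω ((e, true) :: l) with hL
  have hLc : Continuous L := by fun_prop
  set δ := η ^ 2 with hδ
  have hδ0 : 0 < δ := by positivity
  have hden : ∀ ω, 0 < 3 - tr (L ω) + δ := fun ω => by linarith [tr_le (L ω)]
  set G : Disorder Λ → (Λ → S2) → ℝ := fun ω S =>
    ‖rot (L ω) (S x : R3) - (S x : R3)‖ ^ 2 / (3 - tr (L ω) + δ) with hG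
  set H : Disorder Λ → ℝ := fun ω =>
    (2 * ‖rot (L ω) ez - ez‖ ^ 2 + δ) / (3 - tr (L ω) + δ) with hH
  have hGc : Continuous (Function.uncurry G) := by
    unfold Function.uncurry
    simp only [hG]
    exact Continuous.div (by fun_prop) (by fun_prop) fun p => (hden p.1).ne'
  have hHc : Continuous H :=
    Continuous.div (by fun_prop) (by fun_prop) fun p => (hden p).ne'
  have hinv : ∀ θ ω T, G (gauge θ ω) (rotSpins θ T) = G ω T := by
    intro θ ω T
    have h1 : L (gauge θ ω) = θ x * L ω * (θ x)⁻¹ := hcov θ ω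
    have h2 : (rotSpins θ T x : R3) = rot (θ x) (T x : R3) := coe_rotS _ _
    simp only [hG, h1, h2, tr_conj, rot_mul, rot_inv_rot, ← rot_sub, norm_rot]
  -- The geometric bound is applied to `ez` and `S x`; the summand `δ` in the numerator of `H` pays
  -- for the regularized denominator, since `1 - (S x)₂² ≤ 1`.
  have hpt : ∀ (ω : Disorder Λ) (S : Λ → S2), 1 - (S x : R3) 2 ^ 2 ≤ 2 * G ω S + H ω := by
    intro ω S
    have h1 := tr_mul_one_sub_inner_sq_le (L ω) norm_ez (norm_eq_of_mem_sphere (S x))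
    rw [inner_ez] at h1
    simp only [hG, hH]
    rw [← mul_div_assoc, ← add_div, le_div_iff₀ (hden ω)]
    nlinarith [sq_nonneg ((S x : R3) 2)]
  calc ∫ ω, ∫ S, (1 - (S x : R3) 2 ^ 2) ∂(gibbs β ω) ∂(disorderLaw β Λ)
      ≤ ∫ ω, ∫ S, (2 * G ω S + H ω) ∂(gibbs β ω) ∂(disorderLaw β Λ) := by
        refine integral_gibbs_mono β ?_ ?_ hpt
        · unfold Function.uncurry; fun_prop
        · exact (hGc.const_mul 2).add (hHc.comp continuous_fst)
    _ = 2 * ∫ ω, ∫ S, G ω S ∂(gibbs β ω) ∂(disorderLaw β Λ) + ∫ ω, H ω ∂(disorderLaw β Λ) := by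
        rw [integral_gibbs_add (F := fun ω S => 2 * G ω S) (G := fun ω _ => H ω) β
          (hGc.const_mul 2) (hHc.comp continuous_fst), integral_gibbs_const_mul]
        simp only [integral_const, probReal_univ, one_smul]
    _ = ∫ ω, (2 * G ω (north Λ) + H ω) ∂(disorderLaw β Λ) := by
        have hGn : Continuous fun ω => 2 * G ω (north Λ) :=
          (hGc.comp (by fun_prop : Continuous fun ω : Disorder Λ => (ω, north Λ))).const_mul 2
        rw [nishimori_identity β hGc hinv, integral_add (integrable_of_cont _ hGn)
          (integrable_of_cont _ hHc), integral_const_mul]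
    _ = _ := by
        change _ = ∫ ω, _ ∂(disorderLaw β Λ)
        congr 1
        funext ω
        have : (north Λ x : R3) = ez := coe_ezS
        simp only [hG, hH, this, norm_rot_ez_sub_ez_sq]
        rw [← mul_div_assoc, ← add_div]
        congr 1
        ring

/-- If the domain contains a plaquette at `x`, then the spin at `x` is close to the axis. -/
lemma integral_one_sub_sq_le (β : ℝ) (h0 : x.1 + Pi.single 0 1 ∈ Λ) (h1 : x.1 + Pi.single 1 1 ∈ Λ)
    (h01 : x.1 + Pi.single 0 1 + Pi.single 1 1 ∈ Λ) {η : ℝ} (hη : 0 < η) :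
    ∫ ω, ∫ S, (1 - (S x : R3) 2 ^ 2) ∂(gibbs β ω) ∂(disorderLaw β Λ)
      ≤ 2 * (1 - meanCos β ^ 4) / η + 2 * η := by
  let a : Λ := ⟨_, h0⟩
  let b : Λ := ⟨_, h1⟩
  let c : Λ := ⟨_, h01⟩
  let e1 : PosEdge Λ := ⟨(x, a), 0, rfl⟩
  let e2 : PosEdge Λ := ⟨(a, c), 1, rfl⟩
  let e3 : PosEdge Λ := ⟨(b, c), 0, add_right_comm _ _ _⟩
  let e4 : PosEdge Λ := ⟨(x, b), 1, rfl⟩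
  have n0 : (Pi.single 0 1 : Site) ≠ 0 := fun h => by
    have := congrFun h 0
    simp at this
  have n1 : (Pi.single 1 1 : Site) ≠ 0 := fun h => by
    have := congrFun h 1
    simp at this
  have n01 : (Pi.single 0 1 : Site) ≠ Pi.single 1 1 := fun h => by
    have := congrFun h 0
    simp at this
  have hxa : x ≠ a := fun h => n0 (by
    have := congrArg Subtype.val h
    simp [a] at this)
  have hxb : x ≠ b := fun h => n1 (by
    have := congrArg Subtype.val h
    simp [b] at this)
  have hab : a ≠ b := fun h => n01 (by simpa [a, b, Subtype.ext_iff] using h)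
  have h12 : e2 ≠ e1 := fun h => hxa (congrArg (fun e : PosEdge Λ => e.1.1) h).symm
  have h13 : e3 ≠ e1 := fun h => hxb (congrArg (fun e : PosEdge Λ => e.1.1) h).symm
  have h14 : e4 ≠ e1 := fun h => hab (congrArg (fun e : PosEdge Λ => e.1.2) h).symm
  have h23 : e2 ≠ e3 := fun h => hab (congrArg (fun e : PosEdge Λ => e.1.1) h)
  have h24 : e2 ≠ e4 := fun h => hxa (congrArg (fun e : PosEdge Λ => e.1.1) h).symm
  have h34 : e3 ≠ e4 := fun h => hxb (congrArg (fun e : PosEdge Λ => e.1.1) h).symm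
  refine integral_one_sub_sq_le_of_loop β e1 (l := [(e2, true), (e3, false), (e4, false)])
    (by simp [h12, h13, h14]) (by simp [h23, h24, h34]) (fun θ ω => ?_) hη
  simp [transport, stepRot, gauge, e1, e2, e3, e4, mul_assoc]

end Plaquettes

/-! ### Long range order at low temperature -/

section LowTemperature

variable {Λ : Finset Site} {x y : Λ}

lemma correlation_self (β : ℝ) (x : Λ) : correlation β Λ x x = 1 := by
  simp [correlation]

/-- The correlations are those of the components of the spins along the axis. -/
lemma correlation_eq (β : ℝ) (hxy : x ≠ y) :
    correlation β Λ x y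
      = ∫ ω, ∫ S, (S x : R3) 2 * (S y : R3) 2 ∂(gibbs β ω) ∂(disorderLaw β Λ) := by
  -- A half turn about `ez` at `x` alone preserves the law of the disorder. Averaging `S x` with its
  -- image leaves twice its `z` part.
  obtain ⟨θ, hθx, hθ⟩ : ∃ θ : Λ → SO3, θ x = halfTurn ∧ ∀ i, i ≠ x → θ i = 1 :=
    ⟨Function.update 1 x halfTurn, by simp, fun i hi => by simp [hi]⟩
  have hθy : θ y = 1 := hθ y hxy.symm
  have hθz : ∀ i, rotS (θ i) ezS = ezS := by
    intro i
    by_cases hi : i = x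
    · rw [hi, hθx]
      exact Subtype.ext (by rw [coe_rotS, coe_ezS, rot_halfTurn_ez])
    · rw [hθ i hi, rotS_one]
  have hF : Continuous (Function.uncurry fun (_ : Disorder Λ) (S : Λ → S2) =>
      inner ℝ (S x : R3) (S y : R3)) := by unfold Function.uncurry; fun_prop
  have hFS : Continuous fun S : Λ → S2 => inner ℝ (S x : R3) (S y : R3) := by fun_prop
  have h1 : correlation β Λ x y
      = ∫ ω, ∫ S, inner ℝ (rot halfTurn (S x : R3)) (S y : R3) ∂(gibbs β ω) ∂(disorderLaw β Λ) := by
    have h0 : ∫ ω, ∫ S, inner ℝ (S x : R3) (S y : R3) ∂(gibbs β (gauge θ ω)) ∂(disorderLaw β Λ)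
        = correlation β Λ x y :=
      integral_comp_of_cont (f := fun ω => ∫ S, inner ℝ (S x : R3) (S y : R3) ∂(gibbs β ω))
        (measurePreserving_gauge_disorderLaw β hθz) (cont_gibbs β hF)
    rw [← h0]
    refine integral_congr_ae (Filter.Eventually.of_forall fun ω => ?_)
    refine (integral_gibbs_gauge β θ ω hFS).trans
      (integral_congr_ae (Filter.Eventually.of_forall fun S => ?_))
    have hx : (rotSpins θ S x : R3) = rot (θ x) (S x : R3) := coe_rotS _ _
    have hy : (rotSpins θ S y : R3) = rot (θ y) (S y : R3) := coe_rotS _ _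
    simp only [hx, hy, hθx, hθy, rot_one]
  have h2 : correlation β Λ x y + correlation β Λ x y
      = 2 * ∫ ω, ∫ S, (S x : R3) 2 * (S y : R3) 2 ∂(gibbs β ω) ∂(disorderLaw β Λ) := by
    nth_rewrite 1 [h1]
    unfold correlation
    rw [← integral_gibbs_add, ← integral_gibbs_const_mul]
    · refine integral_congr_ae (Filter.Eventually.of_forall fun ω =>
        integral_congr_ae (Filter.Eventually.of_forall fun S => ?_))
      simp only
      rw [← inner_add_left, rot_halfTurn_add, inner_smul_left, inner_ez]
      simp
      ring
    · unfold Function.uncurry; fun_prop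
    · exact hF
  linarith

/-- From `a b = 1 - (a - b)² / 2 - (1 - a²) / 2 - (1 - b²) / 2` for the `z` components `a`, `b`. -/
lemma correlation_ge (β : ℝ) (hxy : x ≠ y) {b : ℝ}
    (hx : ∫ ω, ∫ S, (1 - (S x : R3) 2 ^ 2) ∂(gibbs β ω) ∂(disorderLaw β Λ) ≤ b)
    (hy : ∫ ω, ∫ S, (1 - (S y : R3) 2 ^ 2) ∂(gibbs β ω) ∂(disorderLaw β Λ) ≤ b) :
    1 - b - sqDiff β x y / 2 ≤ correlation β Λ x y := by
  have h : (1 : ℝ) = ∫ ω, ∫ S, ((S x : R3) 2 * (S y : R3) 2 + (1 / 2 * ((S x : R3) 2 - (S y : R3) 2) ^ 2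
      + (1 / 2 * (1 - (S x : R3) 2 ^ 2) + 1 / 2 * (1 - (S y : R3) 2 ^ 2))))
      ∂(gibbs β ω) ∂(disorderLaw β Λ) := by
    have e : ∀ S : Λ → S2, ((S x : R3) 2 * (S y : R3) 2 + (1 / 2 * ((S x : R3) 2 - (S y : R3) 2) ^ 2
      + (1 / 2 * (1 - (S x : R3) 2 ^ 2) + 1 / 2 * (1 - (S y : R3) 2 ^ 2)))) = 1 := fun S => by ring
    simp only [e, integral_const, probReal_univ, one_smul]
  rw [integral_gibbs_add, integral_gibbs_add, integral_gibbs_add, integral_gibbs_const_mul,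
    integral_gibbs_const_mul, integral_gibbs_const_mul, ← correlation_eq β hxy] at h
  · unfold sqDiff
    linarith
  all_goals unfold Function.uncurry; fun_prop

lemma one_le_norm_toR3_sub_sq {x y : Site} (hxy : x ≠ y) : 1 ≤ ‖toR3 x - toR3 y‖ ^ 2 := by
  obtain ⟨k, hk⟩ := Function.ne_iff.1 hxy
  have h1 : (1 : ℝ) ≤ |((x k : ℝ) - y k)| := by
    have : (1 : ℤ) ≤ |x k - y k| := Int.one_le_abs (sub_ne_zero.2 hk)
    exact_mod_cast this
  have h2 := abs_le_norm_toR3_sub x y k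
  nlinarith

lemma FarFromBoundary.symm {x y : Site} (h : FarFromBoundary Λ x y) : FarFromBoundary Λ y x := by
  intro z hz
  refine h z ?_
  rwa [midpoint_comm, norm_sub_rev]

/-- This places the plaquette at `x` inside the ball. With distance at least one, `7 / 2 + 2 * 28 /
5 < 16` leaves enough room even for nearest neighbours. -/
lemma FarFromBoundary.mem_of_sum_sq_le {x y z : Site} (h : FarFromBoundary Λ x y) (hxy : x ≠ y)
    (hz : ∑ k, (z k - x k) ^ 2 ≤ 2) : z ∈ Λ := by
  refine h.mem ?_
  have h1 := one_le_norm_toR3_sub_sq hxy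
  have h2 : ∑ k, ((z k : ℝ) - x k) ^ 2 ≤ 2 := by exact_mod_cast hz
  rw [norm_toR3_sub_sq] at h1 ⊢
  simp only [Fin.sum_univ_three] at *
  have key : ∀ k, (2 * (z k : ℝ) - x k - y k) ^ 2
      ≤ 7 / 2 * ((x k : ℝ) - y k) ^ 2 + 28 / 5 * ((z k : ℝ) - x k) ^ 2 := fun k => by
    nlinarith [sq_nonneg (5 * ((x k : ℝ) - y k) - 4 * ((z k : ℝ) - x k))]
  linarith [key 0, key 1, key 2]

lemma FarFromBoundary.integral_one_sub_sq_le (β : ℝ) (h : FarFromBoundary Λ x y) (hxy : x ≠ y)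
    {η : ℝ} (hη : 0 < η) :
    ∫ ω, ∫ S, (1 - (S x : R3) 2 ^ 2) ∂(gibbs β ω) ∂(disorderLaw β Λ)
      ≤ 2 * (1 - meanCos β ^ 4) / η + 2 * η := by
  have hxy' : (x : Site) ≠ y := fun e => hxy (Subtype.ext e)
  refine NishimoriHeisenberg.integral_one_sub_sq_le β (h.mem_of_sum_sq_le hxy' ?_)
    (h.mem_of_sum_sq_le hxy' ?_) (h.mem_of_sum_sq_le hxy' ?_) hη <;>
  simp [Fin.sum_univ_three, Pi.single_apply]

theorem exists_correlation_ge : ∃ βstar a : ℝ, 0 < βstar ∧ 0 < a ∧ ∀ β : ℝ, βstar ≤ β →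
    ∀ (Λ : Finset Site) (x y : Λ), FarFromBoundary Λ x y →
      1 - Real.sqrt (a * Real.log β / β) ≤ correlation β Λ x y := by
  have hlim : Filter.Tendsto (fun β : ℝ => Real.log β / β) Filter.atTop (nhds 0) := by
    simpa using Real.isLittleO_log_id_atTop.tendsto_div_nhds_zero
  -- `414720 = 10 * 41472`, so that `1 - meanCos β ≤ 1 / 41472`.
  obtain ⟨β₁, hβ₁⟩ := Filter.eventually_atTop.1
    (hlim.eventually_le_const (show (0 : ℝ) < 1 / 414720 by norm_num))
  refine ⟨max β₁ 3, 10 ^ 18, by positivity, by norm_num, fun β hβ Λ x y hfar => ?_⟩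
  have hβ3 : 3 ≤ β := (le_max_right _ _).trans hβ
  by_cases hxy : x = y
  · rw [hxy, correlation_self]
    linarith [Real.sqrt_nonneg (10 ^ 18 * Real.log β / β)]
  have hε := one_sub_meanCos_le hβ3
  rw [mul_div_assoc] at hε
  have hs := hβ₁ β ((le_max_left _ _).trans hβ)
  have ht0 : 0 < Real.log β / β := div_pos (Real.log_pos (by linarith)) (by linarith)
  rw [mul_div_assoc]
  set t := Real.log β / β
  -- This choice balances the two terms of the loop estimate. The total loss is at most `82 η + 230
  -- * 400000 * 10 * t`, below `10 ^ 9 * η` because `t ≤ η`; whence the constant `10 ^ 18`.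
  set η := √t with hη
  have hη0 : 0 < η := Real.sqrt_pos.2 ht0
  have hη2 : η ^ 2 = t := Real.sq_sqrt ht0.le
  have hη1 : η ≤ 1 := Real.sqrt_le_one.2 (by linarith)
  have hsqrt : √(10 ^ 18 * t) = 10 ^ 9 * η := by
    rw [Real.sqrt_mul (by positivity), show (10 : ℝ) ^ 18 = (10 ^ 9) ^ 2 by norm_num,
      Real.sqrt_sq (by positivity)]
  have hc1 := meanCos_le_one β
  have hc : 1 - meanCos β ≤ 1 / 41472 := by linarith
  have hc4 : 1 - meanCos β ^ 4 ≤ 40 * t := by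
    have := one_add_mul_le_pow (a := meanCos β - 1) (by linarith) 4
    norm_num at this
    linarith
  have hb : 2 * (1 - meanCos β ^ 4) / η + 2 * η ≤ 82 * η := by
    have : 2 * (1 - meanCos β ^ 4) / η ≤ 80 * η := by
      rw [div_le_iff₀ hη0]
      nlinarith
    linarith
  have hx := (hfar.integral_one_sub_sq_le β hxy hη0).trans hb
  have hy := (hfar.symm.integral_one_sub_sq_le β (Ne.symm hxy) hη0).trans hb
  have h1 := correlation_ge β hxy hx hy
  have h2 := hfar.sqDiff_le β hc
  rw [hsqrt]
  nlinarith

end LowTemperature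

/-! ### Exponential decay at high temperature -/

section HighTemperature

variable {Λ : Finset Site}

/-! #### Trails in sets of edges -/

/-- There is a trail of `n` edges of `A` that starts at `z` and avoids the edges in `F`. -/
def HasTrail : ℕ → Λ → Finset (PosEdge Λ) → Finset (PosEdge Λ) → Prop
  | 0, _, _, _ => True
  | n + 1, z, F, A => ∃ e ∈ A, e ∉ F ∧ ∃ z', (e.1 = (z, z') ∨ e.1 = (z', z)) ∧
      HasTrail n z' (insert e F) A

open Classical in
/-- The edges at a site. -/
def star (z : Λ) : Finset (PosEdge Λ) := Finset.univ.filter fun e => e.1.1 = z ∨ e.1.2 = z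

-- An edge at `z` is determined by its axis and by which of its ends is `z`.
open Classical in
lemma card_star_le (z : Λ) : (star z).card ≤ 6 := by
  choose dir hdir using fun e : PosEdge Λ => e.2
  have h := Finset.card_le_card_of_injOn (s := star z) (t := (Finset.univ : Finset (Fin 3 × Bool)))
    (fun e => (dir e, decide (e.1.1 = z))) (fun _ _ => Finset.mem_univ _) (by
      intro e he e' he' hee
      obtain ⟨h1, h2⟩ := Prod.ext_iff.1 hee
      simp only [decide_eq_decide] at h1 h2
      have he := (Finset.mem_filter.1 he).2
      have he' := (Finset.mem_filter.1 he').2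
      have k1 := hdir e
      have k2 := hdir e'
      rw [← h1] at k2
      refine Subtype.ext (Prod.ext ?_ ?_)
      · by_cases hz : e.1.1 = z
        · rw [hz, h2.1 hz]
        · have hz' := he.resolve_left hz
          have hz'' := he'.resolve_left fun h => hz (h2.2 h)
          rw [hz'] at k1
          rw [hz''] at k2
          exact Subtype.ext (add_right_cancel (k1.symm.trans k2))
      · by_cases hz : e.1.1 = z
        · rw [hz] at k1
          rw [h2.1 hz] at k2
          exact Subtype.ext (k1.trans k2.symm)
        · rw [he.resolve_left hz, he'.resolve_left fun h => hz (h2.2 h)])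
  simpa using h

lemma sum_biUnion_le {α κ : Type*} [DecidableEq α] {W : α → ℝ} (hW : ∀ a, 0 ≤ W a)
    (s : Finset κ) (t : κ → Finset α) :
    ∑ a ∈ s.biUnion t, W a ≤ ∑ k ∈ s, ∑ a ∈ t k, W a := by
  classical
  induction s using Finset.induction_on with
  | empty => simp
  | insert k s hk ih =>
    rw [Finset.biUnion_insert, Finset.sum_insert hk]
    have h1 := Finset.sum_union_inter (s₁ := t k) (s₂ := s.biUnion t) (f := W)
    have h2 : 0 ≤ ∑ a ∈ t k ∩ s.biUnion t, W a := Finset.sum_nonneg fun a _ => hW a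
    linarith

-- Removing `e` maps the sets that contain `insert e F` injectively to sets that contain `F`, and
-- each removal gains a factor `q`.
open Classical in
lemma sum_superset_insert_le {W : Finset (PosEdge Λ) → ℝ} {q : ℝ} (hq : 0 ≤ q)
    (hW0 : ∀ A, 0 ≤ W A) (hW : ∀ A, ∀ e ∉ A, W (insert e A) ≤ q * W A)
    {F : Finset (PosEdge Λ)} {e : PosEdge Λ} (he : e ∉ F) :
    ∑ A ∈ Finset.univ.filter fun A => insert e F ⊆ A, W A
      ≤ q * ∑ A ∈ Finset.univ.filter fun A => F ⊆ A, W A := by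
  set s := (Finset.univ : Finset (Finset (PosEdge Λ))).filter fun A => insert e F ⊆ A
  have hs : ∀ A ∈ s, e ∈ A := fun A hA =>
    (Finset.mem_filter.1 hA).2 (Finset.mem_insert_self e F)
  have hinj : Set.InjOn (fun A : Finset (PosEdge Λ) => A.erase e) s := by
    intro A hA B hB hAB
    have hAB : A.erase e = B.erase e := hAB
    rw [← Finset.insert_erase (hs A hA), hAB, Finset.insert_erase (hs B hB)]
  calc ∑ A ∈ s, W A ≤ ∑ A ∈ s, q * W (A.erase e) := by
        refine Finset.sum_le_sum fun A hA => ?_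
        have := hW (A.erase e) e (Finset.notMem_erase e A)
        rwa [Finset.insert_erase (hs A hA)] at this
    _ = q * ∑ B ∈ s.image fun A => A.erase e, W B := by
        rw [← Finset.mul_sum, Finset.sum_image hinj]
    _ ≤ _ := by
        refine mul_le_mul_of_nonneg_left (Finset.sum_le_sum_of_subset_of_nonneg ?_
          fun A _ _ => hW0 A) hq
        intro B hB
        obtain ⟨A, hA, rfl⟩ := Finset.mem_image.1 hB
        refine Finset.mem_filter.2 ⟨Finset.mem_univ _, fun f hf => Finset.mem_erase.2 ⟨?_, ?_⟩⟩
        · rintro rfl; exact he hf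
        · exact (Finset.mem_filter.1 hA).2 (Finset.mem_insert_of_mem hf)

open Classical in
/-- A union bound over trails. -/
lemma sum_hasTrail_le {W : Finset (PosEdge Λ) → ℝ} {q : ℝ} (hq : 0 ≤ q)
    (hW0 : ∀ A, 0 ≤ W A) (hW : ∀ A, ∀ e ∉ A, W (insert e A) ≤ q * W A) (n : ℕ) (z : Λ)
    (F : Finset (PosEdge Λ)) :
    ∑ A ∈ Finset.univ.filter fun A => F ⊆ A ∧ HasTrail n z F A, W A
      ≤ (6 * q) ^ n * ∑ A ∈ Finset.univ.filter fun A => F ⊆ A, W A := by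
  induction n generalizing z F with
  | zero => simp [HasTrail]
  | succ n ih =>
    set other : PosEdge Λ → Λ := fun e => if e.1.1 = z then e.1.2 else e.1.1 with hother
    set Z := ∑ A ∈ Finset.univ.filter fun A => F ⊆ A, W A
    have hZ : 0 ≤ Z := Finset.sum_nonneg fun A _ => hW0 A
    -- Split according to the first edge of the trail: there are at most six choices, each costs a
    -- factor `q`, and the edge joins `F` so that it is not charged again.
    have hsub : (Finset.univ.filter fun A => F ⊆ A ∧ HasTrail (n + 1) z F A)
        ⊆ ((star z).filter fun e => e ∉ F).biUnion fun e =>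
          Finset.univ.filter fun A => insert e F ⊆ A ∧ HasTrail n (other e) (insert e F) A := by
      intro A hA
      obtain ⟨hFA, e, heA, heF, z', hz', ht⟩ := (Finset.mem_filter.1 hA).2
      refine Finset.mem_biUnion.2 ⟨e, Finset.mem_filter.2 ⟨Finset.mem_filter.2
        ⟨Finset.mem_univ _, ?_⟩, heF⟩, Finset.mem_filter.2 ⟨Finset.mem_univ _,
        Finset.insert_subset heA hFA, ?_⟩⟩
      · rcases hz' with h | h <;> simp [h]
      · have : other e = z' := by
          rcases hz' with h | h
          · simp [hother, h]
          · simp only [hother, h]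
            split_ifs with h2
            · exact h2.symm
            · rfl
        rwa [this]
    calc _ ≤ ∑ A ∈ ((star z).filter fun e => e ∉ F).biUnion fun e =>
          Finset.univ.filter fun A => insert e F ⊆ A ∧ HasTrail n (other e) (insert e F) A, W A :=
          Finset.sum_le_sum_of_subset_of_nonneg hsub fun A _ _ => hW0 A
      _ ≤ ∑ e ∈ (star z).filter fun e => e ∉ F, ∑ A ∈ Finset.univ.filter fun A =>
          insert e F ⊆ A ∧ HasTrail n (other e) (insert e F) A, W A := by
          exact sum_biUnion_le hW0 _ _
      _ ≤ ∑ e ∈ (star z).filter fun e => e ∉ F, (6 * q) ^ n * (q * Z) := by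
          refine Finset.sum_le_sum fun e he => (ih (other e) (insert e F)).trans ?_
          exact mul_le_mul_of_nonneg_left
            (sum_superset_insert_le hq hW0 hW (Finset.mem_filter.1 he).2) (by positivity)
      _ ≤ 6 * ((6 * q) ^ n * (q * Z)) := by
          rw [Finset.sum_const, nsmul_eq_mul]
          refine mul_le_mul_of_nonneg_right ?_ (by positivity)
          exact_mod_cast (Finset.card_filter_le _ _).trans (card_star_le z)
      _ = (6 * q) ^ (n + 1) * Z := by ring

/-- The graph on the sites of `Λ` with the given edges. -/
def edgeGraph (A : Finset (PosEdge Λ)) : SimpleGraph Λ :=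
  SimpleGraph.fromRel fun u v => ∃ e ∈ A, e.1 = (u, v)

lemma exists_edge_of_adj {A : Finset (PosEdge Λ)} {u v : Λ} (h : (edgeGraph A).Adj u v) :
    ∃ e ∈ A, e.1 = (u, v) ∨ e.1 = (v, u) := by
  rw [edgeGraph, SimpleGraph.fromRel_adj] at h
  rcases h.2 with ⟨e, he, h⟩ | ⟨e, he, h⟩
  exacts [⟨e, he, Or.inl h⟩, ⟨e, he, Or.inr h⟩]

lemma edgeGraph_adj_of_mem {A : Finset (PosEdge Λ)} {e : PosEdge Λ} (he : e ∈ A) :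
    (edgeGraph A).Adj e.1.1 e.1.2 := by
  rw [edgeGraph, SimpleGraph.fromRel_adj]
  refine ⟨fun h => ?_, Or.inl ⟨e, he, rfl⟩⟩
  obtain ⟨k, hk⟩ := e.2
  rw [h] at hk
  have := congrFun hk k
  simp at this

open Classical in
lemma hasTrail_of_walk {A : Finset (PosEdge Λ)} {u v : Λ} (p : (edgeGraph A).Walk u v) (hp : p.IsTrail)
    (F : Finset (PosEdge Λ)) (hF : ∀ e ∈ F, s(e.1.1, e.1.2) ∉ p.edges) (n : ℕ) (hn : n ≤ p.length) :
    HasTrail n u F A := by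
  induction p generalizing F n with
  | nil =>
    have : n = 0 := by simpa using hn
    subst this; trivial
  | @cons u w v h p ih =>
    match n with
    | 0 => trivial
    | n + 1 =>
      rw [SimpleGraph.Walk.isTrail_cons] at hp
      obtain ⟨e, he, hends⟩ := exists_edge_of_adj h
      have hsym : s(e.1.1, e.1.2) = s(u, w) := by
        rcases hends with h | h <;> rw [h]
        exact Sym2.eq_swap
      refine ⟨e, he, fun heF => hF e heF (by simp [hsym]), w, hends, ih hp.1 _ ?_ n (by simpa using hn)⟩
      intro f hf
      rcases Finset.mem_insert.1 hf with rfl | hf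
      · rw [hsym]; exact hp.2
      · exact fun hm => hF f hf (by simp [hm])

/-- The distance of two sites in the lattice. -/
def l1dist (x y : Site) : ℕ := ∑ k, (x k - y k).natAbs

lemma l1dist_le_length {A : Finset (PosEdge Λ)} {u v : Λ} (p : (edgeGraph A).Walk u v) :
    l1dist u v ≤ p.length := by
  induction p with
  | nil => simp [l1dist]
  | @cons u w v h p ih =>
    have htri : l1dist u v ≤ l1dist u w + l1dist w v := by
      unfold l1dist
      rw [← Finset.sum_add_distrib]
      exact Finset.sum_le_sum fun k _ => by omega
    have hone : l1dist u w = 1 := by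
      obtain ⟨e, -, h⟩ := exists_edge_of_adj h
      obtain ⟨k, hk⟩ := e.2
      unfold l1dist
      rcases h with h | h <;> rw [h] at hk <;> rw [hk] <;>
        simp [Pi.single_apply, apply_ite Int.natAbs]
    rw [SimpleGraph.Walk.length_cons]
    omega

lemma hasTrail_of_reachable {A : Finset (PosEdge Λ)} {x y : Λ} (h : (edgeGraph A).Reachable x y) :
    HasTrail (l1dist x y) x ∅ A := by
  obtain ⟨p, hp⟩ := h.exists_isPath
  exact hasTrail_of_walk p hp.isTrail ∅ (by simp) _ (l1dist_le_length p)

lemma norm_toR3_sub_le_l1dist (x y : Site) : ‖toR3 x - toR3 y‖ ≤ l1dist x y := by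
  refine le_of_sq_le_sq ?_ (Nat.cast_nonneg _)
  rw [norm_toR3_sub_sq, l1dist]
  simp only [Fin.sum_univ_three]
  push_cast
  have h : ∀ k, ((x k : ℝ) - y k) ^ 2 = ((|x k - y k| : ℤ) : ℝ) ^ 2 := fun k => by
    push_cast; rw [sq_abs]
  have h0 : ∀ k, (0 : ℝ) ≤ ((|x k - y k| : ℤ) : ℝ) := fun k => by positivity
  simp only [Nat.cast_natAbs, h]
  nlinarith [mul_nonneg (h0 0) (h0 1), mul_nonneg (h0 0) (h0 2), mul_nonneg (h0 1) (h0 2)]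

/-! #### The high temperature expansion -/

/-- The excess of the Boltzmann factor of an edge. -/
def excess (β : ℝ) (ω : Disorder Λ) (e : PosEdge Λ) (S : Λ → S2) : ℝ :=
  Real.exp (β * (1 + inner ℝ (S e.1.1 : R3) (rot (ω e) (S e.1.2 : R3)))) - 1

lemma cont_excess (β : ℝ) (ω : Disorder Λ) (e : PosEdge Λ) : Continuous (excess β ω e) := by
  have : Continuous fun S : Λ → S2 => rot (ω e) (S e.1.2 : R3) :=
    cont_rot continuous_const (cont_spin continuous_id _)
  unfold excess
  fun_prop

/-- The shift of the exponent by `β`, undone by a constant factor per edge, makes all terms of the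
expansion nonnegative, as a union bound requires. -/
lemma excess_nonneg {β : ℝ} (hβ : 0 ≤ β) (ω : Disorder Λ) (e : PosEdge Λ) (S : Λ → S2) :
    0 ≤ excess β ω e S := by
  have h := abs_real_inner_le_norm (S e.1.1 : R3) (rot (ω e) (S e.1.2 : R3))
  rw [norm_rot, norm_eq_of_mem_sphere, norm_eq_of_mem_sphere, mul_one] at h
  unfold excess
  have := Real.one_le_exp (mul_nonneg hβ (by linarith [(abs_le.1 h).1] : (0 : ℝ) ≤
    1 + inner ℝ (S e.1.1 : R3) (rot (ω e) (S e.1.2 : R3))))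
  linarith

lemma excess_le {β : ℝ} (hβ : 0 ≤ β) (ω : Disorder Λ) (e : PosEdge Λ) (S : Λ → S2) :
    excess β ω e S ≤ Real.exp (2 * β) - 1 := by
  have h := abs_real_inner_le_norm (S e.1.1 : R3) (rot (ω e) (S e.1.2 : R3))
  rw [norm_rot, norm_eq_of_mem_sphere, norm_eq_of_mem_sphere, mul_one] at h
  unfold excess
  have := Real.exp_le_exp.2 (by nlinarith [(abs_le.1 h).2] :
    β * (1 + inner ℝ (S e.1.1 : R3) (rot (ω e) (S e.1.2 : R3))) ≤ 2 * β)
  linarith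

lemma exp_logWeight_eq (β : ℝ) (ω : Disorder Λ) (S : Λ → S2) :
    Real.exp (logWeight β ω S)
      = Real.exp (-β * Fintype.card (PosEdge Λ)) * ∑ A : Finset (PosEdge Λ), ∏ e ∈ A, excess β ω e S := by
  have h1 : ∑ A : Finset (PosEdge Λ), ∏ e ∈ A, excess β ω e S = ∏ e, (1 + excess β ω e S) := by
    rw [Finset.prod_one_add, Finset.powerset_univ]
  have h2 : ∀ e : PosEdge Λ, 1 + excess β ω e S
      = Real.exp (β * (1 + inner ℝ (S e.1.1 : R3) (rot (ω e) (S e.1.2 : R3)))) := fun e => by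
    unfold excess; ring
  rw [h1, logWeight_eq]
  simp only [h2]
  rw [← Real.exp_sum, ← Real.exp_add]
  congr 1
  simp only [mul_add, mul_one, Finset.sum_add_distrib, Finset.sum_const, Finset.card_univ,
    nsmul_eq_mul]
  ring

open Classical in
/-- The reversal of all spins in a set of sites. -/
def flipSpins (C : Set Λ) (S : Λ → S2) : Λ → S2 := fun u => if u ∈ C then -S u else S u

lemma measurePreserving_flipSpins (C : Set Λ) :
    MeasurePreserving (flipSpins C) (unifSpins Λ) (unifSpins Λ) := by
  classical
  refine measurePreserving_pi (fun _ => unifS2) (fun _ => unifS2)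
    (f := fun u s => if u ∈ C then -s else s) fun u => ?_
  by_cases hu : u ∈ C
  · simpa [hu] using measurePreserving_neg_S2
  · simp only [hu, if_false]
    exact MeasurePreserving.id _

/-- Edge sets that do not connect `x` and `y` do not contribute to the correlation. -/
lemma integral_inner_mul_prod_eq_zero (β : ℝ) (ω : Disorder Λ) {A : Finset (PosEdge Λ)} {x y : Λ}
    (h : ¬ (edgeGraph A).Reachable x y) :
    ∫ S, inner ℝ (S x : R3) (S y : R3) * ∏ e ∈ A, excess β ω e S ∂(unifSpins Λ) = 0 := by
  -- Reversing the spins in the cluster of `x` leaves the factors of `A` unchanged, since each edge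
  -- of `A` has both ends inside or both outside. It changes the sign of `S x` but not that of `S
  -- y`.
  set C : Set Λ := {u | (edgeGraph A).Reachable x u} with hC
  have hx : x ∈ C := SimpleGraph.Reachable.refl x
  have hy : y ∉ C := h
  have hprod : ∀ S : Λ → S2, ∏ e ∈ A, excess β ω e (flipSpins C S) = ∏ e ∈ A, excess β ω e S := by
    intro S
    refine Finset.prod_congr rfl fun e he => ?_
    have hadj := (edgeGraph_adj_of_mem he).reachable
    by_cases h1 : e.1.1 ∈ C
    · have h2 : e.1.2 ∈ C := SimpleGraph.Reachable.trans h1 hadj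
      have e1 : (flipSpins C S e.1.1 : R3) = -(S e.1.1 : R3) := by simp [flipSpins, h1]
      have e2 : (flipSpins C S e.1.2 : R3) = -(S e.1.2 : R3) := by simp [flipSpins, h2]
      simp only [excess, e1, e2, rot_neg, inner_neg_neg]
    · have h2 : e.1.2 ∉ C := fun h2 => h1 (SimpleGraph.Reachable.trans h2 hadj.symm)
      simp only [excess, flipSpins, h1, h2, if_false]
  have hcont : Continuous fun S : Λ → S2 =>
      inner ℝ (S x : R3) (S y : R3) * ∏ e ∈ A, excess β ω e S :=
    Continuous.mul (by fun_prop) (continuous_finsetProd _ fun e _ => cont_excess β ω e)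
  have hflip := integral_comp_of_cont (measurePreserving_flipSpins C) hcont
  have e1 : ∀ S, (flipSpins C S x : R3) = -(S x : R3) := fun S => by simp [flipSpins, hx]
  have e2 : ∀ S, (flipSpins C S y : R3) = (S y : R3) := fun S => by simp [flipSpins, hy]
  simp only [hprod, e1, e2, inner_neg_left, neg_mul] at hflip
  rw [integral_neg] at hflip
  linarith

/-- Exponential decay of correlations at high temperature, for every disorder. -/
lemma integral_gibbs_inner_le {β : ℝ} (hβ : 0 ≤ β) (ω : Disorder Λ) (x y : Λ) :
    ∫ S, inner ℝ (S x : R3) (S y : R3) ∂(gibbs β ω)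
      ≤ (6 * (Real.exp (2 * β) - 1)) ^ l1dist x y := by
  classical
  set q := Real.exp (2 * β) - 1 with hq
  have hq0 : 0 ≤ q := by have := Real.one_le_exp (by linarith : 0 ≤ 2 * β); linarith
  have hPc : ∀ A : Finset (PosEdge Λ), Continuous fun S => ∏ e ∈ A, excess β ω e S := fun A =>
    continuous_finsetProd _ fun e _ => cont_excess β ω e
  have hP0 : ∀ (A : Finset (PosEdge Λ)) S, 0 ≤ ∏ e ∈ A, excess β ω e S := fun A S =>
    Finset.prod_nonneg fun e _ => excess_nonneg hβ ω e S
  set W : Finset (PosEdge Λ) → ℝ := fun A => ∫ S, ∏ e ∈ A, excess β ω e S ∂(unifSpins Λ) with hW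
  have hW0 : ∀ A, 0 ≤ W A := fun A => integral_nonneg (hP0 A)
  have hWq : ∀ A, ∀ e ∉ A, W (insert e A) ≤ q * W A := by
    intro A e he
    simp only [hW]
    rw [← integral_const_mul]
    refine integral_mono (integrable_of_cont _ (hPc _))
      (integrable_of_cont _ ((hPc A).const_mul q)) fun S => ?_
    simp only [Finset.prod_insert he]
    exact mul_le_mul_of_nonneg_right (excess_le hβ ω e S) (hP0 A S)
  have hIc : ∀ A : Finset (PosEdge Λ), Continuous fun S : Λ → S2 =>
      inner ℝ (S x : R3) (S y : R3) * ∏ e ∈ A, excess β ω e S := fun A =>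
    Continuous.mul (by fun_prop) (hPc A)
  have hI : ∀ A, ∫ S, inner ℝ (S x : R3) (S y : R3) * ∏ e ∈ A, excess β ω e S ∂(unifSpins Λ)
      ≤ if HasTrail (l1dist x y) x ∅ A then W A else 0 := by
    intro A
    split_ifs with h
    · refine integral_mono (integrable_of_cont _ (hIc A)) (integrable_of_cont _ (hPc A)) fun S => ?_
      have h1 := real_inner_le_norm (S x : R3) (S y : R3)
      rw [norm_eq_of_mem_sphere, norm_eq_of_mem_sphere, mul_one] at h1
      exact mul_le_of_le_one_left (hP0 A S) h1
    · exact (integral_inner_mul_prod_eq_zero β ω fun hr => h (hasTrail_of_reachable hr)).le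
  have hZ := partition_pos β ω
  have hexp := Real.exp_pos (-β * Fintype.card (PosEdge Λ))
  set κ := Real.exp (-β * Fintype.card (PosEdge Λ)) with hκ
  have hZeq : ∫ S, Real.exp (logWeight β ω S) ∂(unifSpins Λ) = κ * ∑ A, W A := by
    simp only [exp_logWeight_eq, hW]
    rw [integral_const_mul, integral_finsetSum _ fun A _ => integrable_of_cont _ (hPc A)]
  have hNeq : ∫ S, Real.exp (logWeight β ω S) * inner ℝ (S x : R3) (S y : R3) ∂(unifSpins Λ)
      = κ * ∑ A, ∫ S, inner ℝ (S x : R3) (S y : R3) * ∏ e ∈ A, excess β ω e S ∂(unifSpins Λ) := by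
    rw [← integral_finsetSum _ fun A _ => integrable_of_cont _ (hIc A), ← integral_const_mul]
    refine integral_congr_ae (Filter.Eventually.of_forall fun S => ?_)
    simp only [exp_logWeight_eq]
    rw [← Finset.mul_sum]
    ring
  -- The common factor `κ` cancels; what remains is the weight of the edge sets with a long trail
  -- from `x`, against the total weight.
  rw [integral_gibbs, div_le_iff₀ hZ, hNeq, hZeq, mul_left_comm]
  refine mul_le_mul_of_nonneg_left ((Finset.sum_le_sum fun A _ => hI A).trans ?_) hexp.le
  rw [← Finset.sum_filter]
  simpa using sum_hasTrail_le hq0 hW0 hWq (l1dist x y) x ∅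

theorem exists_correlation_le : ∃ β₀ : ℝ, 0 < β₀ ∧ ∀ β : ℝ, 0 < β → β ≤ β₀ →
    ∃ c : ℝ, 0 < c ∧ ∀ (Λ : Finset Site) (x y : Λ),
      correlation β Λ x y ≤ Real.exp (-c * ‖toR3 x - toR3 y‖) := by
  -- Then `exp (2 β) ≤ exp (1 / 24) ≤ 24 / 23`, so the ratio `r` is at most `6 / 23`.
  refine ⟨1 / 48, by norm_num, fun β hβ hβ' => ?_⟩
  set r := 6 * (Real.exp (2 * β) - 1) with hr
  have hr0 : 0 < r := by
    have := Real.one_lt_exp_iff.2 (by linarith : 0 < 2 * β)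
    rw [hr]; linarith
  have hr1 : r < 1 := by
    have h1 : Real.exp (2 * β) ≤ Real.exp (1 / 24) := Real.exp_le_exp.2 (by linarith)
    have h2 : Real.exp (-(1 / 24)) * Real.exp (1 / 24) = 1 := by rw [← Real.exp_add]; simp
    have h3 := Real.add_one_le_exp (-(1 / 24))
    have h4 := Real.exp_pos (1 / 24)
    rw [hr]
    nlinarith
  refine ⟨-Real.log r, neg_pos.2 (Real.log_neg hr0 hr1), fun Λ x y => ?_⟩
  have hF : Continuous (Function.uncurry fun (_ : Disorder Λ) (S : Λ → S2) =>
      inner ℝ (S x : R3) (S y : R3)) := by unfold Function.uncurry; fun_prop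
  have h1 : correlation β Λ x y ≤ r ^ l1dist x y := by
    unfold correlation
    calc _ ≤ ∫ _ : Disorder Λ, r ^ l1dist x y ∂(disorderLaw β Λ) :=
          integral_mono (integrable_gibbs_integral β hF) (integrable_const _) fun ω =>
            integral_gibbs_inner_le hβ.le ω x y
      _ = _ := by simp
  refine h1.trans ?_
  rw [← Real.exp_log (pow_pos hr0 _), Real.log_pow, Real.exp_le_exp, neg_neg]
  have h2 := norm_toR3_sub_le_l1dist x y
  have h3 := Real.log_neg hr0 hr1
  nlinarith

end HighTemperature

end

end NishimoriHeisenberg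

theorem theorem4p2 :
    (∃ βstar a : ℝ, 0 < βstar ∧ 0 < a ∧ ∀ β : ℝ, βstar ≤ β →
      ∀ (Λ : Finset NishimoriHeisenberg.Site) (x y : Λ),
        NishimoriHeisenberg.FarFromBoundary Λ x y →
          1 - Real.sqrt (a * Real.log β / β) ≤ NishimoriHeisenberg.correlation β Λ x y) ∧
    (∃ β₀ : ℝ, 0 < β₀ ∧ ∀ β : ℝ, 0 < β → β ≤ β₀ →
      ∃ c : ℝ, 0 < c ∧ ∀ (Λ : Finset NishimoriHeisenberg.Site) (x y : Λ),
        NishimoriHeisenberg.correlation β Λ x y ≤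
          Real.exp (-c * ‖NishimoriHeisenberg.toR3 x - NishimoriHeisenberg.toR3 y‖)) :=
  ⟨NishimoriHeisenberg.exists_correlation_ge, NishimoriHeisenberg.exists_correlation_le⟩
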